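/- **Notation.** Let $n\in\mathbb N$, and let $D=D(\mathbb R^n)$ be the space of (real- or complex-valued) compactly supported smooth functions. Let $S'_e$ be the set of distributions $f\in D'(\mathbb R^n)$ for which there are $C_f,N_f$ with $|\langle f,\varphi\rangle|\le C_f\sup\{|D^\beta\varphi(x)|e^{N_f|x|}: x\in\mathbb R^n,\ |\beta|\le N_f\}$ for all $\varphi\in D$. For $g_0\in D$ put $g:=g_0-2^{-n}g_0(\cdot/2)$ and $g_k:=2^{kn}g(2^k\,\cdot)$ for $k\ge1$, the term of index $0$ being $g_0$ itself. For $\psi\in D$, $L_\psi$ is the largest integer $L$ such that $\int x^\beta\psi(x)\,dx=0$ for all multi-indices $|\beta|\le L$. For a sequence $\{t_k\}_{k\ge0}$ of weights (measurable, a.e. positive functions on $\mathbb R^n$) set $$\|f|B^{g_0}_{p,q}(\mathbb R^n,\{t_k\})\|:=\Big(\sum_{k=0}^\infty\|t_k(g_k*f)|L_p(\mathbb R^n)\|^q\Big)^{1/q}\in[0,\infty]$$ (supremum if $q=\infty$). Let $Q_{k,m}:=\prod_{i=1}^n(m_i2^{-k},(m_i+1)2^{-k})$ for $k\in\mathbb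 N_0$, $m\in\mathbb Z^n$. For sequences $\alpha^1=\{\alpha^1_k\}$, $\alpha^2=\{\alpha^2_k\}$ of positive numbers, $\alpha=(\alpha^1,\alpha^2)$, $\alpha_3\ge0$ and $p,\sigma_1,\sigma_2\in(0,\infty]$, $\sigma=(\sigma_1,\sigma_2)$, the class $X^{\alpha_3}_{\alpha,\sigma,p}$ consists of all weight sequences with $t_k\in L_p^{\rm loc}(\mathbb R^n)$ for every $k$ such that, for some $C_1,C_2>0$ and all $0\le k\le j$, $m\in\mathbb Z^n$, $$\Big(2^{kn}\!\int_{Q_{k,m}}\!t_k^p\Big)^{1/p}\Big(2^{kn}\!\int_{Q_{k,m}}\!t_j^{-\sigma_1}\Big)^{1/\sigma_1}\le C_1\frac{\alpha^1_k}{\alpha^1_j},\qquad \Big(2^{kn}\!\int_{Q_{k,m}}\!t_k^p\Big)^{-1/p}\Big(2^{kn}\!\int_{Q_{k,m}}\!t_j^{\sigma_2}\Big)^{1/\sigma_2}\le C_2\frac{\alpha^2_j}{\alpha^2_k}$$ (essential suprema for infinite exponents), and, with $t_{k,m}:=\|t_k|L_p(Q_{k,m})\|$, $0<t_{k,m}\le2^{\alpha_3}t_{k,\widetilde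 m}$ whenever $|m_i-\widetilde m_i|\le1$ for all $i$. For $r\in(0,p]$ let $p_r:=p/r$ ($p_r:=1$ if $p=r$, also when $p=r=\infty$) and let $p'_r$ be its Hölder conjugate, with $rp'_r:=\infty$ if $p'_r=\infty$; $q_\mu:=q/\mu$. For $s\in[1,\infty]$ with Hölder conjugate $s'$ and a sequence $\{\beta_k\}_{k\ge0}$ of positive numbers, consider the conditions (with suprema in place of sums for infinite exponents) $$\text{(2.12)}\quad\sup_{N\in\mathbb N}\Big(\sum_{k=0}^{N}\beta_k^{s}\Big)^{1/s}\Big(\sum_{k=N}^{\infty}\beta_k^{-s'}\Big)^{1/s'}<\infty,\qquad \text{(2.13)}\quad\sup_{N\in\mathbb N}\Big(\sum_{k=N}^{\infty}\beta_k^{s}\Big)^{1/s}\Big(\sum_{k=0}^{N}\beta_k^{-s'}\Big)^{1/s'}<\infty .$$ **Theorem 3.2.** Let $p,q\in(0,\infty]$, $r\in(0,p]$, $\sigma_1=rp'_r$, $\sigma_2=p$, $\alpha_3\ge0$, let $\{\alpha^1_k\}$, $\{\alpha^2_k\}$ be sequences of positive real numbers, and let $\{t_k\}\in X^{\alpha_3}_{\alpha,\sigma,p}$.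 Let $\varphi_0\in D$ with $\int\varphi_0\,dx=1$, let $\zeta_0\in D$, and $\zeta:=\zeta_0-2^{-n}\zeta_0(\cdot/2)$. Assume that, for some $A>0$ and $\mu\in(0,\min\{1,q,r\}]$, condition (2.12) holds with $s=q_\mu$, $\beta_k=(2^{kA}\alpha^1_k)^\mu$, and condition (2.13) holds with $s=q_\mu$, $\beta_k=(2^{-k(1+L_\zeta)}\alpha^2_k)^\mu$. (If $\zeta_0=0$, put $L_\zeta:=0$.) Then there is a constant $C>0$ such that, for all $f\in S'_e$, $$\|f|B^{\zeta_0}_{p,q}(\mathbb R^n,\{t_k\})\|\le C\,\|f|B^{\varphi_0}_{p,q}(\mathbb R^n,\{t_k\})\| .$$ -/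

import Mathlib

open MeasureTheory Set
open scoped ENNReal NNReal Distributions

noncomputable section

namespace VarBesov

/-- Euclidean space `ℝⁿ`. -/
abbrev Eu (n : ℕ) : Type := EuclideanSpace ℝ (Fin n)

/-- `D(ℝⁿ)`: compactly supported smooth functions with values in `𝕜` (`ℝ` or `ℂ`), with the
standard topology. -/
abbrev TestFun (n : ℕ) (𝕜 : Type*) [RCLike 𝕜] := 𝓓((⊤ : TopologicalSpace.Opens (Eu n)), 𝕜)

/-- `D'(ℝⁿ)`: continuous linear functionals on `D(ℝⁿ)`. -/
abbrev Distr (n : ℕ) (𝕜 : Type*) [RCLike 𝕜] := TestFun n 𝕜 →L[𝕜] 𝕜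

section Kernels

variable {n : ℕ} {𝕜 : Type*} [RCLike 𝕜]

/-- The test function `y ↦ φ (a y + b)`, for `a ≠ 0`. -/
def compAffine (φ : TestFun n 𝕜) (a : ℝ) (ha : a ≠ 0) (b : Eu n) : TestFun n 𝕜 where
  toFun y := φ (a • y + b)
  contDiff' := φ.contDiff.comp ((contDiff_id.const_smul a).add contDiff_const)
  hasCompactSupport' :=
    φ.hasCompactSupport.comp_homeomorph
      ((Homeomorph.smulOfNeZero a ha).trans (Homeomorph.addRight b))
  tsupport_subset' := fun _ _ => trivial

@[simp]
theorem compAffine_apply (φ : TestFun n 𝕜) (a : ℝ) (ha : a ≠ 0) (b y : Eu n) :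
    compAffine φ a ha b y = φ (a • y + b) := rfl

/-- `φ = φ₀ - 2⁻ⁿ φ₀(· / 2)`. -/
def diffKernel (φ₀ : TestFun n 𝕜) : TestFun n 𝕜 :=
  φ₀ - ((2 : 𝕜) ^ n)⁻¹ • compAffine φ₀ 2⁻¹ (by norm_num) 0

/-- The dilation `2^{jn} g(2^j ·)`. -/
def dilate (j : ℕ) (g : TestFun n 𝕜) : TestFun n 𝕜 :=
  ((2 : 𝕜) ^ (j * n)) • compAffine g ((2 : ℝ) ^ j) (by positivity) 0

/-- The kernel sequence `φ₀, φ₁, φ₂, …`: the term of index `0` is `φ₀` itself, and the term of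
index `k ≥ 1` is `2^{kn} φ(2^k ·)` with `φ = φ₀ - 2⁻ⁿ φ₀(· / 2)`. -/
def kernelSeq (φ₀ : TestFun n 𝕜) : ℕ → TestFun n 𝕜
  | 0 => φ₀
  | k + 1 => dilate (k + 1) (diffKernel φ₀)

/-- The convolution of a test function with a distribution, `(φ ∗ f)(x) = ⟨f, φ(x - ·)⟩`. -/
def conv (φ : TestFun n 𝕜) (f : Distr n 𝕜) (x : Eu n) : 𝕜 :=
  f (compAffine φ (-1) (by norm_num) x)

/-- `S'_e(ℝⁿ)`: the distributions `f` for which there are `N`, `C` with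
`|⟨f, φ⟩| ≤ C sup {|D^β φ(x)| exp (N |x|) : x ∈ ℝⁿ, |β| ≤ N}` for all `φ ∈ D(ℝⁿ)`.
All derivatives of order `i` are measured together, by the norm of the `i`-th Fréchet
derivative; this changes the supremum at most by a factor that depends only on `n` and `N`. -/
def ExpDistr (n : ℕ) (𝕜 : Type*) [RCLike 𝕜] : Set (Distr n 𝕜) :=
  {f | ∃ (N : ℕ) (C : ℝ≥0), ∀ φ : TestFun n 𝕜,
    ‖f φ‖ₑ ≤ C * ⨆ (i : ℕ) (_ : i ≤ N) (x : Eu n),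
      ‖iteratedFDeriv ℝ i φ x‖ₑ * ENNReal.ofReal (Real.exp (N * ‖x‖))}

/-- `L_ψ`: the largest integer `L` with `∫ x^β ψ(x) dx = 0` for all multi-indices `β` with
`|β| ≤ L`. It is `-1` if `∫ ψ ≠ 0`. The set of such `L` is unbounded only for `ψ = 0`; the
supremum then takes the default value `0`. -/
def momentOrder (ψ : TestFun n 𝕜) : ℤ :=
  sSup {L : ℤ | ∀ β : Fin n → ℕ, ((∑ i, β i : ℕ) : ℤ) ≤ L →
    ∫ x : Eu n, (∏ i, x i ^ β i) • ψ x = 0}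

end Kernels

/-- The `ℓ_s` quasi-norm over the index set `S` of a sequence with values in `[0, ∞]`. -/
def lNorm (s : ℝ≥0∞) (S : Set ℕ) (a : ℕ → ℝ≥0∞) : ℝ≥0∞ :=
  if s = ∞ then ⨆ k ∈ S, a k
  else (∑' k : S, a k ^ s.toReal) ^ (1 / s.toReal)

/-- The exponent `p_r = p / r`, with `p_r = 1` for `p = r`, also if both are infinite. -/
def relExp (p r : ℝ≥0∞) : ℝ≥0∞ := if p = r then 1 else p / r

/-- The first Hardy condition for the sequence `β` and the exponent `s ∈ [1, ∞]`:
`sup_{n ≥ 1} (∑_{k ≤ n} β_k^s)^{1/s} (∑_{k ≥ n} β_k^{-s'})^{1/s'} < ∞`. -/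
def HardyTail (s : ℝ≥0∞) (β : ℕ → ℝ) : Prop :=
  (⨆ (n : ℕ) (_ : 1 ≤ n),
    lNorm s (Iic n) (fun k => ENNReal.ofReal (β k)) *
      lNorm s.conjExponent (Ici n) (fun k => ENNReal.ofReal (β k)⁻¹)) < ∞

/-- The second Hardy condition for the sequence `β` and the exponent `s ∈ [1, ∞]`:
`sup_{n ≥ 1} (∑_{k ≥ n} β_k^s)^{1/s} (∑_{k ≤ n} β_k^{-s'})^{1/s'} < ∞`. -/
def HardyHead (s : ℝ≥0∞) (β : ℕ → ℝ) : Prop :=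
  (⨆ (n : ℕ) (_ : 1 ≤ n),
    lNorm s (Ici n) (fun k => ENNReal.ofReal (β k)) *
      lNorm s.conjExponent (Iic n) (fun k => ENNReal.ofReal (β k)⁻¹)) < ∞

section Weights

variable {n : ℕ}

/-- The open dyadic cube `Q_{k,m} = ∏ᵢ (mᵢ / 2^k, (mᵢ + 1) / 2^k)`. -/
def cube (k : ℕ) (m : Fin n → ℤ) : Set (Eu n) :=
  {x | ∀ i, (m i : ℝ) / 2 ^ k < x i ∧ x i < ((m i : ℝ) + 1) / 2 ^ k}

/-- `(2^{kn} ∫_{Q_{k,m}} |g|^σ)^{1/σ}`, and the essential supremum of `|g|` over `Q_{k,m}`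
for `σ = ∞`. -/
def cubeMean (σ : ℝ≥0∞) (k : ℕ) (m : Fin n → ℤ) (g : Eu n → ℝ) : ℝ≥0∞ :=
  eLpNorm g σ ((2 : ℝ≥0∞) ^ (k * n) • (volume.restrict (cube k m)))

/-- `t_{k,m} = ‖t_k | L_p(Q_{k,m})‖`. -/
def cubeNorm (p : ℝ≥0∞) (t : ℕ → Eu n → ℝ) (k : ℕ) (m : Fin n → ℤ) : ℝ≥0∞ :=
  eLpNorm (t k) p (volume.restrict (cube k m))

/-- `p`-admissible weight sequences: each `t_k` is measurable, positive almost everywhere, and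
in `L_p` on every compact set. -/
structure IsAdmissible (p : ℝ≥0∞) (t : ℕ → Eu n → ℝ) : Prop where
  aemeasurable : ∀ k, AEMeasurable (t k) volume
  pos : ∀ k, ∀ᵐ x ∂volume, 0 < t k x
  locLp : ∀ k, ∀ K : Set (Eu n), IsCompact K → MemLp (t k) p (volume.restrict K)

/-- The class `X^{α₃}_{α,σ,p}`, with `σ = (σ₁, σ₂)` and `α = ({α¹_k}, {α²_k})`. -/
structure MemX (α₁ α₂ : ℕ → ℝ) (α₃ : ℝ) (σ₁ σ₂ p : ℝ≥0∞) (t : ℕ → Eu n → ℝ) : Prop where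
  admissible : IsAdmissible p t
  lower : ∃ C : ℝ, 0 < C ∧ ∀ k j : ℕ, k ≤ j → ∀ m : Fin n → ℤ,
    cubeMean p k m (t k) * cubeMean σ₁ k m (fun x => (t j x)⁻¹)
      ≤ ENNReal.ofReal (C * (α₁ k / α₁ j))
  upper : ∃ C : ℝ, 0 < C ∧ ∀ k j : ℕ, k ≤ j → ∀ m : Fin n → ℤ,
    (cubeMean p k m (t k))⁻¹ * cubeMean σ₂ k m (t j)
      ≤ ENNReal.ofReal (C * (α₂ j / α₂ k))
  neighbour : ∀ (k : ℕ) (m m' : Fin n → ℤ), (∀ i, |m i - m' i| ≤ 1) →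
    0 < cubeNorm p t k m ∧
      cubeNorm p t k m ≤ ENNReal.ofReal ((2 : ℝ) ^ α₃) * cubeNorm p t k m'

/-- The quasi-norm `‖f | B^{φ₀}_{p,q}(ℝⁿ, {t_k})‖`, the `ℓ_q` quasi-norm of
`‖t_k (φ_k ∗ f) | L_p(ℝⁿ)‖`, `k ≥ 0`; its value is `∞` when `f` is not in the space. -/
def besovNorm {𝕜 : Type*} [RCLike 𝕜] (p q : ℝ≥0∞) (t : ℕ → Eu n → ℝ) (φ₀ : TestFun n 𝕜)
    (f : Distr n 𝕜) : ℝ≥0∞ :=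
  lNorm q univ (fun k => eLpNorm (fun x => t k x • conv (kernelSeq φ₀ k) f x) p volume)

end Weights

end VarBesov

end

/-! The proof avoids the Fourier transform and uses only kernels of compact support. Let `E_j = 1 -
T_j`, where `T_j` is convolution with the `j`-th dilation of `φ₀`, and `A_j = 1 - E_j^(M+1)`. All
these operators commute. Since `∫ φ₀ = 1`, each factor `E_j` gains `2^(-j)` at the price of one
derivative, so `A_j² → 1` when tested against a distribution of exponential growth. Since `E_j -
E_(j+1)` is convolution with the kernel of index `j + 1`, the difference `A_(j+1)² - A_j²` contains
this kernel as a factor (`approxId_sq_sub`); the remaining factor `Ψ_j` (`dualOp`) gains `2^(-jM)`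
against `M` derivatives. Telescoping gives a local reproducing formula. The square matters: it
leaves in `Ψ_j` an additional `A_j`, hence a convolution with a dilation of `φ₀`, on which the
vanishing moments of `ζ` can act.

Two pointwise estimates follow. The kernels of `φ₀` at level `k` are bounded by local integrals of
those at levels `k + d`, with decay `2^(-Md)` (`exists_enorm_conv_kernelSeq_le`). For the kernels of
`ζ₀` there are in addition contributions of the levels `j ≤ k`, with decay `2^(-l(k-j))`, `l = 1 +
L_ζ` (`exists_enorm_conv_kernelSeq_le_of_moments`). The first estimate is self-improving: splitting
`u = u^(1-μ) u^μ` and absorbing `u^(1-μ)` into a Peetre maximal function bounds this function by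
integral means of `u^μ` (`peetreMax_rpow_le_of_growth`). Finiteness of the maximal function, needed
for the division, comes from the growth of `f`, but the final constant does not depend on `f`.

The means are then localised to the dyadic cubes of level `j`. Hölder's inequality with `1/σ₁ + 1/p
= 1/r` and the two integral conditions on the weights compare `t_k` and `t_l` with `t_{j,m}`; the
neighbour condition moves between cubes. Sums are turned into suprema by spending half of an
exponential decay, since suprema obey estimates that hold for every `p` in `(0,∞]`, whereas the
triangle inequality fails for `p < 1` (`MemX.exists_eLpNorm_peetreInt_le`).

Of the Hardy conditions only pointwise consequences are needed: `α¹_j ≤ c 2^(Al) α¹_(j+l)`, and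
`α²_(j+d)/α²_j ≤ c 2^((l-δ)d)` for some `δ > 0` (`HardyHead.exists_geometric`). The moments beat the
growth of `α²` by `2^(-δ(k-j))`, and a Schur type estimate in `ℓ_q` finishes the proof. -/

noncomputable section

namespace VarBesov

/-! ### Convolution operators on test functions: derivative bounds and supports -/

section Smoothing
open scoped ContDiff

variable {n : ℕ} {𝕜 : Type*} [RCLike 𝕜]

theorem integrable_smul_comp_add {G : Type*} [NormedAddCommGroup G] [NormedSpace ℝ G]
    [NormedSpace 𝕜 G] {χ : Eu n → 𝕜} (hχ : Continuous χ) (hχ' : HasCompactSupport χ)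
    {v : Eu n → Eu n} (hv : Continuous v) {h : Eu n → G} (hh : Continuous h) (y : Eu n) :
    Integrable (fun z => χ z • h (y + v z)) :=
  (hχ.smul (hh.comp (continuous_const.add hv))).integrable_of_hasCompactSupport hχ'.smul_right

theorem hasFDerivAt_integral_smul_comp_add {G : Type*} [NormedAddCommGroup G] [NormedSpace ℝ G]
    [NormedSpace 𝕜 G] [SMulCommClass ℝ 𝕜 G] [IsScalarTower ℝ 𝕜 G]
    {χ : Eu n → 𝕜} (hχ : Continuous χ) (hχ' : HasCompactSupport χ)
    {v : Eu n → Eu n} (hv : Continuous v) {h : Eu n → G} (hh : ContDiff ℝ ∞ h)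
    (hh' : HasCompactSupport h) (y : Eu n) :
    HasFDerivAt (fun y => ∫ z, χ z • h (y + v z)) (∫ z, χ z • fderiv ℝ h (y + v z)) y := by
  have hd : Continuous (fderiv ℝ h) := hh.continuous_fderiv (by simp)
  obtain ⟨B, hB⟩ := hd.bounded_above_of_compact_support (hh'.fderiv ℝ)
  refine hasFDerivAt_integral_of_dominated_of_fderiv_le (F := fun y z => χ z • h (y + v z))
    (F' := fun y z => χ z • fderiv ℝ h (y + v z)) (bound := fun z => ‖χ z‖ * B)
    (s := univ) Filter.univ_mem ?_ ?_ ?_ ?_ ?_ ?_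
  · exact Filter.Eventually.of_forall fun y =>
      (integrable_smul_comp_add hχ hχ' hv hh.continuous y).aestronglyMeasurable
  · exact integrable_smul_comp_add hχ hχ' hv hh.continuous y
  · exact (integrable_smul_comp_add hχ hχ' hv hd y).aestronglyMeasurable
  · refine Filter.Eventually.of_forall fun z y _ => ?_
    rw [norm_smul]
    exact mul_le_mul_of_nonneg_left (hB _) (norm_nonneg _)
  · exact ((hχ.integrable_of_hasCompactSupport hχ').norm).mul_const B
  · refine Filter.Eventually.of_forall fun z y _ => ?_
    have := ((hh.differentiable (by simp)) (y + v z)).hasFDerivAt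
    exact ((this.comp y ((hasFDerivAt_id y).add_const (v z))).const_smul (χ z))

/-- Differentiation under the integral, repeated. The target space `G` is quantified inside the
induction because the step replaces `h` by `fderiv ℝ h`, whose values are linear maps into `G`. -/
theorem iteratedFDeriv_integral_smul_comp_add {χ : Eu n → 𝕜} (hχ : Continuous χ)
    (hχ' : HasCompactSupport χ) {v : Eu n → Eu n} (hv : Continuous v) (i : ℕ) :
    ∀ {G : Type _} [NormedAddCommGroup G] [NormedSpace ℝ G]
    [NormedSpace 𝕜 G] [SMulCommClass ℝ 𝕜 G] [IsScalarTower ℝ 𝕜 G] [CompleteSpace G]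
    {h : Eu n → G} (_ : ContDiff ℝ ∞ h) (_ : HasCompactSupport h) (y : Eu n),
    iteratedFDeriv ℝ i (fun y => ∫ z, χ z • h (y + v z)) y
      = ∫ z, χ z • iteratedFDeriv ℝ i h (y + v z) := by
  induction i with
  | zero =>
    intro G _ _ _ _ _ _ h hh hh' y
    ext m
    have hc : Continuous (iteratedFDeriv ℝ 0 h) := hh.continuous_iteratedFDeriv (by simp)
    have := (ContinuousMultilinearMap.apply ℝ (fun _ : Fin 0 => Eu n) G m).integral_comp_comm
      (integrable_smul_comp_add hχ hχ' hv hc y)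
    simp only [ContinuousMultilinearMap.apply_apply] at this
    rw [← this]
    simp
  | succ i ih =>
    intro G _ _ _ _ _ _ h hh hh' y
    ext m
    have hc : Continuous (iteratedFDeriv ℝ (i + 1) h) :=
      hh.continuous_iteratedFDeriv (by exact_mod_cast le_top)
    have hd : ContDiff ℝ ∞ (fderiv ℝ h) := hh.fderiv_right (by simp)
    have hc' : Continuous (iteratedFDeriv ℝ i (fderiv ℝ h)) :=
      hd.continuous_iteratedFDeriv (by exact_mod_cast le_top)
    have e1 := (ContinuousMultilinearMap.apply ℝ (fun _ : Fin (i + 1) => Eu n) G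
      m).integral_comp_comm (integrable_smul_comp_add hχ hχ' hv hc y)
    have e2 := (ContinuousMultilinearMap.apply ℝ (fun _ : Fin i => Eu n) (Eu n →L[ℝ] G)
      (Fin.init m)).integral_comp_comm (integrable_smul_comp_add hχ hχ' hv hc' y)
    simp only [ContinuousMultilinearMap.apply_apply] at e1 e2
    rw [← e1, iteratedFDeriv_succ_apply_right]
    have e3 : fderiv ℝ (fun y => ∫ z, χ z • h (y + v z))
        = fun y => ∫ z, χ z • fderiv ℝ h (y + v z) := by
      funext y
      exact (hasFDerivAt_integral_smul_comp_add hχ hχ' hv hh hh' y).fderiv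
    rw [e3, ih hd (hh'.fderiv ℝ), ← e2]
    have e4 := (ContinuousLinearMap.apply ℝ G (m (Fin.last i))).integral_comp_comm
      (((ContinuousMultilinearMap.apply ℝ (fun _ : Fin i => Eu n) (Eu n →L[ℝ] G)
      (Fin.init m))).integrable_comp (integrable_smul_comp_add hχ hχ' hv hc' y))
    simp only [ContinuousMultilinearMap.apply_apply, ContinuousLinearMap.apply_apply] at e4
    rw [← e4]
    refine integral_congr_ae (Filter.Eventually.of_forall fun z => ?_)
    simp [iteratedFDeriv_succ_apply_right]

/-- The convolution of two test functions. -/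
def cvl (χ η : TestFun n 𝕜) : TestFun n 𝕜 where
  toFun := convolution χ η (ContinuousLinearMap.mul ℝ 𝕜) volume
  contDiff' := η.hasCompactSupport.contDiff_convolution_right _
    χ.continuous.locallyIntegrable η.contDiff
  hasCompactSupport' := χ.hasCompactSupport.convolution _ η.hasCompactSupport
  tsupport_subset' := fun _ _ => trivial

theorem cvl_apply (χ η : TestFun n 𝕜) (y : Eu n) : cvl χ η y = ∫ z, χ z * η (y - z) := rfl

theorem cvl_integrable (χ η : TestFun n 𝕜) (y : Eu n) :
    Integrable (fun z => χ z * η (y - z)) := by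
  have := integrable_smul_comp_add χ.continuous χ.hasCompactSupport continuous_neg η.continuous y
  simpa [sub_eq_add_neg] using this

theorem cvl_comm (χ η : TestFun n 𝕜) : cvl χ η = cvl η χ := by
  ext y
  rw [cvl_apply, cvl_apply]
  rw [← integral_sub_left_eq_self (fun z => η z * χ (y - z)) volume y]
  simp [mul_comm]

theorem cvl_assoc (χ η κ : TestFun n 𝕜) : cvl (cvl χ η) κ = cvl χ (cvl η κ) := by
  ext y
  refine convolution_assoc (ContinuousLinearMap.mul ℝ 𝕜) (ContinuousLinearMap.mul ℝ 𝕜)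
    (ContinuousLinearMap.mul ℝ 𝕜) (ContinuousLinearMap.mul ℝ 𝕜) (μ := volume) (ν := volume)
    (f := χ) (g := η) (k := κ)
    (fun x y z => mul_assoc x y z) χ.continuous.aestronglyMeasurable
    η.continuous.aestronglyMeasurable κ.continuous.aestronglyMeasurable ?_ ?_ ?_
  · exact Filter.Eventually.of_forall
      (χ.hasCompactSupport.convolutionExists_left _ χ.continuous η.continuous.locallyIntegrable)
  · exact Filter.Eventually.of_forall
      (η.hasCompactSupport.norm.convolutionExists_left _ η.continuous.norm
        κ.continuous.norm.locallyIntegrable)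
  · refine χ.hasCompactSupport.norm.convolutionExists_left _ χ.continuous.norm ?_ y
    exact (κ.hasCompactSupport.norm.continuous_convolution_right _
      η.continuous.norm.locallyIntegrable κ.continuous.norm).locallyIntegrable

/-- Convolution with a test function, as an operator on test functions. -/
def T (χ : TestFun n 𝕜) : Module.End 𝕜 (TestFun n 𝕜) where
  toFun := cvl χ
  map_add' η κ := by
    ext y
    simp only [cvl_apply, _root_.add_apply, mul_add]
    exact integral_add (cvl_integrable χ η y) (cvl_integrable χ κ y)
  map_smul' c η := by
    ext y
    simp only [cvl_apply, _root_.smul_apply, smul_eq_mul, RingHom.id_apply]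
    rw [← integral_const_mul]
    exact integral_congr_ae (Filter.Eventually.of_forall fun z => by ring)

theorem T_apply (χ η : TestFun n 𝕜) (y : Eu n) : T χ η y = ∫ z, χ z * η (y - z) := rfl

theorem T_comm (χ η : TestFun n 𝕜) : T χ η = T η χ := cvl_comm χ η

theorem T_commute (χ η : TestFun n 𝕜) : Commute (T χ) (T η) := by
  refine LinearMap.ext fun κ => ?_
  change cvl χ (cvl η κ) = cvl η (cvl χ κ)
  rw [← cvl_assoc, ← cvl_assoc, cvl_comm χ η]

theorem T_sub (χ η : TestFun n 𝕜) : T (χ - η) = T χ - T η := by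
  refine LinearMap.ext fun κ => ?_
  rw [LinearMap.sub_apply, T_comm, T_comm χ, T_comm η, map_sub]

/-- All `i`-th derivatives of `g` are bounded by `B`. -/
def DB (i : ℕ) (B : ℝ) (g : TestFun n 𝕜) : Prop := ∀ x, ‖iteratedFDeriv ℝ i g x‖ ≤ B

/-- `g` vanishes off the closed ball of radius `ρ` about the origin. -/
def SB (ρ : ℝ) (g : TestFun n 𝕜) : Prop := ∀ x, ρ < ‖x‖ → g x = 0

theorem exists_DB (i : ℕ) (g : TestFun n 𝕜) : ∃ B, 0 ≤ B ∧ DB i B g := by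
  have hc : Continuous (iteratedFDeriv ℝ i g) :=
    g.contDiff.continuous_iteratedFDeriv (by exact_mod_cast le_top)
  obtain ⟨B, hB⟩ := hc.bounded_above_of_compact_support (g.hasCompactSupport.iteratedFDeriv i)
  exact ⟨B, (norm_nonneg _).trans (hB 0), hB⟩

theorem exists_DB_le (N : ℕ) (g : TestFun n 𝕜) : ∃ B, 0 ≤ B ∧ ∀ i ≤ N, DB i B g := by
  choose B hB0 hB using fun i => exists_DB i g
  refine ⟨∑ i ∈ Finset.range (N + 1), B i, Finset.sum_nonneg fun i _ => hB0 i, fun i hi x => ?_⟩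
  exact (hB i x).trans (Finset.single_le_sum (fun i _ => hB0 i)
    (Finset.mem_range.2 (Nat.lt_succ_of_le hi)))

theorem exists_SB (g : TestFun n 𝕜) : ∃ ρ, 0 ≤ ρ ∧ SB ρ g := by
  obtain ⟨R, hR⟩ := g.hasCompactSupport.isBounded.subset_closedBall (0 : Eu n)
  refine ⟨max R 0, le_max_right _ _, fun x hx => ?_⟩
  by_contra h
  have := hR (subset_tsupport _ (Function.mem_support.2 h))
  rw [mem_closedBall_zero_iff] at this
  exact absurd hx (not_lt.2 (this.trans (le_max_left _ _)))

theorem SB.mono {ρ σ : ℝ} {g : TestFun n 𝕜} (h : SB ρ g) (hρ : ρ ≤ σ) : SB σ g :=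
  fun x hx => h x (hρ.trans_lt hx)

theorem DB.mono {i : ℕ} {B C : ℝ} {g : TestFun n 𝕜} (h : DB i B g) (hB : B ≤ C) : DB i C g :=
  fun x => (h x).trans hB

theorem DB.nonneg {i : ℕ} {B : ℝ} {g : TestFun n 𝕜} (h : DB i B g) : 0 ≤ B :=
  (norm_nonneg _).trans (h 0)

theorem DB.add {i : ℕ} {B C : ℝ} {g h : TestFun n 𝕜} (hg : DB i B g) (hh : DB i C h) :
    DB i (B + C) (g + h) := fun x => by
  have : iteratedFDeriv ℝ i (⇑(g + h)) x = iteratedFDeriv ℝ i g x + iteratedFDeriv ℝ i h x := by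
    rw [FunLike.coe_add]
    exact iteratedFDeriv_add_apply (g.contDiff.contDiffAt.of_le (by exact_mod_cast le_top))
      (h.contDiff.contDiffAt.of_le (by exact_mod_cast le_top))
  rw [this]
  exact (norm_add_le _ _).trans (add_le_add (hg x) (hh x))

theorem SB.add {ρ σ : ℝ} {g h : TestFun n 𝕜} (hg : SB ρ g) (hh : SB σ h) :
    SB (max ρ σ) (g + h) := fun x hx => by
  rw [_root_.add_apply, hg x ((le_max_left _ _).trans_lt hx), hh x ((le_max_right _ _).trans_lt hx),
    add_zero]

theorem DB_zero_iff {B : ℝ} {g : TestFun n 𝕜} : DB 0 B g ↔ ∀ x, ‖g x‖ ≤ B := by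
  simp [DB]

theorem iteratedFDeriv_T (χ g : TestFun n 𝕜) (i : ℕ) (y : Eu n) :
    iteratedFDeriv ℝ i (T χ g) y = ∫ z, χ z • iteratedFDeriv ℝ i g (y - z) := by
  have := iteratedFDeriv_integral_smul_comp_add χ.continuous χ.hasCompactSupport
    continuous_neg i g.contDiff g.hasCompactSupport y
  simp only [← sub_eq_add_neg] at this
  exact this

theorem continuous_iteratedFDeriv (g : TestFun n 𝕜) (i : ℕ) : Continuous (iteratedFDeriv ℝ i g) :=
  g.contDiff.continuous_iteratedFDeriv (by exact_mod_cast le_top)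

theorem integrable_norm (χ : TestFun n 𝕜) : Integrable (fun z => ‖χ z‖) :=
  (χ.continuous.integrable_of_hasCompactSupport χ.hasCompactSupport).norm

theorem T_DB (χ : TestFun n 𝕜) {i : ℕ} {B : ℝ} {g : TestFun n 𝕜} (h : DB i B g) :
    DB i ((∫ z, ‖χ z‖) * B) (T χ g) := fun y => by
  rw [iteratedFDeriv_T, ← integral_mul_const]
  refine norm_integral_le_of_norm_le ((integrable_norm χ).mul_const B)
    (Filter.Eventually.of_forall fun z => ?_)
  rw [norm_smul]
  exact mul_le_mul_of_nonneg_left (h _) (norm_nonneg _)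

theorem T_SB {ρ σ : ℝ} {χ g : TestFun n 𝕜} (hχ : SB ρ χ) (hg : SB σ g) :
    SB (σ + ρ) (T χ g) := fun x hx => by
  rw [T_apply, integral_eq_zero_of_ae]
  refine Filter.Eventually.of_forall fun z => ?_
  rcases lt_or_ge ρ ‖z‖ with h | h
  · simp [hχ z h]
  · have : σ < ‖x - z‖ := by
      have := norm_sub_norm_le x z
      linarith
    simp [hg _ this]

theorem norm_iteratedFDeriv_sub_le {i : ℕ} {B : ℝ} {g : TestFun n 𝕜} (h : DB (i + 1) B g)
    (x y : Eu n) : ‖iteratedFDeriv ℝ i g x - iteratedFDeriv ℝ i g y‖ ≤ B * ‖x - y‖ := by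
  refine convex_univ.norm_image_sub_le_of_norm_fderiv_le (𝕜 := ℝ) (fun z _ => ?_) (fun z _ => ?_)
    (mem_univ y) (mem_univ x)
  · exact g.contDiff.contDiffAt.differentiableAt_iteratedFDeriv
      (by exact_mod_cast WithTop.coe_lt_top _)
  · rw [norm_fderiv_iteratedFDeriv]
    exact h z

/-- Because `∫ χ = 1`, the difference `g - χ ∗ g` is the integral of `χ(z) (g(y) - g(y - z))`, and
the mean value inequality with `|z| ≤ ρ` turns one derivative into a factor `ρ`. This is the source
of every gain of `2^(-j)` below. -/
theorem one_sub_T_DB {ρ : ℝ} {χ : TestFun n 𝕜} (hχ : ∫ z, χ z = 1) (hρ : SB ρ χ) {i : ℕ} {B : ℝ}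
    {g : TestFun n 𝕜} (h : DB (i + 1) B g) :
    DB i (ρ * (∫ z, ‖χ z‖) * B) ((1 - T χ) g) := fun y => by
  have hB := h.nonneg
  have e1 : iteratedFDeriv ℝ i ((1 - T χ) g) y
      = iteratedFDeriv ℝ i g y - iteratedFDeriv ℝ i (T χ g) y := by
    have : (⇑((1 - T χ) g) : Eu n → 𝕜) = ⇑g - ⇑(T χ g) := by
      rw [LinearMap.sub_apply, FunLike.coe_sub, Module.End.one_apply]
    rw [this]
    exact iteratedFDeriv_sub_apply (g.contDiff.contDiffAt.of_le (by exact_mod_cast le_top))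
      ((T χ g).contDiff.contDiffAt.of_le (by exact_mod_cast le_top))
  have e2 : iteratedFDeriv ℝ i g y = ∫ z, χ z • iteratedFDeriv ℝ i g y := by
    rw [integral_smul_const, hχ, one_smul]
  have hc := continuous_iteratedFDeriv g i
  rw [e1, iteratedFDeriv_T, e2, ← integral_sub]
  · rw [show ρ * (∫ z, ‖χ z‖) * B = ∫ z, ‖χ z‖ * (ρ * B) by rw [integral_mul_const]; ring]
    refine norm_integral_le_of_norm_le ((integrable_norm χ).mul_const _)
      (Filter.Eventually.of_forall fun z => ?_)
    rw [← smul_sub, norm_smul]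
    rcases lt_or_ge ρ ‖z‖ with hz | hz
    · simp [hρ z hz]
    · refine mul_le_mul_of_nonneg_left ((norm_iteratedFDeriv_sub_le h _ _).trans ?_)
        (norm_nonneg _)
      rw [sub_sub_cancel, mul_comm]
      exact mul_le_mul_of_nonneg_right hz hB
  · exact (χ.continuous.integrable_of_hasCompactSupport χ.hasCompactSupport).smul_const _
  · simpa only [← sub_eq_add_neg] using
      integrable_smul_comp_add χ.continuous χ.hasCompactSupport continuous_neg hc y

/-- The operator `U` loses at most `d` derivatives, with norm at most `I`, and enlarges supports by
at most `ρ`. -/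
def OpBd (U : Module.End 𝕜 (TestFun n 𝕜)) (d : ℕ) (I ρ : ℝ) : Prop :=
  ∀ (i : ℕ) (B σ : ℝ) (g : TestFun n 𝕜), DB (i + d) B g → SB σ g →
    DB i (I * B) (U g) ∧ SB (σ + ρ) (U g)

theorem OpBd.mono {U : Module.End 𝕜 (TestFun n 𝕜)} {d : ℕ} {I J ρ σ : ℝ} (h : OpBd U d I ρ)
    (hI : I ≤ J) (hρ : ρ ≤ σ) : OpBd U d J σ := fun i B τ g hB hg =>
  ⟨((h i B τ g hB hg).1).mono (mul_le_mul_of_nonneg_right hI hB.nonneg),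
    ((h i B τ g hB hg).2).mono (by linarith)⟩

theorem OpBd.mul {U V : Module.End 𝕜 (TestFun n 𝕜)} {d e : ℕ} {I J ρ σ : ℝ} (hU : OpBd U d I ρ)
    (hV : OpBd V e J σ) : OpBd (U * V) (d + e) (I * J) (ρ + σ) := fun i B τ g hB hg => by
  obtain ⟨h1, h2⟩ := hV (i + d) B τ g (by rwa [add_assoc]) hg
  obtain ⟨h3, h4⟩ := hU i _ _ _ h1 h2
  exact ⟨by rwa [mul_assoc], by rwa [add_comm ρ, ← add_assoc]⟩

theorem OpBd.add {U V : Module.End 𝕜 (TestFun n 𝕜)} {d : ℕ} {I J ρ : ℝ} (hU : OpBd U d I ρ)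
    (hV : OpBd V d J ρ) : OpBd (U + V) d (I + J) ρ := fun i B τ g hB hg => by
  obtain ⟨h1, h2⟩ := hU i B τ g hB hg
  obtain ⟨h3, h4⟩ := hV i B τ g hB hg
  refine ⟨by rw [add_mul]; exact h1.add h3, ?_⟩
  have := h2.add h4
  rwa [max_self] at this

theorem OpBd.zero {d : ℕ} {ρ : ℝ} : OpBd (0 : Module.End 𝕜 (TestFun n 𝕜)) d 0 ρ :=
  fun i B τ g _ _ => by
  refine ⟨fun x => ?_, fun x _ => rfl⟩
  rw [LinearMap.zero_apply, FunLike.coe_zero, zero_mul]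
  simp

theorem OpBd.sum {ι : Type*} (s : Finset ι) {U : ι → Module.End 𝕜 (TestFun n 𝕜)} {d : ℕ} {I ρ : ℝ}
    (hU : ∀ i ∈ s, OpBd (U i) d I ρ) : OpBd (∑ i ∈ s, U i) d (s.card * I) ρ := by
  classical
  induction s using Finset.induction_on with
  | empty => simpa using OpBd.zero
  | insert a s ha ih =>
    rw [Finset.sum_insert ha, Finset.card_insert_of_notMem ha]
    have := (hU a (Finset.mem_insert_self a s)).add
      (ih fun i hi => hU i (Finset.mem_insert_of_mem hi))
    refine this.mono (le_of_eq ?_) le_rfl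
    push_cast; ring

theorem OpBd.one {ρ : ℝ} (hρ : 0 ≤ ρ) : OpBd (1 : Module.End 𝕜 (TestFun n 𝕜)) 0 1 ρ :=
  fun i B τ g hB hg => ⟨by simpa using hB, hg.mono (by linarith)⟩

theorem OpBd.pow {U : Module.End 𝕜 (TestFun n 𝕜)} {d : ℕ} {I ρ : ℝ} (hU : OpBd U d I ρ) (m : ℕ) :
    OpBd (U ^ m) (m * d) (I ^ m) (m * ρ) := by
  induction m with
  | zero => simpa using OpBd.one le_rfl
  | succ m ih =>
    rw [pow_succ, pow_succ, add_mul, one_mul]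
    refine (ih.mul hU).mono le_rfl (le_of_eq ?_)
    push_cast; ring

theorem T_OpBd {ρ : ℝ} {χ : TestFun n 𝕜} (hρ : SB ρ χ) : OpBd (T χ) 0 (∫ z, ‖χ z‖) ρ :=
  fun _ _ _ _ hB hg => ⟨T_DB χ hB, T_SB hρ hg⟩

theorem one_sub_T_OpBd_zero {ρ : ℝ} {χ : TestFun n 𝕜} (hρ0 : 0 ≤ ρ) (hρ : SB ρ χ) :
    OpBd (1 - T χ) 0 (1 + ∫ z, ‖χ z‖) ρ := by
  have h : OpBd (T (-χ)) 0 (∫ z, ‖χ z‖) ρ := by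
    have : SB ρ (-χ) := fun x hx => by rw [_root_.neg_apply, hρ x hx, neg_zero]
    simpa using T_OpBd this
  have e : 1 - T χ = 1 + T (-χ) := by
    have : T (-χ) = - T χ := by rw [← zero_sub, T_sub, ← sub_self χ, T_sub, sub_self, zero_sub]
    rw [this, sub_eq_add_neg]
  rw [e]
  exact (OpBd.one hρ0).add h

theorem one_sub_T_OpBd {ρ : ℝ} {χ : TestFun n 𝕜} (hχ : ∫ z, χ z = 1) (hρ0 : 0 ≤ ρ) (hρ : SB ρ χ) :
    OpBd (1 - T χ) 1 (ρ * ∫ z, ‖χ z‖) ρ :=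
  fun i B σ g hB hg => ⟨one_sub_T_DB hχ hρ hB, by
    -- Only the support statement is taken from the estimate without loss of derivatives, so any
    -- bound `B'` will do.
    obtain ⟨B', -, hB'⟩ := exists_DB i g
    exact (one_sub_T_OpBd_zero hρ0 hρ i B' σ g hB' hg).2⟩

end Smoothing

/-! ### Distributions of exponential growth and their convolutions -/

section ExpGrowth
open scoped BoundedContinuousFunction ContDiff

variable {n : ℕ} {𝕜 : Type*} [RCLike 𝕜]

/-- Hahn–Banach. It represents a distribution of exponential growth as a bounded functional on a
Banach space of weighted derivatives, so that Bochner integrals can be exchanged with it. -/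
theorem exists_clm_of_norm_le {V E : Type*} [AddCommGroup V] [Module 𝕜 V] [NormedAddCommGroup E]
    [NormedSpace 𝕜 E] (J : V →ₗ[𝕜] E) (f : V →ₗ[𝕜] 𝕜) (C : ℝ) (h : ∀ v, ‖f v‖ ≤ C * ‖J v‖) :
    ∃ F : E →L[𝕜] 𝕜, ∀ v, F (J v) = f v := by
  obtain ⟨s, hs⟩ := J.rangeRestrict.exists_rightInverse_of_surjective
    (LinearMap.range_rangeRestrict J)
  have hs' : ∀ w : LinearMap.range J, J (s w) = w := fun w => by
    have := congrArg Subtype.val (LinearMap.congr_fun hs w)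
    simpa using this
  let g : LinearMap.range J →L[𝕜] 𝕜 := (f.comp s).mkContinuous C fun w => by
    have := h (s w)
    rwa [hs'] at this
  obtain ⟨F, hF, -⟩ := exists_extension_norm_eq _ g
  refine ⟨F, fun v => ?_⟩
  have h1 := hF ⟨J v, LinearMap.mem_range_self J v⟩
  -- The chosen preimage of `J v` may differ from `v`; the bound forces `f` to vanish on the
  -- difference, since `J` does.
  have h2 := h (s ⟨J v, LinearMap.mem_range_self J v⟩ - v)
  rw [map_sub, map_sub, hs', sub_self, norm_zero, mul_zero] at h2
  have h3 := sub_eq_zero.1 (norm_le_zero_iff.1 h2)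
  exact h1.trans h3

theorem SB.iteratedFDeriv_eq_zero {σ : ℝ} {g : TestFun n 𝕜} (h : SB σ g) (i : ℕ) {x : Eu n}
    (hx : σ < ‖x‖) : iteratedFDeriv ℝ i g x = 0 := by
  have : (g : Eu n → 𝕜) =ᶠ[nhds x] fun _ => 0 := by
    filter_upwards [(isOpen_lt continuous_const continuous_norm).mem_nhds hx] with y hy
    exact h y hy
  rw [this.iteratedFDeriv ℝ i |>.eq_of_nhds]
  simp

theorem iteratedFDeriv_compAffine (φ : TestFun n 𝕜) (a : ℝ) (ha : a ≠ 0) (b y : Eu n) (i : ℕ) :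
    iteratedFDeriv ℝ i (compAffine φ a ha b) y = a ^ i • iteratedFDeriv ℝ i φ (a • y + b) := by
  have h1 : (compAffine φ a ha b : Eu n → 𝕜) = fun z => (fun w => φ (w + b)) (a • z) := rfl
  have h2 : ContDiff ℝ i (fun w => φ (w + b)) :=
    (φ.contDiff.comp (contDiff_id.add contDiff_const)).of_le (by exact_mod_cast le_top)
  rw [h1, iteratedFDeriv_comp_const_smul a h2]
  simp only [iteratedFDeriv_comp_add_right]

/-- The exponentially weighted `i`-th derivative of a test function. -/
def wDeriv (N i : ℕ) (φ : TestFun n 𝕜) : Eu n →ᵇ (Eu n [×i]→L[ℝ] 𝕜) :=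
  BoundedContinuousFunction.ofNormedAddCommGroup
    (fun x => Real.exp (N * ‖x‖) • iteratedFDeriv ℝ i φ x)
    ((by fun_prop : Continuous fun x : Eu n => Real.exp (N * ‖x‖)).smul
      (continuous_iteratedFDeriv φ i))
    (Real.exp (N * (exists_SB φ).choose) * (exists_DB i φ).choose) fun x => by
      obtain ⟨h0, h1⟩ := (exists_SB φ).choose_spec
      obtain ⟨h2, h3⟩ := (exists_DB i φ).choose_spec
      rcases lt_or_ge (exists_SB φ).choose ‖x‖ with h | h
      · rw [h1.iteratedFDeriv_eq_zero i h, smul_zero, norm_zero]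
        positivity
      · rw [norm_smul, Real.norm_of_nonneg (Real.exp_nonneg _)]
        gcongr
        exact h3 x

/-- The space of the values of `jet`. -/
def JetSpace (n : ℕ) (𝕜 : Type*) [RCLike 𝕜] (N : ℕ) : Type _ :=
  (i : Fin (N + 1)) → (Eu n →ᵇ (Eu n [×(i : ℕ)]→L[ℝ] 𝕜))

set_option synthInstance.maxHeartbeats 400000 in
instance (N : ℕ) : NormedAddCommGroup (JetSpace n 𝕜 N) :=
  inferInstanceAs (NormedAddCommGroup ((i : Fin (N + 1)) → (Eu n →ᵇ (Eu n [×(i : ℕ)]→L[ℝ] 𝕜))))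

set_option synthInstance.maxHeartbeats 400000 in
instance (N : ℕ) : NormedSpace 𝕜 (JetSpace n 𝕜 N) :=
  inferInstanceAs (NormedSpace 𝕜 ((i : Fin (N + 1)) → (Eu n →ᵇ (Eu n [×(i : ℕ)]→L[ℝ] 𝕜))))

set_option synthInstance.maxHeartbeats 400000 in
instance (N : ℕ) : NormedSpace ℝ (JetSpace n 𝕜 N) :=
  inferInstanceAs (NormedSpace ℝ ((i : Fin (N + 1)) → (Eu n →ᵇ (Eu n [×(i : ℕ)]→L[ℝ] 𝕜))))

set_option synthInstance.maxHeartbeats 400000 in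
instance (N : ℕ) : CompleteSpace (JetSpace n 𝕜 N) :=
  inferInstanceAs (CompleteSpace ((i : Fin (N + 1)) → (Eu n →ᵇ (Eu n [×(i : ℕ)]→L[ℝ] 𝕜))))

set_option synthInstance.maxHeartbeats 400000 in
/-- The evaluation of the `i`-th component at `x`. -/
def evalJet {N : ℕ} (i : Fin (N + 1)) (x : Eu n) :
    JetSpace n 𝕜 N →L[𝕜] (Eu n [×(i : ℕ)]→L[ℝ] 𝕜) :=
  (BoundedContinuousFunction.evalCLM 𝕜 (β := (Eu n [×(i : ℕ)]→L[ℝ] 𝕜)) x).comp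
    (ContinuousLinearMap.proj (R := 𝕜)
      (φ := fun i : Fin (N + 1) => (Eu n →ᵇ (Eu n [×(i : ℕ)]→L[ℝ] 𝕜))) i)

theorem JetSpace.ext {N : ℕ} {u v : JetSpace n 𝕜 N}
    (h : ∀ (i : Fin (N + 1)) (x : Eu n), evalJet i x u = evalJet i x v) : u = v :=
  funext fun i => BoundedContinuousFunction.ext fun x => h i x

theorem JetSpace.norm_le {N : ℕ} {u : JetSpace n 𝕜 N} {C : ℝ} (hC : 0 ≤ C)
    (h : ∀ (i : Fin (N + 1)) (x : Eu n), ‖evalJet i x u‖ ≤ C) : ‖u‖ ≤ C :=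
  (pi_norm_le_iff_of_nonneg hC).2 fun i => (BoundedContinuousFunction.norm_le hC).2 fun x => h i x

theorem JetSpace.norm_evalJet_le {N : ℕ} (u : JetSpace n 𝕜 N) (i : Fin (N + 1)) (x : Eu n) :
    ‖evalJet i x u‖ ≤ ‖u‖ :=
  (BoundedContinuousFunction.norm_coe_le_norm (u i) x).trans
    (norm_le_pi_norm (G := fun i : Fin (N + 1) => (Eu n →ᵇ (Eu n [×(i : ℕ)]→L[ℝ] 𝕜))) u i)

/-- The exponentially weighted derivatives of a test function up to the order `N`. -/
def jet (N : ℕ) : TestFun n 𝕜 →ₗ[𝕜] JetSpace n 𝕜 N where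
  toFun φ := fun i => wDeriv N i φ
  map_add' φ ψ := by
    refine JetSpace.ext fun i x => ?_
    change Real.exp (N * ‖x‖) • iteratedFDeriv ℝ i (⇑(φ + ψ)) x
      = Real.exp (N * ‖x‖) • iteratedFDeriv ℝ i φ x + Real.exp (N * ‖x‖) • iteratedFDeriv ℝ i ψ x
    rw [← smul_add, FunLike.coe_add]
    congr 1
    exact iteratedFDeriv_add_apply (φ.contDiff.contDiffAt.of_le (by exact_mod_cast le_top))
      (ψ.contDiff.contDiffAt.of_le (by exact_mod_cast le_top))
  map_smul' c φ := by
    refine JetSpace.ext fun i x => ?_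
    change Real.exp (N * ‖x‖) • iteratedFDeriv ℝ i (⇑(c • φ)) x
      = c • Real.exp (N * ‖x‖) • iteratedFDeriv ℝ i φ x
    rw [smul_comm, FunLike.coe_smul]
    congr 1
    exact iteratedFDeriv_const_smul_apply (φ.contDiff.contDiffAt.of_le (by exact_mod_cast le_top))

theorem evalJet_jet {N : ℕ} (i : Fin (N + 1)) (x : Eu n) (φ : TestFun n 𝕜) :
    evalJet i x (jet N φ) = Real.exp (N * ‖x‖) • iteratedFDeriv ℝ i φ x := rfl

theorem jet_norm_le {N : ℕ} {σ B : ℝ} {φ : TestFun n 𝕜} (hσ : SB σ φ) (hB : ∀ i ≤ N, DB i B φ) :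
    ‖jet N φ‖ ≤ Real.exp (N * σ) * B := by
  have hB0 := (hB 0 (Nat.zero_le _)).nonneg
  refine JetSpace.norm_le (by positivity) fun i x => ?_
  rw [evalJet_jet]
  rcases lt_or_ge σ ‖x‖ with h | h
  · rw [hσ.iteratedFDeriv_eq_zero i h, smul_zero, norm_zero]
    positivity
  · rw [norm_smul, Real.norm_of_nonneg (Real.exp_nonneg _)]
    gcongr
    exact hB i (Nat.lt_succ_iff.1 i.2) x

theorem ExpDistr.exists_clm {f : Distr n 𝕜} (hf : f ∈ ExpDistr n 𝕜) :
    ∃ (N : ℕ) (F : JetSpace n 𝕜 N →L[𝕜] 𝕜),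
      ∀ φ, f φ = F (jet N φ) := by
  obtain ⟨N, C, h⟩ := hf
  obtain ⟨F, hF⟩ := exists_clm_of_norm_le (jet N) (f : TestFun n 𝕜 →ₗ[𝕜] 𝕜) C fun φ => by
    have h1 : ‖f φ‖ₑ ≤ C * ENNReal.ofReal ‖jet N φ‖ := by
      refine (h φ).trans (mul_le_mul_right (iSup₂_le fun i hi => iSup_le fun x => ?_) _)
      rw [← ofReal_norm, ← ENNReal.ofReal_mul (norm_nonneg _)]
      refine ENNReal.ofReal_le_ofReal ?_
      have h2 := JetSpace.norm_evalJet_le (jet N φ) ⟨i, Nat.lt_succ_of_le hi⟩ x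
      rwa [evalJet_jet, norm_smul, Real.norm_of_nonneg (Real.exp_nonneg _), mul_comm] at h2
    rw [← ofReal_norm, ← ENNReal.ofReal_coe_nnreal, ← ENNReal.ofReal_mul C.coe_nonneg] at h1
    exact (ENNReal.ofReal_le_ofReal_iff (mul_nonneg C.coe_nonneg (norm_nonneg _))).1 h1
  exact ⟨N, F, fun φ => (hF φ).symm⟩

theorem compAffine_neg_SB {σ : ℝ} {φ : TestFun n 𝕜} (hσ : SB σ φ) (x : Eu n) :
    SB (‖x‖ + σ) (compAffine φ (-1) (by norm_num) x) := fun y hy => by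
  rw [compAffine_apply]
  refine hσ _ ?_
  have := norm_sub_norm_le y x
  rw [neg_smul, one_smul, ← norm_neg, neg_add, neg_neg, ← sub_eq_add_neg]
  linarith

theorem compAffine_neg_DB {i : ℕ} {B : ℝ} {φ : TestFun n 𝕜} (hB : DB i B φ) (x : Eu n) :
    DB i B (compAffine φ (-1) (by norm_num) x) := fun y => by
  rw [iteratedFDeriv_compAffine, norm_smul]
  simpa using hB _

theorem exists_norm_conv_le {f : Distr n 𝕜} (hf : f ∈ ExpDistr n 𝕜) :
    ∃ (N : ℕ) (C : ℝ), 0 ≤ C ∧ ∀ (φ : TestFun n 𝕜) (σ B : ℝ) (x : Eu n), SB σ φ →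
      (∀ i ≤ N, DB i B φ) → ‖conv φ f x‖ ≤ C * Real.exp (N * (‖x‖ + σ)) * B := by
  obtain ⟨N, F, hF⟩ := ExpDistr.exists_clm hf
  refine ⟨N, ‖F‖, norm_nonneg _, fun φ σ B x hσ hB => ?_⟩
  rw [conv, hF, mul_assoc]
  exact (F.le_opNorm _).trans (mul_le_mul_of_nonneg_left
    (jet_norm_le (compAffine_neg_SB hσ x) fun i hi => compAffine_neg_DB (hB i hi) x)
    (norm_nonneg _))

theorem continuous_jet_translate (N : ℕ) (φ : TestFun n 𝕜) :
    Continuous fun x => jet N (compAffine φ (-1) (by norm_num) x) := by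
  obtain ⟨σ, hσ0, hσ⟩ := exists_SB φ
  -- One derivative more than the order `N`: it makes the derivatives up to order `N` Lipschitz.
  obtain ⟨B, hB0, hB⟩ := exists_DB_le (N + 1) φ
  rw [continuous_iff_continuousAt]
  intro x
  rw [ContinuousAt, tendsto_iff_norm_sub_tendsto_zero]
  have hlim : Filter.Tendsto (fun y => Real.exp (N * (‖x‖ + 1 + σ)) * (B * ‖y - x‖)) (nhds x)
      (nhds 0) := by
    have : Continuous fun y => Real.exp (N * (‖x‖ + 1 + σ)) * (B * ‖y - x‖) := by fun_prop
    simpa using this.tendsto x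
  refine squeeze_zero' (Filter.Eventually.of_forall fun y => norm_nonneg _) ?_ hlim
  filter_upwards [Metric.ball_mem_nhds x one_pos] with y hy
  rw [mem_ball_iff_norm] at hy
  rw [← map_sub]
  refine jet_norm_le (fun w hw => ?_) fun i hi w => ?_
  · have h1 : ‖y‖ ≤ ‖x‖ + 1 := by
      have := norm_sub_norm_le y x
      linarith
    rw [_root_.sub_apply, compAffine_neg_SB hσ y w (by linarith),
      compAffine_neg_SB hσ x w (by linarith), sub_zero]
  · have h1 : iteratedFDeriv ℝ i (⇑(compAffine φ (-1) (by norm_num) y -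
        compAffine φ (-1) (by norm_num) x)) w = (-1 : ℝ) ^ i • (iteratedFDeriv ℝ i φ
        ((-1 : ℝ) • w + y) - iteratedFDeriv ℝ i φ ((-1 : ℝ) • w + x)) := by
      rw [smul_sub, ← iteratedFDeriv_compAffine φ (-1) (by norm_num),
        ← iteratedFDeriv_compAffine φ (-1) (by norm_num), FunLike.coe_sub]
      exact iteratedFDeriv_sub_apply
        ((compAffine φ _ _ _).contDiff.contDiffAt.of_le (by exact_mod_cast le_top))
        ((compAffine φ _ _ _).contDiff.contDiffAt.of_le (by exact_mod_cast le_top))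
    rw [h1, norm_smul, norm_pow, norm_neg, norm_one, one_pow, one_mul]
    refine (norm_iteratedFDeriv_sub_le (hB (i + 1) (by omega)) _ _).trans (le_of_eq ?_)
    rw [add_sub_add_left_eq_sub]

theorem continuous_conv {f : Distr n 𝕜} (hf : f ∈ ExpDistr n 𝕜) (φ : TestFun n 𝕜) :
    Continuous (conv φ f) := by
  obtain ⟨N, F, hF⟩ := ExpDistr.exists_clm hf
  have : conv φ f = fun x => F (jet N (compAffine φ (-1) (by norm_num) x)) := by
    funext x
    rw [conv, hF]
  rw [this]
  exact F.continuous.comp (continuous_jet_translate N φ)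

/-- The jet of `(χ ∗ η)(x - ·)` is a Bochner integral of jets of translates of `η`, which depend
continuously on the translation; the bounded functional representing `f` commutes with this
integral. -/
theorem conv_T {f : Distr n 𝕜} (hf : f ∈ ExpDistr n 𝕜) (χ η : TestFun n 𝕜) (x : Eu n) :
    conv (T χ η) f x = ∫ z, χ z * conv η f (x - z) := by
  obtain ⟨N, F, hF⟩ := ExpDistr.exists_clm hf
  have hc : Continuous fun z => jet N (compAffine η (-1) (by norm_num) (x - z)) :=
    (continuous_jet_translate N η).comp (continuous_const.sub continuous_id)
  have hi : Integrable fun z => χ z • jet N (compAffine η (-1) (by norm_num) (x - z)) :=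
    (χ.continuous.smul hc).integrable_of_hasCompactSupport χ.hasCompactSupport.smul_right
  have key : jet N (compAffine (T χ η) (-1) (by norm_num) x)
      = ∫ z, χ z • jet N (compAffine η (-1) (by norm_num) (x - z)) := by
    refine JetSpace.ext fun i y => ?_
    rw [← (evalJet i y).integral_comp_comm hi]
    simp only [map_smul, evalJet_jet, iteratedFDeriv_compAffine, iteratedFDeriv_T]
    rw [← integral_smul, ← integral_smul]
    refine integral_congr_ae (Filter.Eventually.of_forall fun z => ?_)
    simp only
    rw [smul_comm (χ z), smul_comm (χ z), add_sub_assoc]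
  rw [conv, hF, key, ← F.integral_comp_comm hi]
  refine integral_congr_ae (Filter.Eventually.of_forall fun z => ?_)
  simp only [map_smul, smul_eq_mul, conv, hF]

theorem conv_add (φ ψ : TestFun n 𝕜) (f : Distr n 𝕜) (x : Eu n) :
    conv (φ + ψ) f x = conv φ f x + conv ψ f x := by
  rw [conv, conv, conv, ← map_add]
  rfl

theorem conv_sub (φ ψ : TestFun n 𝕜) (f : Distr n 𝕜) (x : Eu n) :
    conv (φ - ψ) f x = conv φ f x - conv ψ f x := by
  rw [conv, conv, conv, ← map_sub]
  rfl

end ExpGrowth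

/-! ### Vanishing moments and Taylor's formula -/

section Moments
open scoped ContDiff

variable {n : ℕ} {𝕜 : Type*} [RCLike 𝕜]

/-- All moments of `ζ` of order less than `l` vanish. -/
def VanishingMoments (l : ℕ) (ζ : TestFun n 𝕜) : Prop :=
  ∀ β : Fin n → ℕ, ∑ i, β i < l → ∫ x : Eu n, (∏ i, x i ^ β i) • ζ x = 0

theorem iteratedDeriv_comp_line (g : TestFun n 𝕜) (x v : Eu n) (i : ℕ) (s : ℝ) :
    iteratedDeriv i (fun s : ℝ => g (x + s • v)) s
      = iteratedFDeriv ℝ i g (x + s • v) (fun _ => v) := by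
  let L : ℝ →L[ℝ] Eu n := (ContinuousLinearMap.id ℝ ℝ).smulRight v
  have h1 : (fun s : ℝ => g (x + s • v)) = (fun y => g (x + y)) ∘ L := by
    funext s
    simp [L]
  have h2 : ContDiff ℝ i (fun y => g (x + y)) :=
    (g.contDiff.comp (contDiff_const.add contDiff_id)).of_le (by exact_mod_cast le_top)
  rw [iteratedDeriv_eq_iteratedFDeriv, h1, L.iteratedFDeriv_comp_right h2 s le_rfl,
    ContinuousMultilinearMap.compContinuousLinearMap_apply, iteratedFDeriv_comp_add_left]
  simp [L]

/-- Taylor's formula in one variable on the segment from `x` to `x + v`; the factorial in the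
remainder is discarded. -/
theorem norm_sub_taylor_le {m : ℕ} {B : ℝ} {g : TestFun n 𝕜} (hB : DB (m + 1) B g) (x v : Eu n) :
    ‖g (x + v) - ∑ i ∈ Finset.range (m + 1), ((i.factorial : ℝ)⁻¹) •
      iteratedFDeriv ℝ i g x (fun _ => v)‖ ≤ B * ‖v‖ ^ (m + 1) := by
  have hf : ContDiff ℝ (m + 1) (fun s : ℝ => g (x + s • v)) :=
    (g.contDiff.comp (contDiff_const.add (contDiff_id.smul contDiff_const))).of_le
      (by exact_mod_cast le_top)
  have hu : UniqueDiffOn ℝ (Icc (0 : ℝ) 1) := uniqueDiffOn_Icc one_pos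
  have hw : ∀ i ≤ m + 1, ∀ s ∈ Icc (0 : ℝ) 1,
      iteratedDerivWithin i (fun s : ℝ => g (x + s • v)) (Icc 0 1) s
        = iteratedFDeriv ℝ i g (x + s • v) (fun _ => v) := fun i hi s hs => by
    rw [← iteratedDeriv_comp_line]
    exact iteratedDerivWithin_eq_iteratedDeriv hu
      (hf.contDiffAt.of_le (by exact_mod_cast hi)) hs
  have h := taylor_mean_remainder_bound (f := fun s : ℝ => g (x + s • v)) (a := 0) (b := 1)
    (x := 1) (n := m) (C := B * ‖v‖ ^ (m + 1)) zero_le_one hf.contDiffOn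
    (right_mem_Icc.2 zero_le_one) fun s hs => by
      rw [hw _ le_rfl s hs]
      refine (ContinuousMultilinearMap.le_opNorm _ _).trans ?_
      rw [Finset.prod_const, Finset.card_univ, Fintype.card_fin]
      exact mul_le_mul_of_nonneg_right (hB _) (by positivity)
  rw [taylor_within_apply] at h
  have h2 : ∑ k ∈ Finset.range (m + 1), ((k.factorial : ℝ)⁻¹ * (1 - 0) ^ k) •
      iteratedDerivWithin k (fun s : ℝ => g (x + s • v)) (Icc 0 1) 0
      = ∑ i ∈ Finset.range (m + 1), ((i.factorial : ℝ)⁻¹) •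
      iteratedFDeriv ℝ i g x (fun _ => v) := by
    refine Finset.sum_congr rfl fun i hi => ?_
    rw [hw i (Finset.mem_range.1 hi).le 0 (left_mem_Icc.2 zero_le_one)]
    simp
  rw [h2, one_smul] at h
  refine h.trans ?_
  rw [sub_zero, one_pow, mul_one]
  exact div_le_self (mul_nonneg hB.nonneg (by positivity)) (by exact_mod_cast m.factorial_pos)

theorem VanishingMoments.integral_multilinear {l : ℕ} {ζ : TestFun n 𝕜}
    (hζ : VanishingMoments l ζ) {i : ℕ} (hi : i < l) (A : Eu n [×i]→L[ℝ] 𝕜) :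
    ∫ z, ζ z * A (fun _ => -z) = 0 := by
  have e1 : ∀ z : Eu n, A (fun _ => -z) = ∑ r : Fin i → Fin n,
      (∏ j, z j ^ (Finset.univ.filter fun k => r k = j).card) •
        A (fun k => -EuclideanSpace.single (r k) (1 : ℝ)) := fun z => by
    have hz : -z = ∑ j, z j • -(EuclideanSpace.single j (1 : ℝ)) := by
      ext k
      simp [Finset.sum_apply, Pi.single_apply]
    rw [hz, A.map_sum]
    refine Finset.sum_congr rfl fun r _ => ?_
    rw [A.map_smul_univ]
    congr 1
    rw [← Finset.prod_fiberwise' Finset.univ r fun j => z j]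
    simp
  have hint : ∀ r : Fin i → Fin n, Integrable fun z : Eu n => ζ z *
      ((∏ j, z j ^ (Finset.univ.filter fun k => r k = j).card) •
        A (fun k => -EuclideanSpace.single (r k) (1 : ℝ))) := fun r =>
    (ζ.continuous.mul (by fun_prop)).integrable_of_hasCompactSupport ζ.hasCompactSupport.mul_right
  simp_rw [e1, Finset.mul_sum]
  rw [integral_finsetSum _ fun r _ => hint r]
  refine Finset.sum_eq_zero fun r _ => ?_
  -- The exponents count how often each coordinate is chosen by `r`, so they add up to `i < l`.
  have h0 := hζ (fun j => (Finset.univ.filter fun k => r k = j).card) (by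
    rw [← Finset.card_eq_sum_card_fiberwise (fun k _ => Finset.mem_coe.2 (Finset.mem_univ (r k)))]
    simpa using hi)
  have e2 : ∀ z : Eu n, ζ z * ((∏ j, z j ^ (Finset.univ.filter fun k => r k = j).card) •
        A (fun k => -EuclideanSpace.single (r k) (1 : ℝ)))
      = ((∏ j, z j ^ (Finset.univ.filter fun k => r k = j).card) • ζ z) *
        A (fun k => -EuclideanSpace.single (r k) (1 : ℝ)) := fun z => by
    rw [mul_smul_comm, smul_mul_assoc]
  simp_rw [e2]
  rw [integral_mul_const, h0, zero_mul]

/-- The Taylor polynomial of `g` of degree less than `l` integrates to zero against `ζ`; the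
remainder on the support of `ζ` is at most `B ρ^l`. For `l = 0` nothing is subtracted. -/
theorem VanishingMoments.norm_T_le {l : ℕ} {ζ g : TestFun n 𝕜} (hζ : VanishingMoments l ζ)
    {ρ B : ℝ} (hρ : SB ρ ζ) (hB : DB l B g) :
    DB 0 ((∫ z, ‖ζ z‖) * ρ ^ l * B) (T ζ g) := by
  have hB0 := hB.nonneg
  rcases l with _ | m
  · rw [pow_zero, mul_one]
    exact T_DB ζ hB
  rw [DB_zero_iff]
  intro x
  have hi1 : ∀ i, Integrable fun z => ζ z * (((i.factorial : ℝ)⁻¹) •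
      iteratedFDeriv ℝ i g x (fun _ => -z)) := fun i => by
    refine (ζ.continuous.mul (Continuous.const_smul ?_ _)).integrable_of_hasCompactSupport
      ζ.hasCompactSupport.mul_right
    exact (iteratedFDeriv ℝ i g x).cont.comp (continuous_pi fun _ => continuous_neg)
  have e0 : ∫ z, ∑ i ∈ Finset.range (m + 1), ζ z * (((i.factorial : ℝ)⁻¹) •
      iteratedFDeriv ℝ i g x (fun _ => -z)) = 0 := by
    rw [integral_finsetSum _ fun i _ => hi1 i]
    refine Finset.sum_eq_zero fun i hi => ?_
    simp_rw [mul_smul_comm]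
    rw [integral_smul, hζ.integral_multilinear (Finset.mem_range.1 hi), smul_zero]
  have e1 : T ζ g x = ∫ z, ζ z * (g (x + -z) - ∑ i ∈ Finset.range (m + 1), ((i.factorial : ℝ)⁻¹) •
      iteratedFDeriv ℝ i g x (fun _ => -z)) := by
    simp_rw [mul_sub, Finset.mul_sum]
    rw [integral_sub _ (integrable_finsetSum _ fun i _ => hi1 i), e0, sub_zero, T_apply]
    · simp_rw [sub_eq_add_neg]
    · simpa [sub_eq_add_neg] using cvl_integrable ζ g x
  rw [e1, show (∫ z, ‖ζ z‖) * ρ ^ (m + 1) * B = ∫ z, ‖ζ z‖ * (ρ ^ (m + 1) * B) by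
    rw [integral_mul_const]; ring]
  refine norm_integral_le_of_norm_le ((integrable_norm ζ).mul_const _)
    (Filter.Eventually.of_forall fun z => ?_)
  rw [norm_mul]
  rcases lt_or_ge ρ ‖z‖ with hz | hz
  · simp [hρ z hz]
  · refine mul_le_mul_of_nonneg_left ((norm_sub_taylor_le hB x (-z)).trans ?_) (norm_nonneg _)
    rw [norm_neg, mul_comm]
    gcongr

end Moments

/-! ### Dilated kernels and their scaling -/

section Dilations

variable {n : ℕ} {𝕜 : Type*} [RCLike 𝕜]

theorem dilate_apply (j : ℕ) (g : TestFun n 𝕜) (y : Eu n) :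
    dilate j g y = (2 : 𝕜) ^ (j * n) * g ((2 : ℝ) ^ j • y) := by
  simp [dilate, _root_.smul_apply]

theorem norm_two_pow (m : ℕ) : ‖(2 : 𝕜) ^ m‖ = 2 ^ m := by
  rw [norm_pow, RCLike.norm_ofNat]

theorem dilate_SB {ρ : ℝ} {g : TestFun n 𝕜} (h : SB ρ g) (j : ℕ) :
    SB (ρ / 2 ^ j) (dilate j g) := fun x hx => by
  rw [dilate_apply, h _, mul_zero]
  rw [norm_smul, Real.norm_of_nonneg (by positivity)]
  rw [div_lt_iff₀ (by positivity)] at hx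
  rwa [mul_comm]

theorem dilate_DB {i : ℕ} {B : ℝ} {g : TestFun n 𝕜} (h : DB i B g) (j : ℕ) :
    DB i (B * (2 ^ (j * n) * 2 ^ (j * i))) (dilate j g) := fun x => by
  have : iteratedFDeriv ℝ i (dilate j g) x = (2 : 𝕜) ^ (j * n) •
      iteratedFDeriv ℝ i (compAffine g ((2 : ℝ) ^ j) (by positivity) 0) x := by
    rw [dilate, FunLike.coe_smul]
    exact iteratedFDeriv_const_smul_apply
      ((compAffine g _ _ _).contDiff.contDiffAt.of_le (by exact_mod_cast le_top))
  rw [this, iteratedFDeriv_compAffine, norm_smul, norm_smul, norm_two_pow, norm_pow, norm_pow,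
    Real.norm_ofNat, ← pow_mul]
  calc _ ≤ 2 ^ (j * n) * (2 ^ (j * i) * B) := by gcongr; exact h _
    _ = _ := by ring

theorem integral_two_pow_mul_comp_smul {G : Type*} [NormedAddCommGroup G] [NormedSpace ℝ G]
    (h : Eu n → G) (j : ℕ) :
    ∫ y : Eu n, (2 : ℝ) ^ (j * n) • h ((2 : ℝ) ^ j • y) = ∫ y, h y := by
  rw [integral_smul, Measure.integral_comp_smul, finrank_euclideanSpace_fin, smul_smul,
    abs_of_pos (by positivity), pow_mul, mul_inv_cancel₀ (by positivity), one_smul]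

theorem integral_dilate (j : ℕ) (g : TestFun n 𝕜) : ∫ y, dilate j g y = ∫ y, g y := by
  rw [← integral_two_pow_mul_comp_smul g j]
  refine integral_congr_ae (Filter.Eventually.of_forall fun y => ?_)
  simp only [dilate_apply]
  rw [RCLike.real_smul_eq_coe_mul]
  push_cast
  rfl

theorem integral_norm_dilate (j : ℕ) (g : TestFun n 𝕜) :
    ∫ y, ‖dilate j g y‖ = ∫ y, ‖g y‖ := by
  rw [← integral_two_pow_mul_comp_smul (fun y => ‖g y‖) j]
  refine integral_congr_ae (Filter.Eventually.of_forall fun y => ?_)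
  simp only [dilate_apply, norm_mul, norm_two_pow, smul_eq_mul]

theorem VanishingMoments.dilate {l : ℕ} {ζ : TestFun n 𝕜} (h : VanishingMoments l ζ) (j : ℕ) :
    VanishingMoments l (dilate j ζ) := fun β hβ => by
  have h0 := h β hβ
  rw [← integral_two_pow_mul_comp_smul _ j] at h0
  have e : ∀ y : Eu n, (2 : ℝ) ^ (j * n) • ((∏ i, (((2 : ℝ) ^ j • y) i) ^ β i) •
      ζ ((2 : ℝ) ^ j • y)) = (2 : ℝ) ^ (j * ∑ i, β i) • ((∏ i, y i ^ β i) •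
        VarBesov.dilate j ζ y) := fun y => by
    have e1 : ∏ i, (((2 : ℝ) ^ j • y) i) ^ β i = (2 : ℝ) ^ (j * ∑ i, β i) * ∏ i, y i ^ β i := by
      rw [Finset.mul_sum, ← Finset.prod_pow_eq_pow_sum, ← Finset.prod_mul_distrib]
      refine Finset.prod_congr rfl fun i _ => ?_
      rw [PiLp.smul_apply, smul_eq_mul, mul_pow, pow_mul]
    rw [e1, dilate_apply]
    simp only [RCLike.real_smul_eq_coe_mul]
    push_cast
    ring
  simp_rw [e] at h0
  rw [integral_smul] at h0
  exact (smul_eq_zero.1 h0).resolve_left (by positivity)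

theorem dilate_zero (g : TestFun n 𝕜) : dilate 0 g = g := by
  ext y
  simp [dilate_apply]

theorem kernelSeq_zero (g : TestFun n 𝕜) : kernelSeq g 0 = dilate 0 g := (dilate_zero g).symm

/-- The telescoping form of the kernels, on which the reproducing formula rests. -/
theorem kernelSeq_succ (g : TestFun n 𝕜) (k : ℕ) :
    kernelSeq g (k + 1) = dilate (k + 1) g - dilate k g := by
  ext y
  rw [kernelSeq, dilate_apply, _root_.sub_apply, dilate_apply, dilate_apply, diffKernel,
    _root_.sub_apply, mul_sub, _root_.smul_apply, compAffine_apply, add_zero, smul_smul,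
    pow_succ' (2 : ℝ) k, inv_mul_cancel_left₀ (two_ne_zero), smul_eq_mul, ← mul_assoc, add_mul,
    one_mul, pow_add, mul_inv_cancel_right₀ (pow_ne_zero _ two_ne_zero)]

theorem exists_kernelSeq_SB (g : TestFun n 𝕜) : ∃ ρ, 0 ≤ ρ ∧ ∀ k, SB (ρ / 2 ^ k) (kernelSeq g k) := by
  obtain ⟨ρ, hρ, h⟩ := exists_SB g
  obtain ⟨σ, hσ, h'⟩ := exists_SB (diffKernel g)
  refine ⟨max ρ σ, hρ.trans (le_max_left _ _), fun k => ?_⟩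
  rcases k with _ | k
  · rw [kernelSeq_zero]
    exact (dilate_SB h 0).mono (by gcongr; exact le_max_left _ _)
  · exact (dilate_SB h' (k + 1)).mono (by gcongr; exact le_max_right _ _)

theorem exists_kernelSeq_DB (g : TestFun n 𝕜) (i : ℕ) :
    ∃ B, 0 ≤ B ∧ ∀ k, DB i (B * (2 ^ (k * n) * 2 ^ (k * i))) (kernelSeq g k) := by
  obtain ⟨B, hB, h⟩ := exists_DB i g
  obtain ⟨C, hC, h'⟩ := exists_DB i (diffKernel g)
  refine ⟨max B C, hB.trans (le_max_left _ _), fun k => ?_⟩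
  rcases k with _ | k
  · rw [kernelSeq_zero]
    exact (dilate_DB h 0).mono (by gcongr; exact le_max_left _ _)
  · exact (dilate_DB h' (k + 1)).mono (by gcongr; exact le_max_right _ _)

end Dilations

/-! ### The local reproducing formula -/

section Reproducing
open scoped ContDiff

variable {n : ℕ} {𝕜 : Type*} [RCLike 𝕜]

/-- `1 - T`, for the convolution `T` with the `j`-th dilation of `φ`. -/
def defect (φ : TestFun n 𝕜) (j : ℕ) : Module.End 𝕜 (TestFun n 𝕜) := 1 - T (dilate j φ)

/-- The partial sum of the geometric series of `defect φ j`. -/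
def geomOp (φ : TestFun n 𝕜) (M j : ℕ) : Module.End 𝕜 (TestFun n 𝕜) :=
  ∑ i ∈ Finset.range (M + 1), defect φ j ^ i

/-- An approximate identity of order `M + 1`. -/
def approxId (φ : TestFun n 𝕜) (M j : ℕ) : Module.End 𝕜 (TestFun n 𝕜) := 1 - defect φ j ^ (M + 1)

/-- The divided difference of the power `M + 1` of the defects at consecutive levels. -/
def dividedDiff (φ : TestFun n 𝕜) (M j : ℕ) : Module.End 𝕜 (TestFun n 𝕜) :=
  ∑ i ∈ Finset.range (M + 1), defect φ j ^ i * defect φ (j + 1) ^ (M + 1 - 1 - i)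

/-- The dual operator of the reproducing formula at level `j + 1`. -/
def dualOp (φ : TestFun n 𝕜) (M j : ℕ) : Module.End 𝕜 (TestFun n 𝕜) :=
  dividedDiff φ M j * (approxId φ M (j + 1) + approxId φ M j)

theorem commute_T_defect (χ φ : TestFun n 𝕜) (j : ℕ) : Commute (T χ) (defect φ j) :=
  (Commute.one_right _).sub_right (T_commute _ _)

theorem commute_defect (φ : TestFun n 𝕜) (i j : ℕ) : Commute (defect φ i) (defect φ j) :=
  (Commute.one_left _).sub_left (commute_T_defect _ _ _)

theorem commute_T_geomOp (χ φ : TestFun n 𝕜) (M j : ℕ) : Commute (T χ) (geomOp φ M j) :=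
  Commute.sum_right _ _ _ fun _ _ => (commute_T_defect χ φ j).pow_right _

theorem commute_T_approxId (χ φ : TestFun n 𝕜) (M j : ℕ) : Commute (T χ) (approxId φ M j) :=
  (Commute.one_right _).sub_right ((commute_T_defect χ φ j).pow_right _)

theorem commute_approxId (φ : TestFun n 𝕜) (M i j : ℕ) :
    Commute (approxId φ M i) (approxId φ M j) :=
  (Commute.one_right _).sub_right
    (((Commute.one_left _).sub_left ((commute_defect φ i j).pow_left _)).pow_right _)

/-- The finite geometric series for `1 - E^(M+1)`. It exhibits a convolution with the dilated `φ`
inside every `approxId`, which is how vanishing moments are brought to bear on it. -/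
theorem approxId_eq (φ : TestFun n 𝕜) (M j : ℕ) :
    approxId φ M j = T (dilate j φ) * geomOp φ M j := by
  rw [approxId, geomOp, ← mul_neg_geom_sum (defect φ j) (M + 1), defect, sub_sub_cancel]

/-- A difference of squares of commuting operators, followed by the factorisation of `a^(M+1) -
b^(M+1)` by `a - b`, with `a`, `b` the defects at the levels `j` and `j + 1`; their difference is
convolution with the kernel of index `j + 1`. -/
theorem approxId_sq_sub (φ : TestFun n 𝕜) (M j : ℕ) :
    approxId φ M (j + 1) * approxId φ M (j + 1) - approxId φ M j * approxId φ M j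
      = T (kernelSeq φ (j + 1)) * dualOp φ M j := by
  have h1 : T (kernelSeq φ (j + 1)) = defect φ j - defect φ (j + 1) := by
    rw [kernelSeq_succ, T_sub, defect, defect, sub_sub_sub_cancel_left]
  have h2 : approxId φ M (j + 1) - approxId φ M j
      = (defect φ j - defect φ (j + 1)) * dividedDiff φ M j := by
    rw [dividedDiff, (commute_defect φ j (j + 1)).mul_geom_sum₂, approxId, approxId,
      sub_sub_sub_cancel_left]
  rw [(commute_approxId φ M (j + 1) j).mul_self_sub_mul_self_eq', h2, h1, dualOp, mul_assoc]

section Bounds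

variable {φ : TestFun n 𝕜} {ρ : ℝ}

theorem defect_OpBd (hφ : ∫ x, φ x = 1) (hρ0 : 0 ≤ ρ) (hρ : SB ρ φ) {j l : ℕ} (hl : l ≤ j) :
    OpBd (defect φ j) 1 (ρ / 2 ^ l * ∫ z, ‖φ z‖) (ρ / 2 ^ l) := by
  have hI : 0 ≤ ∫ z, ‖φ z‖ := integral_nonneg fun _ => norm_nonneg _
  have h := one_sub_T_OpBd (χ := dilate j φ) (by rw [integral_dilate, hφ])
    (by positivity) (dilate_SB hρ j)
  rw [integral_norm_dilate] at h
  have h1 : ρ / 2 ^ j ≤ ρ / 2 ^ l :=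
    div_le_div_of_nonneg_left hρ0 (by positivity) (pow_le_pow_right₀ one_le_two hl)
  exact h.mono (mul_le_mul_of_nonneg_right h1 hI) h1

theorem defect_OpBd_zero (hρ0 : 0 ≤ ρ) (hρ : SB ρ φ) {j l : ℕ} (hl : l ≤ j) :
    OpBd (defect φ j) 0 (1 + ∫ z, ‖φ z‖) (ρ / 2 ^ l) := by
  have h := one_sub_T_OpBd_zero (by positivity) (dilate_SB hρ j)
  rw [integral_norm_dilate] at h
  exact h.mono le_rfl
    (div_le_div_of_nonneg_left hρ0 (by positivity) (pow_le_pow_right₀ one_le_two hl))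

/-- Each summand is a product of `M` defects of level `j` or `j + 1`, and each of them trades one
derivative for `2^(-j)`. -/
theorem dividedDiff_OpBd (hφ : ∫ x, φ x = 1) (hρ0 : 0 ≤ ρ) (hρ : SB ρ φ) (M j : ℕ) :
    OpBd (dividedDiff φ M j) M ((M + 1) * (ρ * ∫ z, ‖φ z‖) ^ M / 2 ^ (j * M))
      ((M + 1) * ρ / 2 ^ j) := by
  have h : ∀ i ∈ Finset.range (M + 1), OpBd (defect φ j ^ i * defect φ (j + 1) ^ (M + 1 - 1 - i)) M
      ((ρ / 2 ^ j * ∫ z, ‖φ z‖) ^ M) (M * (ρ / 2 ^ j)) := fun i hi => by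
    have hi' : i + (M - i) = M := by have := Finset.mem_range.1 hi; omega
    have := ((defect_OpBd hφ hρ0 hρ (le_refl j)).pow i).mul
      ((defect_OpBd hφ hρ0 hρ (Nat.le_succ j)).pow (M - i))
    rw [mul_one, mul_one, hi', ← pow_add, hi', ← add_mul, ← Nat.cast_add, hi'] at this
    exact this
  refine (OpBd.sum _ h).mono (le_of_eq ?_) ?_
  · rw [Finset.card_range, pow_mul, mul_div_assoc, ← div_pow]
    push_cast
    ring
  · rw [← mul_div_assoc]
    gcongr
    linarith

/-- Here no derivative is spent and nothing is gained; this version serves where the smallness comes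
from vanishing moments. -/
theorem dividedDiff_OpBd_zero (hρ0 : 0 ≤ ρ) (hρ : SB ρ φ) (M j : ℕ) :
    OpBd (dividedDiff φ M j) 0 ((M + 1) * (1 + ∫ z, ‖φ z‖) ^ M) ((M + 1) * ρ / 2 ^ j) := by
  have h : ∀ i ∈ Finset.range (M + 1), OpBd (defect φ j ^ i * defect φ (j + 1) ^ (M + 1 - 1 - i)) 0
      ((1 + ∫ z, ‖φ z‖) ^ M) (M * (ρ / 2 ^ j)) := fun i hi => by
    have hi' : i + (M - i) = M := by have := Finset.mem_range.1 hi; omega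
    have := ((defect_OpBd_zero hρ0 hρ (le_refl j)).pow i).mul
      ((defect_OpBd_zero hρ0 hρ (Nat.le_succ j)).pow (M - i))
    rw [mul_zero, mul_zero, ← pow_add, hi', ← add_mul, ← Nat.cast_add, hi'] at this
    exact this
  refine (OpBd.sum _ h).mono (le_of_eq ?_) ?_
  · rw [Finset.card_range]
    push_cast
    ring
  · rw [← mul_div_assoc]
    gcongr
    linarith

theorem geomOp_OpBd (hρ0 : 0 ≤ ρ) (hρ : SB ρ φ) (M : ℕ) {j l : ℕ} (hl : l ≤ j) :
    OpBd (geomOp φ M j) 0 ((M + 1) * (1 + ∫ z, ‖φ z‖) ^ M) (M * ρ / 2 ^ l) := by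
  have hI : 0 ≤ ∫ z, ‖φ z‖ := integral_nonneg fun _ => norm_nonneg _
  have h : ∀ i ∈ Finset.range (M + 1), OpBd (defect φ j ^ i) 0
      ((1 + ∫ z, ‖φ z‖) ^ M) (M * ρ / 2 ^ l) := fun i hi => by
    have hi' : i ≤ M := Nat.lt_succ_iff.1 (Finset.mem_range.1 hi)
    have := (defect_OpBd_zero hρ0 hρ hl).pow i
    rw [mul_zero] at this
    refine this.mono (pow_le_pow_right₀ (by linarith) hi') ?_
    rw [← mul_div_assoc]
    gcongr
  refine (OpBd.sum _ h).mono (le_of_eq ?_) le_rfl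
  rw [Finset.card_range]
  push_cast
  ring

theorem approxId_OpBd (hρ0 : 0 ≤ ρ) (hρ : SB ρ φ) (M : ℕ) {j l : ℕ} (hl : l ≤ j) :
    OpBd (approxId φ M j) 0 ((∫ z, ‖φ z‖) * ((M + 1) * (1 + ∫ z, ‖φ z‖) ^ M))
      ((M + 1) * ρ / 2 ^ l) := by
  have h := (T_OpBd (dilate_SB hρ j)).mul (geomOp_OpBd hρ0 hρ M hl)
  rw [integral_norm_dilate, ← approxId_eq] at h
  refine h.mono le_rfl ?_
  rw [add_mul, one_mul, add_div, add_comm]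
  gcongr
  exact one_le_two

theorem dualOp_OpBd (hφ : ∫ x, φ x = 1) (hρ0 : 0 ≤ ρ) (hρ : SB ρ φ) (M : ℕ) :
    ∃ C, 0 ≤ C ∧ ∀ j, OpBd (dualOp φ M j) M (C / 2 ^ (j * M)) (2 * ((M + 1) * ρ) / 2 ^ j) := by
  have hI : 0 ≤ ∫ z, ‖φ z‖ := integral_nonneg fun _ => norm_nonneg _
  refine ⟨((M + 1) * (ρ * ∫ z, ‖φ z‖) ^ M) * (2 * ((∫ z, ‖φ z‖) * ((M + 1) *
    (1 + ∫ z, ‖φ z‖) ^ M))), by positivity, fun j => ?_⟩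
  refine ((dividedDiff_OpBd hφ hρ0 hρ M j).mul
    ((approxId_OpBd hρ0 hρ M (Nat.le_succ j)).add (approxId_OpBd hρ0 hρ M le_rfl))).mono
    (le_of_eq ?_) (le_of_eq ?_)
  all_goals ring

/-- After exchanging the factors, `(χ ∗ h) ∗ f` is `h` convolved with the function `χ ∗ f`, and `h`
is bounded by `B` and lives in a ball of radius `σ`. -/
theorem enorm_conv_T_le {f : Distr n 𝕜} (hf : f ∈ ExpDistr n 𝕜) (χ : TestFun n 𝕜)
    {h : TestFun n 𝕜} {σ B : ℝ} (hσ : SB σ h) (hB : DB 0 B h) (x : Eu n) :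
    ‖conv (T χ h) f x‖ₑ
      ≤ ENNReal.ofReal B * ∫⁻ y in Metric.closedBall x σ, ‖conv χ f y‖ₑ := by
  rw [T_comm, conv_T hf]
  refine (enorm_integral_le_lintegral_enorm _).trans ?_
  rw [← lintegral_sub_left_eq_self (fun z => ‖h z * conv χ f (x - z)‖ₑ) x,
    ← lintegral_indicator Metric.isClosed_closedBall.measurableSet,
    ← lintegral_const_mul' _ _ ENNReal.ofReal_ne_top]
  refine lintegral_mono fun y => ?_
  simp only [sub_sub_cancel]
  by_cases hy : y ∈ Metric.closedBall x σ
  · rw [indicator_of_mem hy, enorm_mul]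
    gcongr
    rw [← ofReal_norm]
    exact ENNReal.ofReal_le_ofReal (DB_zero_iff.1 hB _)
  · rw [hσ (x - y), zero_mul, enorm_zero]
    · exact zero_le
    · rw [Metric.mem_closedBall, not_le, dist_comm, dist_eq_norm] at hy
      exact hy

/-- With `A = 1 - E^(M+1)` one has `1 - A² = E^(M+1) (1 + A)`. The defects gain a power of `2^(-j)`
at the cost of `M + 1` derivatives of `g`, beyond the order `N` of `f`, and the supports stay in a
fixed ball. -/
theorem tendsto_conv_approxId (hφ : ∫ x, φ x = 1) (M : ℕ) {f : Distr n 𝕜}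
    (hf : f ∈ ExpDistr n 𝕜) (g : TestFun n 𝕜) (x : Eu n) :
    Filter.Tendsto (fun j => conv ((approxId φ M j * approxId φ M j) g) f x) Filter.atTop
      (nhds (conv g f x)) := by
  obtain ⟨ρ, hρ0, hρ⟩ := exists_SB φ
  obtain ⟨N, C, hC, hconv⟩ := exists_norm_conv_le hf
  obtain ⟨σ, hσ0, hσ⟩ := exists_SB g
  obtain ⟨B, hB0, hB⟩ := exists_DB_le (N + (M + 1)) g
  set I := ∫ z, ‖φ z‖ with hI'
  have hI : 0 ≤ I := integral_nonneg fun _ => norm_nonneg _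
  set K := 1 + I * ((M + 1) * (1 + I) ^ M) with hK
  have hK0 : 0 ≤ K := by positivity
  have hE : ∀ j, OpBd (defect φ j ^ (M + 1) * (1 + approxId φ M j)) (M + 1)
      ((ρ * I) ^ (M + 1) * K / 2 ^ j) ((M + 1) * ρ + (M + 1) * ρ) := fun j => by
    have h1 := ((defect_OpBd hφ hρ0 hρ (le_refl j)).pow (M + 1)).mul
      ((OpBd.one (𝕜 := 𝕜) (n := n) (by positivity)).add (approxId_OpBd hρ0 hρ M (le_refl j)))
    rw [mul_one, add_zero] at h1
    have h2j : (1 : ℝ) ≤ 2 ^ j := one_le_pow₀ one_le_two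
    refine h1.mono ?_ ?_
    · rw [← hI', ← hK, div_mul_eq_mul_div, div_pow, div_mul_eq_mul_div]
      -- Of the gain `2^(-j(M+1))` the factor `2^(-j)` is enough.
      exact div_le_div_of_nonneg_left (by positivity) (by positivity)
        (le_self_pow₀ h2j (Nat.succ_ne_zero M))
    · push_cast
      rw [← mul_div_assoc]
      exact add_le_add (div_le_self (by positivity) h2j) (div_le_self (by positivity) h2j)
  have hid : ∀ j, g - (approxId φ M j * approxId φ M j) g
      = (defect φ j ^ (M + 1) * (1 + approxId φ M j)) g := fun j => by
    have : (1 : Module.End 𝕜 (TestFun n 𝕜)) - approxId φ M j * approxId φ M j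
        = defect φ j ^ (M + 1) * (1 + approxId φ M j) := by
      rw [approxId]
      noncomm_ring
    rw [← this, LinearMap.sub_apply, Module.End.one_apply]
  rw [tendsto_iff_norm_sub_tendsto_zero]
  have hlim : Filter.Tendsto (fun j : ℕ => C * Real.exp (N * (‖x‖ + (σ + ((M + 1) * ρ + (M + 1) * ρ))))
      * ((ρ * I) ^ (M + 1) * K * B) * (1 / 2) ^ j) Filter.atTop (nhds 0) := by
    simpa using (tendsto_pow_atTop_nhds_zero_of_lt_one (r := (1 / 2 : ℝ)) (by norm_num)
      (by norm_num)).const_mul (C * Real.exp (N * (‖x‖ + (σ + ((M + 1) * ρ + (M + 1) * ρ))))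
      * ((ρ * I) ^ (M + 1) * K * B))
  refine squeeze_zero (fun j => norm_nonneg _) (fun j => ?_) hlim
  rw [norm_sub_rev, ← conv_sub, hid]
  refine (hconv _ _ _ x (hE j 0 B σ g (hB _ (by omega)) hσ).2 fun i hi =>
    (hE j i B σ g (hB _ (by omega)) hσ).1).trans (le_of_eq ?_)
  rw [one_div, inv_pow]
  ring

end Bounds

end Reproducing

/-- Powers of two with values in `[0, ∞]`. -/
def w (a : ℝ) : ℝ≥0∞ := (2 : ℝ≥0∞) ^ a

theorem w_add (a b : ℝ) : w (a + b) = w a * w b :=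
  ENNReal.rpow_add a b two_ne_zero ENNReal.ofNat_ne_top

theorem w_zero : w 0 = 1 := ENNReal.rpow_zero

theorem w_mono {a b : ℝ} (h : a ≤ b) : w a ≤ w b :=
  ENNReal.rpow_le_rpow_of_exponent_le one_le_two h

theorem w_rpow (a b : ℝ) : w a ^ b = w (a * b) := (ENNReal.rpow_mul 2 a b).symm

theorem w_pos (a : ℝ) : 0 < w a := ENNReal.rpow_pos (by norm_num) ENNReal.ofNat_ne_top

theorem w_ne_top (a : ℝ) : w a ≠ ∞ :=
  ENNReal.rpow_ne_top_of_nonneg' (by norm_num) ENNReal.ofNat_ne_top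

theorem ofReal_two_rpow (a : ℝ) : ENNReal.ofReal ((2 : ℝ) ^ a) = w a := by
  rw [w, ← ENNReal.ofReal_rpow_of_pos two_pos, ENNReal.ofReal_ofNat]

theorem w_natCast (m : ℕ) : w m = 2 ^ m := ENNReal.rpow_natCast 2 m

theorem ofReal_two_pow_div (a b : ℕ) :
    ENNReal.ofReal ((2 : ℝ) ^ a / 2 ^ b) = w (a - b) := by
  rw [← ofReal_two_rpow, Real.rpow_sub two_pos, Real.rpow_natCast, Real.rpow_natCast]

/-! ### Pointwise estimates of kernels by kernels -/

section Reproducing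

variable {n : ℕ} {𝕜 : Type*} [RCLike 𝕜]

section Bounds

variable {φ : TestFun n 𝕜} {ρ : ℝ}

/-- Telescoping of `A_j²` upwards from level `k`: a function `g` of scale `2^(-k)` has `M`-th
derivatives of size `2^(kn + kM)`, against which the dual operator at level `k + d` gains
`2^(-(k+d)M)`. -/
theorem enorm_conv_le_approxId_add_tsum (hφ : ∫ x, φ x = 1) (M : ℕ) :
    ∃ C R : ℝ, 0 ≤ C ∧ 0 ≤ R ∧ ∀ (k : ℕ) (g : TestFun n 𝕜) (σ B : ℝ), 0 ≤ σ → SB (σ / 2 ^ k) g →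
      DB M (B * (2 ^ (k * n) * 2 ^ (k * M))) g → ∀ f ∈ ExpDistr n 𝕜, ∀ x : Eu n,
      ‖conv g f x‖ₑ ≤ ‖conv ((approxId φ M k * approxId φ M k) g) f x‖ₑ +
        ENNReal.ofReal (C * B) * ∑' d : ℕ, w (k * n - M * d) *
          ∫⁻ y in Metric.closedBall x ((σ + R) / 2 ^ k), ‖conv (kernelSeq φ (k + d)) f y‖ₑ := by
  obtain ⟨ρ, hρ0, hρ⟩ := exists_SB φ
  obtain ⟨C, hC, hΨ⟩ := dualOp_OpBd hφ hρ0 hρ M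
  -- The dual operator at level `k + d` is paired with the kernel of level `k + d + 1`; the factor
  -- `2^M` pays for this shift. The second witness is the radius by which the dual operators enlarge
  -- supports.
  refine ⟨C * 2 ^ M, 2 * ((M + 1) * ρ), by positivity, by positivity,
    fun k g σ B hσ0 hσ hB f hf x => ?_⟩
  set a : ℕ → ℝ≥0∞ := fun d => w (k * n - M * d) *
    ∫⁻ y in Metric.closedBall x ((σ + 2 * ((M + 1) * ρ)) / 2 ^ k),
      ‖conv (kernelSeq φ (k + d)) f y‖ₑ with ha
  have hB0 : 0 ≤ B := nonneg_of_mul_nonneg_left hB.nonneg (by positivity)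
  have hterm : ∀ d, ‖conv ((T (kernelSeq φ (k + d + 1)) * dualOp φ M (k + d)) g) f x‖ₑ
      ≤ ENNReal.ofReal (C * 2 ^ M * B) * a (d + 1) := fun d => by
    obtain ⟨h1, h2⟩ := hΨ (k + d) 0 _ _ g (by rwa [zero_add]) hσ
    have h1' : DB 0 (C * 2 ^ M * B * (2 ^ (k * n) / 2 ^ (M * (d + 1)))) (dualOp φ M (k + d) g) := by
      refine h1.mono (le_of_eq ?_)
      rw [add_mul, pow_add, mul_comm d M, mul_add, pow_add, mul_one]
      field_simp
    have h2' : SB ((σ + 2 * ((M + 1) * ρ)) / 2 ^ k) (dualOp φ M (k + d) g) := by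
      refine h2.mono ?_
      rw [add_div]
      gcongr
      · exact one_le_two
      · omega
    refine (enorm_conv_T_le hf _ h2' h1' x).trans (le_of_eq ?_)
    rw [ENNReal.ofReal_mul (by positivity), ofReal_two_pow_div, mul_assoc, ha]
    push_cast
    rfl
  have hsum : ∀ D, ‖conv ((approxId φ M (k + D) * approxId φ M (k + D)) g) f x‖ₑ
      ≤ ‖conv ((approxId φ M k * approxId φ M k) g) f x‖ₑ +
        ENNReal.ofReal (C * 2 ^ M * B) * ∑ d ∈ Finset.range D, a (d + 1) := fun D => by
    induction D with
    | zero => simp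
    | succ D ih =>
      have e : (approxId φ M (k + (D + 1)) * approxId φ M (k + (D + 1))) g
          = (approxId φ M (k + D) * approxId φ M (k + D)) g +
            (T (kernelSeq φ (k + D + 1)) * dualOp φ M (k + D)) g := by
        rw [← approxId_sq_sub, LinearMap.sub_apply, add_sub_cancel, add_assoc]
      rw [e, conv_add, Finset.sum_range_succ, mul_add, ← add_assoc]
      exact (enorm_add_le _ _).trans (add_le_add ih (hterm D))
  have hlim := (((tendsto_conv_approxId hφ M hf g x).comp
    (Filter.tendsto_add_atTop_nat k)).enorm)
  refine le_of_tendsto hlim (Filter.Eventually.of_forall fun D => ?_)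
  have := hsum D
  rw [add_comm k D] at this
  refine this.trans ?_
  gcongr
  exact (ENNReal.sum_le_tsum _).trans
    (ENNReal.tsum_comp_le_tsum_of_injective Nat.succ_injective a)

/-- The operator form of exchanging two convolution factors: the factor `A` of `P` acts on `b`, and
`A b = B a` trades it for `B`. It is applied with `b` the kernel of level `k` and `B` the
convolution with this kernel, so that the distribution is tested only through that kernel. -/
theorem mul_apply_eq_of_commute {V : Type*} [AddCommGroup V] [Module 𝕜 V]
    {A B P Q : Module.End 𝕜 V} {a b : V} (hP : P = A * Q) (hAQ : Commute A Q) (hAP : Commute A P)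
    (hBQ : Commute B Q) (hBP : Commute B P) (h : A b = B a) : (P * P) b = B ((Q * P) a) := by
  have e : P * P = Q * P * A := by
    rw [mul_assoc, ← hAP.eq, ← mul_assoc, ← hAQ.eq, ← hP]
  rw [e, Module.End.mul_apply _ A, h, ← Module.End.mul_apply _ B, ← (hBQ.mul_right hBP).eq,
    Module.End.mul_apply B]

theorem approxId_sq_apply_kernelSeq (φ : TestFun n 𝕜) (M k : ℕ) :
    (approxId φ M k * approxId φ M k) (kernelSeq φ k)
      = T (kernelSeq φ k) ((geomOp φ M k * approxId φ M k) (dilate k φ)) :=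
  mul_apply_eq_of_commute (approxId_eq φ M k) (commute_T_geomOp _ φ M k)
    (commute_T_approxId _ φ M k) (commute_T_geomOp _ φ M k) (commute_T_approxId _ φ M k)
    (T_comm (dilate k φ) (kernelSeq φ k))

/-- The kernels at level `k` are controlled by the kernels at the levels `k + d`, `d ≥ 0`. -/
theorem exists_enorm_conv_kernelSeq_le (hφ : ∫ x, φ x = 1) (M : ℕ) :
    ∃ (C : ℝ≥0) (c : ℝ), 0 ≤ c ∧ ∀ f ∈ ExpDistr n 𝕜, ∀ (k : ℕ) (x : Eu n),
      ‖conv (kernelSeq φ k) f x‖ₑ ≤ C * ∑' d : ℕ, w (k * n - M * d) *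
          ∫⁻ y in Metric.closedBall x (c / 2 ^ k), ‖conv (kernelSeq φ (k + d)) f y‖ₑ := by
  obtain ⟨C, R, hC, hR, h⟩ := enorm_conv_le_approxId_add_tsum hφ M
  obtain ⟨σ, hσ0, hσ⟩ := exists_kernelSeq_SB φ
  obtain ⟨B, hB0, hB⟩ := exists_kernelSeq_DB φ M
  obtain ⟨ρ, hρ0, hρ⟩ := exists_SB φ
  obtain ⟨B', hB'0, hB'⟩ := exists_DB 0 φ
  have hI : 0 ≤ ∫ z, ‖φ z‖ := integral_nonneg fun _ => norm_nonneg _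
  set J := ((M + 1) * (1 + ∫ z, ‖φ z‖) ^ M) * ((∫ z, ‖φ z‖) * ((M + 1) * (1 + ∫ z, ‖φ z‖) ^ M))
    with hJ
  have hJ0 : 0 ≤ J := by positivity
  set c := max (σ + R) (ρ + (M * ρ + (M + 1) * ρ)) with hc
  refine ⟨(J * B').toNNReal + (C * B).toNNReal, c, by positivity, fun f hf k x => ?_⟩
  have hc1 : Metric.closedBall x ((σ + R) / 2 ^ k) ⊆ Metric.closedBall x (c / 2 ^ k) :=
    Metric.closedBall_subset_closedBall (by gcongr; exact le_max_left _ _)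
  set a : ℕ → ℝ≥0∞ := fun d => w (k * n - M * d) *
    ∫⁻ y in Metric.closedBall x (c / 2 ^ k), ‖conv (kernelSeq φ (k + d)) f y‖ₑ with ha
  have h1 := h k (kernelSeq φ k) σ B hσ0 (hσ k) (hB k) f hf x
  have h2 : ‖conv ((approxId φ M k * approxId φ M k) (kernelSeq φ k)) f x‖ₑ
      ≤ ENNReal.ofReal (J * B') * a 0 := by
    obtain ⟨h3, h4⟩ := ((geomOp_OpBd hρ0 hρ M (le_refl k)).mul (approxId_OpBd hρ0 hρ M (le_refl k)))
      0 _ _ (dilate k φ) (dilate_DB hB' k) (dilate_SB hρ k)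
    have h4' : SB (c / 2 ^ k) ((geomOp φ M k * approxId φ M k) (dilate k φ)) := by
      refine h4.mono ?_
      rw [← add_div, ← add_div]
      gcongr
      exact le_max_right _ _
    have h3' : DB 0 (J * B' * (2 ^ (k * n) / 2 ^ (0 : ℕ)))
        ((geomOp φ M k * approxId φ M k) (dilate k φ)) := by
      refine h3.mono (le_of_eq ?_)
      rw [hJ, mul_zero, pow_zero, div_one, mul_one, ← mul_assoc]
    rw [approxId_sq_apply_kernelSeq]
    refine (enorm_conv_T_le hf _ h4' h3' x).trans (le_of_eq ?_)
    have e3 : (((k * n : ℕ) : ℝ) - ((0 : ℕ) : ℝ)) = k * n - M * ((0 : ℕ) : ℝ) := by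
      push_cast
      rw [mul_zero]
    rw [ENNReal.ofReal_mul (mul_nonneg hJ0 hB'0), ofReal_two_pow_div, e3, mul_assoc]
    rfl
  calc ‖conv (kernelSeq φ k) f x‖ₑ
      ≤ ENNReal.ofReal (J * B') * a 0 + ENNReal.ofReal (C * B) * ∑' d, a d := by
        refine h1.trans (add_le_add h2 ?_)
        exact mul_le_mul' le_rfl (ENNReal.tsum_le_tsum fun d =>
          mul_le_mul' le_rfl (lintegral_mono_set hc1))
    _ ≤ ENNReal.ofReal (J * B') * (∑' d, a d) + ENNReal.ofReal (C * B) * ∑' d, a d := by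
        gcongr
        exact ENNReal.le_tsum 0
    _ = _ := by
        rw [← add_mul]
        push_cast
        rfl

/-- The `l` moments of the kernel at the finer scale `2^(-(k+1))` meet the `l`-th derivatives of `φ`
at the scale `2^(-j)`; the ratio of the scales enters to the power `l`. -/
theorem T_dilate_kernelSeq_DB {ζ : TestFun n 𝕜} {l : ℕ} (hζ : VanishingMoments l (diffKernel ζ)) :
    ∃ B, 0 ≤ B ∧ ∀ j k, j ≤ k + 1 →
      DB 0 (B * (2 ^ (j * n) / 2 ^ (l * (k + 1 - j)))) (T (dilate j φ) (kernelSeq ζ (k + 1))) := by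
  obtain ⟨ρ, hρ0, hρ⟩ := exists_SB (diffKernel ζ)
  obtain ⟨B, hB0, hB⟩ := exists_DB l φ
  have hI : 0 ≤ ∫ z, ‖diffKernel ζ z‖ := integral_nonneg fun _ => norm_nonneg _
  refine ⟨(∫ z, ‖diffKernel ζ z‖) * ρ ^ l * B, by positivity, fun j k hj => ?_⟩
  rw [T_comm, kernelSeq]
  have := (hζ.dilate (k + 1)).norm_T_le (dilate_SB hρ (k + 1)) (dilate_DB hB j)
  rw [integral_norm_dilate] at this
  refine this.mono (le_of_eq ?_)
  obtain ⟨e, he⟩ := Nat.exists_eq_add_of_le hj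
  rw [he, Nat.add_sub_cancel_left, div_pow, ← pow_mul, add_mul, pow_add, mul_comm l e]
  field_simp

/-- Telescoping from level `0` up to `m`. The extra factor `approxId` in every dual operator
convolves the kernel of `ζ` with a dilation of `φ`, which produces the decay `2^(-l(k-j))`; the
remaining factors are merely bounded. -/
theorem enorm_conv_approxId_sq_kernelSeq_le {ζ : TestFun n 𝕜} {l : ℕ}
    (hζ : VanishingMoments l (diffKernel ζ)) (M : ℕ) :
    ∃ (C : ℝ≥0) (c : ℝ), 0 ≤ c ∧ ∀ f ∈ ExpDistr n 𝕜, ∀ (k m : ℕ), m ≤ k → ∀ x : Eu n,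
      ‖conv ((approxId φ M m * approxId φ M m) (kernelSeq ζ k)) f x‖ₑ
        ≤ C * ∑ j ∈ Finset.range (m + 1), w (j * n - l * (k - j)) *
          ∫⁻ y in Metric.closedBall x (c / 2 ^ j), ‖conv (kernelSeq φ j) f y‖ₑ := by
  obtain ⟨σ, hσ0, hσ⟩ := exists_kernelSeq_SB ζ
  obtain ⟨B₀, hB₀0, hB₀⟩ := exists_kernelSeq_DB ζ 0
  obtain ⟨ρ, hρ0, hρ⟩ := exists_SB φ
  obtain ⟨B', hB'0, hB'⟩ := T_dilate_kernelSeq_DB (φ := φ) hζ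
  have hI : 0 ≤ ∫ z, ‖φ z‖ := integral_nonneg fun _ => norm_nonneg _
  set I := ∫ z, ‖φ z‖ with hI'
  set q := (M + 1) * (1 + I) ^ M with hq
  have hq0 : 0 ≤ q := by positivity
  set B₁ := B₀ * I + B' with hB₁
  have hTB : ∀ k, DB 0 (B₁ * (1 / 2 ^ (l * k))) (T (dilate 0 φ) (kernelSeq ζ k)) := fun k => by
    -- The kernel of `ζ` of index `0` need not have vanishing moments, but for `k = 0` no decay is
    -- claimed.
    rcases k with _ | k
    · have h1 := T_DB (dilate 0 φ) (hB₀ 0)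
      rw [integral_norm_dilate, ← hI'] at h1
      refine h1.mono ?_
      simp only [mul_zero, pow_zero, zero_mul, mul_one, div_one, hB₁]
      nlinarith
    · refine (hB' 0 k (Nat.zero_le _)).mono ?_
      simp only [zero_mul, pow_zero, Nat.sub_zero, hB₁]
      gcongr
      nlinarith [mul_nonneg hB₀0 hI]
  set r := σ + (4 * M + 4) * ρ with hr
  have hr0 : 0 ≤ r := by positivity
  have h0 : ∀ k, DB 0 (q * q * B₁ * (2 ^ (0 * n) / 2 ^ (l * k)))
      ((geomOp φ M 0 * approxId φ M 0) (kernelSeq ζ k)) ∧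
      SB (r / 2 ^ 0) ((geomOp φ M 0 * approxId φ M 0) (kernelSeq ζ k)) := fun k => by
    have hQ := geomOp_OpBd hρ0 hρ M (le_refl 0)
    constructor
    · obtain ⟨B'', -, h2⟩ := exists_SB (T (dilate 0 φ) (kernelSeq ζ k))
      have h1 := ((hQ.mul hQ) 0 _ _ _ (hTB k) h2).1
      have e : (geomOp φ M 0 * approxId φ M 0) (kernelSeq ζ k)
          = (geomOp φ M 0 * geomOp φ M 0) (T (dilate 0 φ) (kernelSeq ζ k)) := by
        rw [approxId_eq, (commute_T_geomOp _ _ _ _).eq]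
        rfl
      rw [e]
      refine h1.mono (le_of_eq ?_)
      rw [zero_mul, pow_zero]
      ring
    · refine ((hQ.mul (approxId_OpBd hρ0 hρ M (le_refl 0))) 0 _ _ _ (hB₀ k) (hσ k)).2.mono ?_
      have : σ / 2 ^ k ≤ σ := div_le_self hσ0 (one_le_pow₀ one_le_two)
      rw [hr]
      simp only [pow_zero, div_one]
      nlinarith [mul_nonneg (Nat.cast_nonneg (α := ℝ) M) hρ0]
  set K := q * (2 * (q * B')) with hK
  have hK0 : 0 ≤ K := by positivity
  -- The dual operator of level `j` is measured at level `j + 1`, where it will be paired with the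
  -- kernel of `φ`; therefore the radius is `2 * r`.
  have hj : ∀ j k, j ≤ k → DB 0 (K * (2 ^ ((j + 1) * n) / 2 ^ (l * (k - j))))
      (dualOp φ M j (kernelSeq ζ (k + 1))) ∧
      SB (2 * r / 2 ^ (j + 1)) (dualOp φ M j (kernelSeq ζ (k + 1))) := fun j k hjk => by
    constructor
    · have hA : ∀ i, j ≤ i → i ≤ j + 1 →
          DB 0 (q * (B' * (2 ^ ((j + 1) * n) / 2 ^ (l * (k - j)))))
            (approxId φ M i (kernelSeq ζ (k + 1))) := fun i hi1 hi2 => by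
        obtain ⟨B'', -, h2⟩ := exists_SB (T (dilate i φ) (kernelSeq ζ (k + 1)))
        have h1 := (geomOp_OpBd hρ0 hρ M (le_refl i) 0 _ _ _ (hB' i k (by omega)) h2).1
        have e : approxId φ M i (kernelSeq ζ (k + 1))
            = geomOp φ M i (T (dilate i φ) (kernelSeq ζ (k + 1))) := by
          rw [approxId_eq, (commute_T_geomOp _ _ _ _).eq]
          rfl
        rw [e]
        refine h1.mono (mul_le_mul_of_nonneg_left (mul_le_mul_of_nonneg_left ?_ hB'0) hq0)
        exact div_le_div₀ (by positivity)
          (pow_le_pow_right₀ one_le_two (Nat.mul_le_mul_right _ hi2)) (by positivity)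
          (pow_le_pow_right₀ one_le_two (Nat.mul_le_mul_left _ (by omega)))
      obtain ⟨B'', -, h2⟩ := exists_SB ((approxId φ M (j + 1) + approxId φ M j)
        (kernelSeq ζ (k + 1)))
      have h1 := ((dividedDiff_OpBd_zero hρ0 hρ M j) 0 _ _ _
        ((hA (j + 1) (by omega) le_rfl).add (hA j le_rfl (by omega))) h2).1
      refine h1.mono (le_of_eq ?_)
      rw [← hI', ← hq, hK]
      ring
    · refine (((dividedDiff_OpBd_zero hρ0 hρ M j).mul ((approxId_OpBd hρ0 hρ M (Nat.le_succ j)).add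
        (approxId_OpBd hρ0 hρ M (le_refl j)))) 0 _ _ _ (hB₀ (k + 1)) (hσ (k + 1))).2.mono ?_
      have h1 : σ / 2 ^ (k + 1) ≤ σ / 2 ^ j :=
        div_le_div_of_nonneg_left hσ0 (by positivity)
          (pow_le_pow_right₀ one_le_two (by omega))
      have h2 : 2 * r / 2 ^ (j + 1) = r / 2 ^ j := by
        rw [pow_succ]
        field_simp
      rw [h2, hr, add_div, ← add_div]
      refine add_le_add h1 ?_
      gcongr
      nlinarith [mul_nonneg (Nat.cast_nonneg (α := ℝ) M) hρ0]
  set D := q * q * B₁ + K with hD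
  have hB₁0 : 0 ≤ B₁ := by positivity
  refine ⟨D.toNNReal, 2 * r, by positivity, fun f hf k m hm x => ?_⟩
  set a : ℕ → ℝ≥0∞ := fun j => w (j * n - l * (k - j)) *
    ∫⁻ y in Metric.closedBall x (2 * r / 2 ^ j), ‖conv (kernelSeq φ j) f y‖ₑ with ha
  have hD' : ((D.toNNReal : ℝ≥0) : ℝ≥0∞) = ENNReal.ofReal D := rfl
  rw [hD']
  have hterm : ∀ (j : ℕ) (h : TestFun n 𝕜) (b : ℝ), j ≤ k → 0 ≤ b → b ≤ D →
      DB 0 (b * (2 ^ (j * n) / 2 ^ (l * (k - j)))) h → SB (2 * r / 2 ^ j) h →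
      ‖conv (T (kernelSeq φ j) h) f x‖ₑ ≤ ENNReal.ofReal D * a j := fun j h b hjk hb hbD h1 h2 => by
    refine (enorm_conv_T_le hf _ h2 h1 x).trans ?_
    rw [ENNReal.ofReal_mul hb, ofReal_two_pow_div, mul_assoc, ha]
    push_cast [Nat.cast_sub hjk]
    exact mul_le_mul_left (ENNReal.ofReal_le_ofReal hbD) _
  induction m with
  | zero =>
    have e : (approxId φ M 0 * approxId φ M 0) (kernelSeq ζ k)
        = T (kernelSeq φ 0) ((geomOp φ M 0 * approxId φ M 0) (kernelSeq ζ k)) := by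
      rw [kernelSeq_zero, ← Module.End.mul_apply, ← mul_assoc, ← approxId_eq]
    rw [e, Finset.sum_range_one]
    exact hterm 0 _ (q * q * B₁) (Nat.zero_le _) (by positivity) (by linarith) (h0 k).1
      ((h0 k).2.mono (by gcongr; linarith))
  | succ m ih =>
    obtain ⟨k, rfl⟩ : ∃ k', k = k' + 1 := ⟨k - 1, by omega⟩
    have e : (approxId φ M (m + 1) * approxId φ M (m + 1)) (kernelSeq ζ (k + 1))
        = (approxId φ M m * approxId φ M m) (kernelSeq ζ (k + 1)) +
          T (kernelSeq φ (m + 1)) (dualOp φ M m (kernelSeq ζ (k + 1))) := by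
      rw [← Module.End.mul_apply, ← approxId_sq_sub, LinearMap.sub_apply, add_sub_cancel]
    rw [e, conv_add, Finset.sum_range_succ, mul_add]
    refine (enorm_add_le _ _).trans (add_le_add (ih (by omega)) ?_)
    refine hterm (m + 1) _ K hm hK0 (le_add_of_nonneg_left (by positivity)) ?_ (hj m k (by omega)).2
    rw [Nat.add_sub_add_right]
    exact (hj m k (by omega)).1

/-- Kernels with vanishing moments at level `k` are controlled by the kernels at all levels. -/
theorem exists_enorm_conv_kernelSeq_le_of_moments (hφ : ∫ x, φ x = 1) {ζ : TestFun n 𝕜} {l : ℕ}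
    (hζ : VanishingMoments l (diffKernel ζ)) (M : ℕ) :
    ∃ (C : ℝ≥0) (c : ℝ), 0 ≤ c ∧ ∀ f ∈ ExpDistr n 𝕜, ∀ (k : ℕ) (x : Eu n),
      ‖conv (kernelSeq ζ k) f x‖ₑ ≤ C * ((∑ j ∈ Finset.range (k + 1), w (j * n - l * (k - j)) *
          ∫⁻ y in Metric.closedBall x (c / 2 ^ j), ‖conv (kernelSeq φ j) f y‖ₑ) +
        ∑' d : ℕ, w (k * n - M * d) *
          ∫⁻ y in Metric.closedBall x (c / 2 ^ k), ‖conv (kernelSeq φ (k + d)) f y‖ₑ) := by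
  obtain ⟨C, R, hC, hR, h⟩ := enorm_conv_le_approxId_add_tsum hφ M
  obtain ⟨σ, hσ0, hσ⟩ := exists_kernelSeq_SB ζ
  obtain ⟨B, hB0, hB⟩ := exists_kernelSeq_DB ζ M
  obtain ⟨C', c', hc', h'⟩ := enorm_conv_approxId_sq_kernelSeq_le (φ := φ) hζ M
  set c := max (σ + R) c' with hc
  refine ⟨(C * B).toNNReal + C', c, le_max_of_le_right hc', fun f hf k x => ?_⟩
  refine (h k (kernelSeq ζ k) σ B hσ0 (hσ k) (hB k) f hf x).trans ?_
  rw [mul_add, ENNReal.coe_add]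
  refine add_le_add ((h' f hf k k le_rfl x).trans ?_) ?_
  · refine mul_le_mul' le_add_self (Finset.sum_le_sum fun j _ => ?_)
    refine mul_le_mul' le_rfl (lintegral_mono_set (Metric.closedBall_subset_closedBall ?_))
    exact div_le_div_of_nonneg_right (le_max_right _ _) (by positivity)
  · refine mul_le_mul' le_self_add (ENNReal.tsum_le_tsum fun d => ?_)
    refine mul_le_mul' le_rfl (lintegral_mono_set (Metric.closedBall_subset_closedBall ?_))
    exact div_le_div_of_nonneg_right (le_max_left _ _) (by positivity)

end Bounds

end Reproducing

/-! ### Peetre maximal functions -/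

section Peetre

variable {n : ℕ}

/-- The Peetre maximal function of the sequence `u` at level `j`. -/
def peetreMax (M Λ : ℝ) (u : ℕ → Eu n → ℝ≥0∞) (j : ℕ) (x : Eu n) : ℝ≥0∞ :=
  ⨆ (e : ℕ) (y : Eu n), w (-(e * M) - Λ * 2 ^ j * ‖x - y‖) * u (j + e) y

/-- The integral means of the `μ`-th powers which control the Peetre maximal function. -/
def peetreInt (M Λ μ : ℝ) (u : ℕ → Eu n → ℝ≥0∞) (j : ℕ) (x : Eu n) : ℝ≥0∞ :=
  ∑' l : ℕ, w (j * n - l * (M * μ - n)) *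
    ∫⁻ z, w (-(Λ * μ * 2 ^ j * ‖x - z‖)) * u (j + l) z ^ μ

theorem le_mul_peetreMax (M Λ : ℝ) (u : ℕ → Eu n → ℝ≥0∞) (j e : ℕ) (x y : Eu n) :
    u (j + e) y ≤ w (e * M + Λ * 2 ^ j * ‖x - y‖) * peetreMax M Λ u j x := by
  have h : w (-(e * M) - Λ * 2 ^ j * ‖x - y‖) * u (j + e) y ≤ peetreMax M Λ u j x :=
    le_iSup₂_of_le e y le_rfl
  calc u (j + e) y = w (e * M + Λ * 2 ^ j * ‖x - y‖) *
        (w (-(e * M) - Λ * 2 ^ j * ‖x - y‖) * u (j + e) y) := by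
        rw [← mul_assoc, ← w_add, show e * M + Λ * 2 ^ j * ‖x - y‖ +
          (-(e * M) - Λ * 2 ^ j * ‖x - y‖) = 0 by ring, w_zero, one_mul]
    _ ≤ _ := by gcongr

/-- Division by `S^(1-μ)`, the only place where finiteness of the maximal function is indispensable.
-/
theorem rpow_le_of_le_mul_rpow {S K : ℝ≥0∞} {μ : ℝ} (hμ : 0 < μ) (hS : S ≠ ∞)
    (h : S ≤ K * S ^ (1 - μ)) : S ^ μ ≤ K := by
  rcases eq_or_ne S 0 with rfl | h0
  · rw [ENNReal.zero_rpow_of_pos hμ]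
    exact zero_le
  have e : S ^ μ = S * S ^ (-(1 - μ)) := by
    conv_rhs => rw [← ENNReal.rpow_one S, ← ENNReal.rpow_mul, one_mul]
    rw [← ENNReal.rpow_add _ _ h0 hS]
    congr 1
    ring
  rw [e]
  calc S * S ^ (-(1 - μ)) ≤ K * S ^ (1 - μ) * S ^ (-(1 - μ)) := by gcongr
    _ = K := by
      rw [mul_assoc, ← ENNReal.rpow_add _ _ h0 hS, add_neg_cancel, ENNReal.rpow_zero, mul_one]

theorem le_rpow_one_div_iff {a b : ℝ≥0∞} {μ : ℝ} (hμ : 0 < μ) : a ≤ b ^ (1 / μ) ↔ a ^ μ ≤ b := by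
  rw [one_div, ENNReal.le_rpow_inv_iff hμ]

/-- In the hypothesis `u` is split as `u^(1-μ) u^μ`, and the first factor is bounded by the maximal
function `S` at the fixed point `x`. This yields `S ≤ K S^(1-μ)` with `K` built from integrals of
`u^μ`. -/
theorem peetreMax_rpow_le {M Λ μ c : ℝ} {C : ℝ≥0∞} {u : ℕ → Eu n → ℝ≥0∞} (hΛ : 0 ≤ Λ) (hμ : 0 < μ)
    (hμ1 : μ ≤ 1) (hc : 0 ≤ c) (h : ∀ k x, u k x ≤ C * ∑' d : ℕ, w (k * n - M * d) *
      ∫⁻ y in Metric.closedBall x (c / 2 ^ k), u (k + d) y) {j : ℕ} {x : Eu n}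
    (hS : peetreMax M Λ u j x ≠ ∞) :
    peetreMax M Λ u j x ^ μ ≤ C * w (Λ * c) * peetreInt M Λ μ u j x := by
  set S := peetreMax M Λ u j x with hSdef
  refine rpow_le_of_le_mul_rpow hμ hS ?_
  have hS' : S ^ (1 - μ) ≠ ∞ := ENNReal.rpow_ne_top_of_nonneg (by linarith) hS
  set F : ℕ → ℝ≥0∞ := fun l => w (j * n - l * (M * μ - n)) *
    ∫⁻ z, w (-(Λ * μ * 2 ^ j * ‖x - z‖)) * u (j + l) z ^ μ with hF
  refine iSup₂_le fun e y => ?_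
  have key : ∀ d : ℕ, w (-(e * M) - Λ * 2 ^ j * ‖x - y‖) * (w ((j + e : ℕ) * n - M * d) *
      ∫⁻ z in Metric.closedBall y (c / 2 ^ (j + e)), u (j + e + d) z)
      ≤ w (Λ * c) * S ^ (1 - μ) * F (e + d) := fun d => by
    rw [← mul_assoc, ← w_add, ← lintegral_const_mul' _ _ (w_ne_top _), hF]
    simp only
    rw [← mul_assoc, ← lintegral_const_mul' _ _
      (ENNReal.mul_ne_top (ENNReal.mul_ne_top (w_ne_top _) hS') (w_ne_top _))]
    refine (setLIntegral_mono' Metric.isClosed_closedBall.measurableSet fun z hz => ?_).trans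
      (setLIntegral_le_lintegral _ _)
    rw [add_assoc j e d]
    set v := u (j + (e + d)) z with hv
    have hv1 : v ≤ w ((e + d : ℕ) * M + Λ * 2 ^ j * ‖x - z‖) * S :=
      le_mul_peetreMax M Λ u j (e + d) x z
    have hv2 : v = v ^ (1 - μ) * v ^ μ := by
      rw [← ENNReal.rpow_add_of_nonneg _ _ (by linarith) hμ.le, sub_add_cancel, ENNReal.rpow_one]
    have hv3 : v ^ (1 - μ) ≤ w (((e + d : ℕ) * M + Λ * 2 ^ j * ‖x - z‖) * (1 - μ)) *
        S ^ (1 - μ) := by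
      rw [← w_rpow, ← ENNReal.mul_rpow_of_nonneg _ _ (by linarith)]
      exact ENNReal.rpow_le_rpow hv1 (by linarith)
    -- Balance of the exponents. Replacing `y` by a point `z` of the ball of radius `c / 2^(j+e)`
    -- costs at most `Λ * c`, and the surplus `d * n` is dropped.
    have hexp : -(e * M) - Λ * 2 ^ j * ‖x - y‖ + ((j + e : ℕ) * n - M * d) +
        ((e + d : ℕ) * M + Λ * 2 ^ j * ‖x - z‖) * (1 - μ)
        ≤ Λ * c + (j * n - (e + d : ℕ) * (M * μ - n)) + -(Λ * μ * 2 ^ j * ‖x - z‖) := by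
      have h1 : ‖x - z‖ ≤ ‖x - y‖ + c / 2 ^ (j + e) := by
        have h2 := norm_sub_le_norm_sub_add_norm_sub x y z
        rw [Metric.mem_closedBall, dist_comm, dist_eq_norm] at hz
        linarith
      have h3 : (2 : ℝ) ^ j * (c / 2 ^ (j + e)) ≤ c := by
        rw [pow_add, mul_div_assoc', mul_div_mul_left _ _ (by positivity)]
        exact div_le_self hc (one_le_pow₀ one_le_two)
      have h4 : 2 ^ j * ‖x - z‖ ≤ 2 ^ j * ‖x - y‖ + c := by
        have := mul_le_mul_of_nonneg_left h1 (by positivity : (0 : ℝ) ≤ 2 ^ j)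
        linarith
      have h5 := mul_le_mul_of_nonneg_left h4 hΛ
      have h6 : (0 : ℝ) ≤ d * n := by positivity
      push_cast
      nlinarith
    calc w (-(e * M) - Λ * 2 ^ j * ‖x - y‖ + ((j + e : ℕ) * n - M * d)) * v
        = w (-(e * M) - Λ * 2 ^ j * ‖x - y‖ + ((j + e : ℕ) * n - M * d)) *
          (v ^ (1 - μ) * v ^ μ) := by rw [← hv2]
      _ ≤ w (-(e * M) - Λ * 2 ^ j * ‖x - y‖ + ((j + e : ℕ) * n - M * d)) *
          ((w (((e + d : ℕ) * M + Λ * 2 ^ j * ‖x - z‖) * (1 - μ)) * S ^ (1 - μ)) * v ^ μ) := by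
          gcongr
      _ = w (-(e * M) - Λ * 2 ^ j * ‖x - y‖ + ((j + e : ℕ) * n - M * d) +
          ((e + d : ℕ) * M + Λ * 2 ^ j * ‖x - z‖) * (1 - μ)) * (S ^ (1 - μ) * v ^ μ) := by
          rw [w_add _ (((e + d : ℕ) * M + Λ * 2 ^ j * ‖x - z‖) * (1 - μ))]
          ring
      _ ≤ w (Λ * c + (j * n - (e + d : ℕ) * (M * μ - n)) + -(Λ * μ * 2 ^ j * ‖x - z‖)) *
          (S ^ (1 - μ) * v ^ μ) := by
          gcongr
          exact w_mono hexp
      _ = _ := by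
          rw [w_add, w_add]
          ring
  calc w (-(e * M) - Λ * 2 ^ j * ‖x - y‖) * u (j + e) y
      ≤ w (-(e * M) - Λ * 2 ^ j * ‖x - y‖) * (C * ∑' d : ℕ, w ((j + e : ℕ) * n - M * d) *
        ∫⁻ z in Metric.closedBall y (c / 2 ^ (j + e)), u (j + e + d) z) := by
        gcongr
        exact h _ _
    _ = C * ∑' d : ℕ, w (-(e * M) - Λ * 2 ^ j * ‖x - y‖) * (w ((j + e : ℕ) * n - M * d) *
        ∫⁻ z in Metric.closedBall y (c / 2 ^ (j + e)), u (j + e + d) z) := by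
        rw [ENNReal.tsum_mul_left]
        ring
    _ ≤ C * ∑' d : ℕ, w (Λ * c) * S ^ (1 - μ) * F (e + d) := by
        exact mul_le_mul' le_rfl (ENNReal.tsum_le_tsum key)
    _ ≤ C * (w (Λ * c) * S ^ (1 - μ) * ∑' l, F l) := by
        rw [ENNReal.tsum_mul_left]
        exact mul_le_mul' le_rfl (mul_le_mul' le_rfl
          (ENNReal.tsum_comp_le_tsum_of_injective (add_right_injective e) F))
    _ = C * w (Λ * c) * peetreInt M Λ μ u j x * S ^ (1 - μ) := by
        rw [peetreInt]
        ring

theorem peetreInt_anti {M M' Λ Λ' μ : ℝ} (hμ : 0 ≤ μ) (hM : M ≤ M') (hΛ : Λ ≤ Λ')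
    (u : ℕ → Eu n → ℝ≥0∞) (j : ℕ) (x : Eu n) :
    peetreInt M' Λ' μ u j x ≤ peetreInt M Λ μ u j x := by
  refine ENNReal.tsum_le_tsum fun l => mul_le_mul' (w_mono ?_)
    (lintegral_mono fun z => mul_le_mul' (w_mono ?_) le_rfl)
  · gcongr
  · gcongr

/-- The growth factor is the inverse of the `μ`-th power of the weight in `peetreMax`, so a
pointwise bound of `u^μ` by `peetreInt` passes to the maximal function. -/
theorem peetreInt_translate {M Λ μ : ℝ} (hμ : 0 ≤ μ) (hΛ : 0 ≤ Λ)
    (u : ℕ → Eu n → ℝ≥0∞) (j e : ℕ) (x y : Eu n) :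
    peetreInt M Λ μ u (j + e) y
      ≤ w (e * M * μ + Λ * μ * 2 ^ j * ‖x - y‖) * peetreInt M Λ μ u j x := by
  set F : ℕ → ℝ≥0∞ := fun l => w (j * n - l * (M * μ - n)) *
    ∫⁻ z, w (-(Λ * μ * 2 ^ j * ‖x - z‖)) * u (j + l) z ^ μ with hF
  have key : ∀ l : ℕ, w ((j + e : ℕ) * n - l * (M * μ - n)) *
      ∫⁻ z, w (-(Λ * μ * 2 ^ (j + e) * ‖y - z‖)) * u (j + e + l) z ^ μ
      ≤ w (e * M * μ + Λ * μ * 2 ^ j * ‖x - y‖) * F (e + l) := fun l => by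
    rw [hF]
    simp only
    rw [← mul_assoc, ← w_add, ← lintegral_const_mul' _ _ (w_ne_top _),
      ← lintegral_const_mul' _ _ (w_ne_top _)]
    refine lintegral_mono fun z => ?_
    rw [← mul_assoc, ← mul_assoc, ← w_add, ← w_add, add_assoc j e l]
    refine mul_le_mul' (w_mono ?_) le_rfl
    have h1 : ‖x - z‖ ≤ ‖x - y‖ + ‖y - z‖ := norm_sub_le_norm_sub_add_norm_sub x y z
    have h2 : (2 : ℝ) ^ j * ‖x - z‖ ≤ 2 ^ j * ‖x - y‖ + 2 ^ (j + e) * ‖y - z‖ := by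
      have h3 : (2 : ℝ) ^ j * ‖y - z‖ ≤ 2 ^ (j + e) * ‖y - z‖ :=
        mul_le_mul_of_nonneg_right (pow_le_pow_right₀ one_le_two (by omega)) (norm_nonneg _)
      have := mul_le_mul_of_nonneg_left h1 (by positivity : (0 : ℝ) ≤ 2 ^ j)
      linarith
    have h4 := mul_le_mul_of_nonneg_left h2 (mul_nonneg hΛ hμ)
    push_cast
    nlinarith
  calc peetreInt M Λ μ u (j + e) y
      ≤ ∑' l, w (e * M * μ + Λ * μ * 2 ^ j * ‖x - y‖) * F (e + l) := ENNReal.tsum_le_tsum key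
    _ ≤ _ := by
      rw [ENNReal.tsum_mul_left]
      exact mul_le_mul' le_rfl
        (ENNReal.tsum_comp_le_tsum_of_injective (add_right_injective e) F)

/-- The Peetre maximal function is controlled by integral means of the `μ`-th powers, if `u` has
at most exponential growth. The constant does not depend on the growth of `u`. -/
theorem peetreMax_rpow_le_of_growth {μ : ℝ} {c : ℕ → ℝ} {C : ℕ → ℝ≥0} {u : ℕ → Eu n → ℝ≥0∞}
    (hμ : 0 < μ) (hμ1 : μ ≤ 1) (hc : ∀ M, 0 ≤ c M)
    (h : ∀ M k x, u k x ≤ C M * ∑' d : ℕ, w (k * n - M * d) *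
      ∫⁻ y in Metric.closedBall x (c M / 2 ^ k), u (k + d) y) {N : ℕ} {K : ℝ≥0}
    (hu : ∀ k x, u k x ≤ K * w (N * k + N * ‖x‖)) (M : ℕ) {Λ : ℝ} (hΛ : 0 ≤ Λ) (j : ℕ) (x : Eu n) :
    peetreMax M Λ u j x ^ μ ≤ (C M + 1) * w (Λ * c M) * peetreInt M Λ μ u j x := by
  have hCle : (C M : ℝ≥0∞) ≤ C M + 1 := le_self_add
  -- An infinite right-hand side is harmless because the constant `C M + 1` cannot vanish, as `C M`
  -- might.
  rcases eq_or_ne (peetreInt M Λ μ u j x) ∞ with hI | hI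
  · rw [hI, ENNReal.mul_top]
    · exact le_top
    · exact mul_ne_zero (by simp) (w_pos _).ne'
  -- Above the growth exponent `N` of `u` the maximal function is finite.
  set M₁ := max M N with hM₁
  set Λ₁ := max Λ N with hΛ₁
  have hfin : ∀ i y, peetreMax M₁ Λ₁ u i y ≠ ∞ := fun i y => by
    refine ne_top_of_le_ne_top (b := K * w (N * i + N * ‖y‖))
      (ENNReal.mul_ne_top ENNReal.coe_ne_top (w_ne_top _)) (iSup₂_le fun e z => ?_)
    calc w (-(e * M₁) - Λ₁ * 2 ^ i * ‖y - z‖) * u (i + e) z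
        ≤ w (-(e * M₁) - Λ₁ * 2 ^ i * ‖y - z‖) * (K * w (N * (i + e : ℕ) + N * ‖z‖)) := by
          gcongr
          exact hu _ _
      _ = K * w (-(e * M₁) - Λ₁ * 2 ^ i * ‖y - z‖ + (N * (i + e : ℕ) + N * ‖z‖)) := by
          rw [w_add (-(e * M₁) - Λ₁ * 2 ^ i * ‖y - z‖)]
          ring
      _ ≤ K * w (N * i + N * ‖y‖) := by
          gcongr
          refine w_mono ?_
          have h1 : (N : ℝ) ≤ M₁ := by exact_mod_cast le_max_right M N
          have h2 : (N : ℝ) ≤ Λ₁ * 2 ^ i :=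
            (le_max_right Λ N).trans (le_mul_of_one_le_right (hΛ.trans (le_max_left _ _))
              (one_le_pow₀ one_le_two))
          have h3 : ‖z‖ ≤ ‖y‖ + ‖y - z‖ := by
            have := norm_sub_norm_le z y
            rw [norm_sub_rev] at this
            linarith
          have h4 := mul_le_mul_of_nonneg_right h2 (norm_nonneg (y - z))
          have h5 := mul_le_mul_of_nonneg_left h3 (Nat.cast_nonneg (α := ℝ) N)
          have h6 := mul_le_mul_of_nonneg_left h1 (Nat.cast_nonneg (α := ℝ) e)
          push_cast
          nlinarith
  set C₁ : ℝ≥0∞ := C M₁ * w (Λ₁ * c M₁) with hC₁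
  have hC₁' : C₁ ≠ ∞ := ENNReal.mul_ne_top ENNReal.coe_ne_top (w_ne_top _)
  -- The constant `C₁` depends on `N`, but this bound is used only to see that the maximal function
  -- with the original `M` and `Λ` is finite; the division is then repeated with a constant free of
  -- `N`.
  have hpt : ∀ i y, u i y ^ μ ≤ C₁ * peetreInt M Λ μ u i y := fun i y => by
    have h1 := peetreMax_rpow_le (hΛ.trans (le_max_left Λ N)) hμ hμ1 (hc M₁) (h M₁) (hfin i y)
    have h2 := le_mul_peetreMax (M₁ : ℝ) Λ₁ u i 0 y y
    rw [sub_self, norm_zero, mul_zero, Nat.cast_zero, zero_mul, add_zero, add_zero, w_zero,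
      one_mul] at h2
    refine (ENNReal.rpow_le_rpow h2 hμ.le).trans (h1.trans ?_)
    gcongr
    exact peetreInt_anti hμ.le (by exact_mod_cast le_max_left M N) (le_max_left Λ N) u i y
  have hS : peetreMax M Λ u j x ≠ ∞ := by
    refine ne_top_of_le_ne_top (ENNReal.rpow_ne_top_of_nonneg (y := 1 / μ) (by positivity)
      (ENNReal.mul_ne_top hC₁' hI)) (iSup₂_le fun e y => ?_)
    rw [le_rpow_one_div_iff hμ, ENNReal.mul_rpow_of_nonneg _ _ hμ.le, w_rpow]
    calc w ((-(e * M) - Λ * 2 ^ j * ‖x - y‖) * μ) * u (j + e) y ^ μ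
        ≤ w ((-(e * M) - Λ * 2 ^ j * ‖x - y‖) * μ) * (C₁ *
          (w (e * M * μ + Λ * μ * 2 ^ j * ‖x - y‖) * peetreInt M Λ μ u j x)) := by
          gcongr
          refine (hpt _ _).trans ?_
          gcongr
          exact peetreInt_translate hμ.le hΛ u j e x y
      _ = C₁ * (w ((-(e * M) - Λ * 2 ^ j * ‖x - y‖) * μ + (e * M * μ + Λ * μ * 2 ^ j * ‖x - y‖)) *
          peetreInt M Λ μ u j x) := by
          rw [w_add ((-(e * M) - Λ * 2 ^ j * ‖x - y‖) * μ)]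
          ring
      _ = C₁ * peetreInt M Λ μ u j x := by
          rw [show (-(e * M) - Λ * 2 ^ j * ‖x - y‖) * μ + (e * M * μ + Λ * μ * 2 ^ j * ‖x - y‖) = 0
            by ring, w_zero, one_mul]
  refine (peetreMax_rpow_le hΛ hμ hμ1 (hc M) (h M) hS).trans ?_
  gcongr

theorem volume_closedBall_div (c : ℝ) (hc : 0 ≤ c) (j : ℕ) (x : Eu n) :
    volume (Metric.closedBall x (c / 2 ^ j))
      = w (-(j * n)) * volume (Metric.closedBall (0 : Eu n) c) := by
  rw [Measure.addHaar_closedBall _ _ (by positivity), Measure.addHaar_closedBall _ _ hc,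
    finrank_euclideanSpace_fin, ← mul_assoc]
  congr 1
  rw [← ofReal_two_rpow, ← ENNReal.ofReal_mul (by positivity), div_pow, ← pow_mul,
    Real.rpow_neg zero_le_two, div_eq_inv_mul]
  congr 3
  rw [← Nat.cast_mul, Real.rpow_natCast]

theorem setLIntegral_closedBall_le_peetreMax {c : ℝ} (hc : 0 ≤ c) (M : ℝ) {Λ : ℝ} (hΛ : 0 ≤ Λ)
    (u : ℕ → Eu n → ℝ≥0∞) (j d : ℕ) (x : Eu n) :
    ∫⁻ y in Metric.closedBall x (c / 2 ^ j), u (j + d) y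
      ≤ volume (Metric.closedBall (0 : Eu n) c) * w (Λ * c) *
        (w (d * M - j * n) * peetreMax M Λ u j x) := by
  calc ∫⁻ y in Metric.closedBall x (c / 2 ^ j), u (j + d) y
      ≤ ∫⁻ _ in Metric.closedBall x (c / 2 ^ j), w (d * M + Λ * c) * peetreMax M Λ u j x := by
        refine setLIntegral_mono' Metric.isClosed_closedBall.measurableSet fun y hy => ?_
        refine (le_mul_peetreMax M Λ u j d x y).trans (mul_le_mul' (w_mono ?_) le_rfl)
        rw [Metric.mem_closedBall, dist_comm, dist_eq_norm, le_div_iff₀ (by positivity)] at hy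
        have := mul_le_mul_of_nonneg_left hy hΛ
        linarith
    _ = _ := by
        rw [setLIntegral_const, volume_closedBall_div c hc, w_add, sub_eq_add_neg, w_add]
        ring

theorem tsum_w_neg : ∑' d : ℕ, w (-(d : ℝ)) = 2 := by
  have : ∀ d : ℕ, w (-(d : ℝ)) = (2⁻¹ : ℝ≥0∞) ^ d := fun d => by
    rw [w, ENNReal.rpow_neg, ENNReal.rpow_natCast, ENNReal.inv_pow]
  simp_rw [this]
  rw [ENNReal.tsum_geometric, ENNReal.one_sub_inv_two, inv_inv]

end Peetre

/-! ### Pointwise bound of the kernels by integral means -/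

section PointwiseBound

variable {n : ℕ} {𝕜 : Type*} [RCLike 𝕜]

theorem exists_enorm_conv_kernelSeq_growth (φ : TestFun n 𝕜) {f : Distr n 𝕜}
    (hf : f ∈ ExpDistr n 𝕜) : ∃ (N : ℕ) (K : ℝ≥0), ∀ (k : ℕ) (x : Eu n),
      ‖conv (kernelSeq φ k) f x‖ₑ ≤ K * w (N * k + N * ‖x‖) := by
  obtain ⟨N, C, hC, h⟩ := exists_norm_conv_le hf
  obtain ⟨ρ, hρ0, hρ⟩ := exists_kernelSeq_SB φ
  choose B hB0 hB using exists_kernelSeq_DB φ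
  set b := ∑ i ∈ Finset.range (N + 1), B i with hb
  have hb0 : 0 ≤ b := Finset.sum_nonneg fun i _ => hB0 i
  -- Derivatives up to order `N` of the kernel of level `k` cost `2^(k(n+N))`, and `exp(N|x|) ≤
  -- 2^(2N|x|)` since `log 2 > 1/2`; one exponent covers both.
  refine ⟨n + 2 * N, (C * Real.exp (N * ρ) * b).toNNReal, fun k x => ?_⟩
  have h1 := h (kernelSeq φ k) (ρ / 2 ^ k) (b * 2 ^ (k * (n + N))) x (hρ k) fun i hi => by
    refine (hB i k).mono ?_
    rw [mul_add, pow_add]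
    gcongr
    · exact Finset.single_le_sum (fun i _ => hB0 i) (Finset.mem_range.2 (Nat.lt_succ_of_le hi))
    · exact one_le_two
  have h2 : Real.exp (N * (‖x‖ + ρ / 2 ^ k)) ≤ Real.exp (N * ρ) * (2 : ℝ) ^ (2 * N * ‖x‖) := by
    have h3 : Real.exp (N * ‖x‖) ≤ (2 : ℝ) ^ (2 * N * ‖x‖) := by
      rw [Real.rpow_def_of_pos two_pos, Real.exp_le_exp]
      have := Real.log_two_gt_d9
      have h4 : 0 ≤ N * ‖x‖ := by positivity
      nlinarith
    have h5 : Real.exp (N * (ρ / 2 ^ k)) ≤ Real.exp (N * ρ) := by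
      rw [Real.exp_le_exp]
      gcongr
      exact div_le_self hρ0 (one_le_pow₀ one_le_two)
    rw [mul_add, Real.exp_add, mul_comm]
    gcongr
  have h6 : ‖conv (kernelSeq φ k) f x‖ ≤ C * Real.exp (N * ρ) * b *
      (2 : ℝ) ^ ((n + 2 * N : ℕ) * (k : ℝ) + (n + 2 * N : ℕ) * ‖x‖) := by
    calc ‖conv (kernelSeq φ k) f x‖
        ≤ C * (Real.exp (N * ρ) * (2 : ℝ) ^ (2 * N * ‖x‖)) * (b * 2 ^ (k * (n + N))) :=
          h1.trans (by gcongr)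
      _ = C * Real.exp (N * ρ) * b * (2 : ℝ) ^ (2 * N * ‖x‖ + (k * (n + N) : ℕ)) := by
          rw [Real.rpow_add two_pos, Real.rpow_natCast]
          ring
      _ ≤ _ := by
          refine mul_le_mul_of_nonneg_left (Real.rpow_le_rpow_of_exponent_le one_le_two ?_)
            (by positivity)
          push_cast
          have h7 : (0 : ℝ) ≤ n * ‖x‖ := by positivity
          have h8 : (0 : ℝ) ≤ N * k := by positivity
          nlinarith
  rw [← ofReal_norm]
  refine (ENNReal.ofReal_le_ofReal h6).trans (le_of_eq ?_)
  rw [ENNReal.ofReal_mul (by positivity), ofReal_two_rpow]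
  rfl

/-- Pointwise estimate of the kernels with vanishing moments by integral means. -/
theorem exists_enorm_conv_le_peetreInt {φ ζ : TestFun n 𝕜} (hφ : ∫ x, φ x = 1) {l : ℕ}
    (hζ : VanishingMoments l (diffKernel ζ)) {μ : ℝ} (hμ : 0 < μ) (hμ1 : μ ≤ 1) (M : ℕ) {Λ : ℝ}
    (hΛ : 0 ≤ Λ) : ∃ C : ℝ≥0, ∀ f ∈ ExpDistr n 𝕜, ∀ (k : ℕ) (x : Eu n),
      ‖conv (kernelSeq ζ k) f x‖ₑ ≤ C * ∑ j ∈ Finset.range (k + 1), w (-(l * (k - j))) *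
        peetreInt M Λ μ (fun i y => ‖conv (kernelSeq φ i) f y‖ₑ) j x ^ (1 / μ) := by
  -- The estimate is needed for every `M` at once, because the finiteness argument uses an exponent
  -- depending on the growth of `f`.
  choose C c hc h using exists_enorm_conv_kernelSeq_le (n := n) (𝕜 := 𝕜) hφ
  -- The order `M + 1` against the exponent `M` of the maximal function leaves the summable factor
  -- `2^(-d)` at the levels `k + d`.
  obtain ⟨C', c', hc', h'⟩ := exists_enorm_conv_kernelSeq_le_of_moments hφ hζ (M + 1)
  set v := volume (Metric.closedBall (0 : Eu n) c') * w (Λ * c') with hv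
  have hv' : v ≠ ∞ := ENNReal.mul_ne_top measure_closedBall_lt_top.ne (w_ne_top _)
  set D : ℝ≥0∞ := ((C M + 1) * w (Λ * c M)) ^ (1 / μ) with hD
  have hD' : D ≠ ∞ := ENNReal.rpow_ne_top_of_nonneg (by positivity)
    (ENNReal.mul_ne_top (by simp) (w_ne_top _))
  set E : ℝ≥0∞ := C' * (3 * v * D) with hE
  have hE' : E ≠ ∞ := by finiteness
  refine ⟨E.toNNReal, fun f hf k x => ?_⟩
  rw [ENNReal.coe_toNNReal hE']
  set u : ℕ → Eu n → ℝ≥0∞ := fun i y => ‖conv (kernelSeq φ i) f y‖ₑ with hu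
  obtain ⟨N, K, hNK⟩ := exists_enorm_conv_kernelSeq_growth φ hf
  have hS : ∀ j, peetreMax M Λ u j x ≤ D * peetreInt M Λ μ u j x ^ (1 / μ) := fun j => by
    rw [hD, ← ENNReal.mul_rpow_of_nonneg _ _ (by positivity), le_rpow_one_div_iff hμ]
    exact peetreMax_rpow_le_of_growth hμ hμ1 hc (fun M k x => h M f hf k x) hNK M hΛ j x
  set s : ℕ → ℝ≥0∞ := fun j => w (-(l * (k - j))) * peetreMax M Λ u j x with hs
  have h1 : ∑ j ∈ Finset.range (k + 1), w (j * n - l * (k - j)) *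
      ∫⁻ y in Metric.closedBall x (c' / 2 ^ j), u j y ≤ v * ∑ j ∈ Finset.range (k + 1), s j := by
    rw [Finset.mul_sum]
    refine Finset.sum_le_sum fun j _ => ?_
    have := setLIntegral_closedBall_le_peetreMax hc' M hΛ u j 0 x
    rw [add_zero, Nat.cast_zero, zero_mul, zero_sub, ← hv] at this
    refine (mul_le_mul' le_rfl this).trans (le_of_eq ?_)
    rw [hs, sub_eq_add_neg, w_add]
    calc w (j * n) * w (-(l * (k - j))) * (v * (w (-(j * n)) * peetreMax M Λ u j x))
        = (w (j * n) * w (-(j * n))) * (v * (w (-(l * (k - j))) * peetreMax M Λ u j x)) := by ring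
      _ = _ := by rw [← w_add, add_neg_cancel, w_zero, one_mul]
  have h2 : ∑' d : ℕ, w (k * n - (M + 1 : ℕ) * d) *
      ∫⁻ y in Metric.closedBall x (c' / 2 ^ k), u (k + d) y ≤ 2 * v * s k := by
    calc _ ≤ ∑' d : ℕ, w (-(d : ℝ)) * (v * s k) := ENNReal.tsum_le_tsum fun d => by
          have := setLIntegral_closedBall_le_peetreMax hc' M hΛ u k d x
          rw [← hv] at this
          refine (mul_le_mul' le_rfl this).trans (le_of_eq ?_)
          rw [hs]
          simp only [sub_self, mul_zero, neg_zero, w_zero, one_mul]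
          calc w (k * n - (M + 1 : ℕ) * d) * (v * (w (d * M - k * n) * peetreMax M Λ u k x))
              = (w (k * n - (M + 1 : ℕ) * d) * w (d * M - k * n)) *
                (v * peetreMax M Λ u k x) := by ring
            _ = _ := by
              rw [← w_add]
              congr 2
              push_cast
              ring
      _ = _ := by rw [ENNReal.tsum_mul_right, tsum_w_neg, ← mul_assoc]
  have h3 : s k ≤ ∑ j ∈ Finset.range (k + 1), s j :=
    Finset.single_le_sum (fun _ _ => zero_le) (Finset.self_mem_range_succ k)
  calc ‖conv (kernelSeq ζ k) f x‖ₑ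
      ≤ C' * (v * ∑ j ∈ Finset.range (k + 1), s j + 2 * v * s k) :=
        (h' f hf k x).trans (mul_le_mul' le_rfl (add_le_add h1 h2))
    _ ≤ C' * (v * ∑ j ∈ Finset.range (k + 1), s j + 2 * v * ∑ j ∈ Finset.range (k + 1), s j) := by
        gcongr
    _ = C' * (3 * v * ∑ j ∈ Finset.range (k + 1), s j) := by ring
    _ ≤ C' * (3 * v * ∑ j ∈ Finset.range (k + 1), w (-(l * (k - j))) *
        (D * peetreInt M Λ μ u j x ^ (1 / μ))) := by
        gcongr with j
        exact mul_le_mul' le_rfl (hS j)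
    _ = _ := by
        rw [hE, Finset.mul_sum, Finset.mul_sum, Finset.mul_sum]
        refine Finset.sum_congr rfl fun j _ => ?_
        ring

end PointwiseBound

/-! ### Mixed quasi-norms of suprema -/

section SequenceNorms

/-- The `ℓ_p` quasi-norm of a family with values in `[0, ∞]`. -/
def lN {ι : Type*} (p : ℝ≥0∞) (a : ι → ℝ≥0∞) : ℝ≥0∞ :=
  if p = ∞ then ⨆ i, a i else (∑' i, a i ^ p.toReal) ^ (1 / p.toReal)

variable {ι κ : Type*} {p : ℝ≥0∞}

theorem lN_top (a : ι → ℝ≥0∞) : lN ∞ a = ⨆ i, a i := if_pos rfl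

theorem lN_of_ne_top (hp : p ≠ ∞) (a : ι → ℝ≥0∞) :
    lN p a = (∑' i, a i ^ p.toReal) ^ (1 / p.toReal) := if_neg hp

theorem lN_le_iff_of_ne_top (hp0 : p ≠ 0) (hp : p ≠ ∞) (a : ι → ℝ≥0∞) (D : ℝ≥0∞) :
    lN p a ≤ D ↔ ∑' i, a i ^ p.toReal ≤ D ^ p.toReal := by
  rw [lN_of_ne_top hp, one_div, ENNReal.rpow_inv_le_iff (ENNReal.toReal_pos hp0 hp)]

theorem lN_rpow (hp0 : p ≠ 0) (hp : p ≠ ∞) (a : ι → ℝ≥0∞) :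
    lN p a ^ p.toReal = ∑' i, a i ^ p.toReal := by
  rw [lN_of_ne_top hp, ← ENNReal.rpow_mul, one_div_mul_cancel (ENNReal.toReal_pos hp0 hp).ne',
    ENNReal.rpow_one]

theorem lN_mono {a b : ι → ℝ≥0∞} (h : ∀ i, a i ≤ b i) : lN p a ≤ lN p b := by
  rcases eq_or_ne p ∞ with rfl | hp
  · rw [lN_top, lN_top]
    exact iSup_mono h
  · rw [lN_of_ne_top hp, lN_of_ne_top hp]
    exact ENNReal.rpow_le_rpow (ENNReal.tsum_le_tsum fun i =>
      ENNReal.rpow_le_rpow (h i) ENNReal.toReal_nonneg) (by positivity)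

theorem lN_const_mul (hp0 : p ≠ 0) (c : ℝ≥0∞) (a : ι → ℝ≥0∞) :
    lN p (fun i => c * a i) = c * lN p a := by
  rcases eq_or_ne p ∞ with rfl | hp
  · rw [lN_top, lN_top, ENNReal.mul_iSup]
  · have h0 := ENNReal.toReal_pos hp0 hp
    rw [lN_of_ne_top hp, lN_of_ne_top hp]
    simp_rw [ENNReal.mul_rpow_of_nonneg _ _ h0.le]
    rw [ENNReal.tsum_mul_left, ENNReal.mul_rpow_of_nonneg _ _ (by positivity), ← ENNReal.rpow_mul,
      mul_one_div_cancel h0.ne', ENNReal.rpow_one]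

theorem iSup_rpow_le_tsum {s : ℝ} (hs : 0 < s) (a : ι → ℝ≥0∞) : (⨆ i, a i) ^ s ≤ ∑' i, a i ^ s := by
  rw [← ENNReal.le_rpow_inv_iff hs]
  refine iSup_le fun i => ?_
  rw [ENNReal.le_rpow_inv_iff hs]
  exact ENNReal.le_tsum i

/-- The `p`-th power of a supremum is at most the sum of the `p`-th powers, and the two sums can be
exchanged. No triangle inequality enters, so `p < 1` is admitted. -/
theorem lN_iSup_le (hp0 : p ≠ 0) (f : κ → ι → ℝ≥0∞) :
    lN p (fun i => ⨆ j, f j i) ≤ lN p fun j => lN p (f j) := by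
  rcases eq_or_ne p ∞ with rfl | hp
  · simp_rw [lN_top]
    exact (iSup_comm).le
  · have h0 := ENNReal.toReal_pos hp0 hp
    rw [lN_le_iff_of_ne_top hp0 hp, lN_rpow hp0 hp]
    simp_rw [lN_rpow hp0 hp]
    rw [ENNReal.tsum_comm]
    exact ENNReal.tsum_le_tsum fun i => iSup_rpow_le_tsum h0 _

/-- A Schur type estimate, with suprema in place of sums. -/
theorem lN_iSup_mul_le (hp0 : p ≠ 0) {c : ι → κ → ℝ≥0∞} {D : ℝ≥0∞}
    (hD : ∀ j, lN p (fun i => c i j) ≤ D) (a : κ → ℝ≥0∞) :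
    lN p (fun i => ⨆ j, c i j * a j) ≤ D * lN p a := by
  calc lN p (fun i => ⨆ j, c i j * a j) ≤ lN p fun j => lN p (fun i => c i j * a j) :=
        lN_iSup_le hp0 _
    _ = lN p fun j => lN p (fun i => c i j) * a j := by
        congr 1
        funext j
        simp_rw [mul_comm _ (a j)]
        rw [lN_const_mul hp0]
    _ ≤ lN p fun j => D * a j := lN_mono fun j => mul_le_mul' (hD j) le_rfl
    _ = D * lN p a := lN_const_mul hp0 _ _

theorem lN_mul_le (hp0 : p ≠ 0) (c a : ι → ℝ≥0∞) :
    lN p (fun i => c i * a i) ≤ lN p c * ⨆ i, a i := by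
  rw [mul_comm, ← lN_const_mul hp0]
  refine lN_mono fun i => ?_
  rw [mul_comm]
  exact mul_le_mul' (le_iSup a i) le_rfl

theorem eLpNorm_iSup_le {α : Type*} [MeasurableSpace α] {ν : Measure α} [Countable κ]
    (hp0 : p ≠ 0) {g : κ → α → ℝ≥0∞} (hg : ∀ j, AEMeasurable (g j) ν) :
    eLpNorm (fun x => ⨆ j, g j x) p ν ≤ lN p fun j => eLpNorm (g j) p ν := by
  rcases eq_or_ne p ∞ with rfl | hp
  · rw [lN_top, eLpNorm_exponent_top]
    refine essSup_le_of_ae_le _ ?_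
    have : ∀ᵐ x ∂ν, ∀ j, g j x ≤ eLpNorm (g j) ∞ ν := ae_all_iff.2 fun j => by
      rw [eLpNorm_exponent_top]
      exact ae_le_essSup
    filter_upwards [this] with x hx
    exact iSup_mono hx
  · have h0 := ENNReal.toReal_pos hp0 hp
    have he : ∀ f : α → ℝ≥0∞, eLpNorm f p ν ^ p.toReal = ∫⁻ x, f x ^ p.toReal ∂ν := fun f => by
      rw [eLpNorm_eq_lintegral_rpow_enorm_toReal hp0 hp, ← ENNReal.rpow_mul,
        one_div_mul_cancel h0.ne', ENNReal.rpow_one]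
      rfl
    rw [lN_of_ne_top hp, one_div, ENNReal.le_rpow_inv_iff h0, he]
    simp_rw [he]
    rw [← lintegral_tsum fun j => (hg j).pow_const _]
    exact lintegral_mono fun x => iSup_rpow_le_tsum h0 _

end SequenceNorms

/-! ### Summability of exponential weights over `ℕ`, `ℤ` and `ℤⁿ` -/

section GeometricSums

theorem tsum_w_nat_ne_top {δ : ℝ} (hδ : 0 < δ) : ∑' d : ℕ, w (-(δ * d)) ≠ ∞ := by
  have h1 : ∀ d : ℕ, w (-(δ * d)) = w (-δ) ^ d := fun d => by
    rw [← ENNReal.rpow_natCast, w_rpow, neg_mul]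
  have h2 : w (-δ) < 1 := ENNReal.rpow_lt_one_of_one_lt_of_neg ENNReal.one_lt_two (by linarith)
  simp_rw [h1]
  rw [ENNReal.tsum_geometric]
  exact ENNReal.inv_ne_top.2 (tsub_pos_of_lt h2).ne'

theorem tsum_w_int_ne_top {δ : ℝ} (hδ : 0 < δ) : ∑' m : ℤ, w (-(δ * |(m : ℝ)|)) ≠ ∞ := by
  have h1 := HasSum.of_nat_of_neg_add_one (f := fun m : ℤ => w (-(δ * |(m : ℝ)|)))
    ENNReal.summable.hasSum ENNReal.summable.hasSum
  rw [h1.tsum_eq]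
  refine ENNReal.add_ne_top.2 ⟨?_, ?_⟩
  · simpa using tsum_w_nat_ne_top hδ
  · refine ne_top_of_le_ne_top (tsum_w_nat_ne_top hδ) (ENNReal.tsum_le_tsum fun d => w_mono ?_)
    push_cast
    rw [abs_neg, abs_of_nonneg (by positivity)]
    nlinarith

theorem tsum_pi_prod (n : ℕ) (g : ℤ → ℝ≥0∞) :
    ∑' m : Fin n → ℤ, ∏ i, g (m i) = (∑' k, g k) ^ n := by
  induction n with
  | zero => simp
  | succ n ih =>
    rw [← (Fin.consEquiv fun _ => ℤ).tsum_eq, ENNReal.tsum_prod']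
    simp only [Fin.consEquiv_apply, Fin.prod_univ_succ, Fin.cons_zero, Fin.cons_succ]
    simp_rw [ENNReal.tsum_mul_left, ih]
    rw [ENNReal.tsum_mul_right, pow_succ']

theorem tsum_w_pi_ne_top (n : ℕ) {δ : ℝ} (hδ : 0 < δ) :
    ∑' m : Fin n → ℤ, w (-(δ * ‖m‖)) ≠ ∞ := by
  have h0 : (0 : ℝ) < n + 1 := by positivity
  have h1 : ∀ s : Finset (Fin n), ∀ a : Fin n → ℝ, ∏ i ∈ s, w (a i) = w (∑ i ∈ s, a i) := by
    classical
    intro s a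
    induction s using Finset.induction_on with
    | empty => simp [w_zero]
    | insert i s hi ih => rw [Finset.prod_insert hi, Finset.sum_insert hi, w_add, ih]
  -- The supremum norm dominates `1 / (n + 1)` times the sum of the coordinates, which reduces the
  -- sum to a product; `n + 1` keeps the divisor positive.
  refine ne_top_of_le_ne_top (b := (∑' m : ℤ, w (-(δ / (n + 1) * |(m : ℝ)|))) ^ n)
    (ENNReal.pow_ne_top (tsum_w_int_ne_top (by positivity))) ?_
  rw [← tsum_pi_prod]
  refine ENNReal.tsum_le_tsum fun m => ?_
  rw [h1]
  refine w_mono ?_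
  rw [Finset.sum_neg_distrib, neg_le_neg_iff, ← Finset.mul_sum]
  have h2 : ∑ i, |(m i : ℝ)| ≤ (n + 1) * ‖m‖ := by
    calc ∑ i, |(m i : ℝ)| ≤ ∑ _i : Fin n, ‖m‖ := Finset.sum_le_sum fun i _ => by
          have := norm_le_pi_norm m i
          rwa [Int.norm_eq_abs] at this
      _ ≤ _ := by
          rw [Finset.sum_const, Finset.card_univ, Fintype.card_fin, nsmul_eq_mul]
          nlinarith [norm_nonneg m]
  calc δ / (n + 1) * ∑ i, |(m i : ℝ)| ≤ δ / (n + 1) * ((n + 1) * ‖m‖) := by gcongr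
    _ = δ * ‖m‖ := by field_simp

theorem exists_lN_w_le {ι : Type*} {p : ℝ≥0∞} (hp0 : p ≠ 0) {δ : ℝ} (hδ : 0 < δ) {ν : ι → ι → ℝ}
    (hν : ∀ i j, 0 ≤ ν i j) (h : ∀ δ : ℝ, 0 < δ → ∃ D : ℝ≥0, ∀ j, ∑' i, w (-(δ * ν i j)) ≤ D) :
    ∃ D : ℝ≥0, ∀ j, lN p (fun i => w (-(δ * ν i j))) ≤ D := by
  rcases eq_or_ne p ∞ with rfl | hp
  · refine ⟨1, fun j => ?_⟩
    rw [lN_top]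
    refine iSup_le fun i => ?_
    rw [ENNReal.coe_one, ← w_zero]
    exact w_mono (neg_nonpos.2 (mul_nonneg hδ.le (hν i j)))
  · have h0 := ENNReal.toReal_pos hp0 hp
    obtain ⟨D, hD⟩ := h (δ * p.toReal) (by positivity)
    refine ⟨D ^ (1 / p.toReal), fun j => ?_⟩
    rw [lN_of_ne_top hp, ENNReal.coe_rpow_of_nonneg _ (by positivity)]
    refine ENNReal.rpow_le_rpow ((ENNReal.tsum_le_tsum fun i => le_of_eq ?_).trans (hD j))
      (by positivity)
    rw [w_rpow]
    congr 1
    ring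

theorem exists_tsum_w_nat_le {δ : ℝ} (hδ : 0 < δ) :
    ∃ D : ℝ≥0, ∀ j : ℕ, ∑' i : ℕ, w (-(δ * |(i : ℝ) - j|)) ≤ D := by
  refine ⟨(∑' m : ℤ, w (-(δ * |(m : ℝ)|))).toNNReal, fun j => ?_⟩
  rw [ENNReal.coe_toNNReal (tsum_w_int_ne_top hδ)]
  have hinj : Function.Injective fun i : ℕ => (i : ℤ) - j := fun a b hab => by
    simpa using hab
  have := ENNReal.tsum_comp_le_tsum_of_injective hinj (fun m : ℤ => w (-(δ * |(m : ℝ)|)))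
  simpa using this

theorem exists_tsum_w_pi_le (n : ℕ) {δ : ℝ} (hδ : 0 < δ) :
    ∃ D : ℝ≥0, ∀ j : Fin n → ℤ, ∑' i : Fin n → ℤ, w (-(δ * ‖i - j‖)) ≤ D := by
  refine ⟨(∑' m : Fin n → ℤ, w (-(δ * ‖m‖))).toNNReal, fun j => ?_⟩
  rw [ENNReal.coe_toNNReal (tsum_w_pi_ne_top n hδ)]
  exact ENNReal.tsum_comp_le_tsum_of_injective (sub_left_injective (b := j))
    (fun m : Fin n → ℤ => w (-(δ * ‖m‖)))

theorem exists_lN_w_nat_le {p : ℝ≥0∞} (hp0 : p ≠ 0) {δ : ℝ} (hδ : 0 < δ) :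
    ∃ D : ℝ≥0, ∀ j : ℕ, lN p (fun i : ℕ => w (-(δ * |(i : ℝ) - j|))) ≤ D :=
  exists_lN_w_le hp0 hδ (fun _ _ => abs_nonneg _) fun _ h => exists_tsum_w_nat_le h

theorem exists_lN_w_pi_le (n : ℕ) {p : ℝ≥0∞} (hp0 : p ≠ 0) {δ : ℝ} (hδ : 0 < δ) :
    ∃ D : ℝ≥0, ∀ j : Fin n → ℤ, lN p (fun i : Fin n → ℤ => w (-(δ * ‖i - j‖))) ≤ D :=
  exists_lN_w_le hp0 hδ (fun _ _ => norm_nonneg _) fun _ h => exists_tsum_w_pi_le n h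

end GeometricSums

/-! ### Dyadic cubes -/

section Cubes

variable {n : ℕ}

theorem cube_eq_preimage (j : ℕ) (m : Fin n → ℤ) :
    cube j m = WithLp.ofLp ⁻¹'
      (univ.pi fun i => Ioo ((m i : ℝ) / 2 ^ j) (((m i : ℝ) + 1) / 2 ^ j)) := by
  ext x
  simp [cube]

theorem measurableSet_cube (j : ℕ) (m : Fin n → ℤ) : MeasurableSet (cube j m) := by
  rw [cube_eq_preimage]
  exact (PiLp.volume_preserving_ofLp (Fin n)).measurable
    (MeasurableSet.univ_pi fun _ => measurableSet_Ioo)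

theorem volume_cube (j : ℕ) (m : Fin n → ℤ) : volume (cube j m) = ((2 : ℝ≥0∞) ^ (j * n))⁻¹ := by
  have h1 : ∀ i, ((m i : ℝ) + 1) / 2 ^ j - (m i : ℝ) / 2 ^ j = (2 ^ j)⁻¹ := fun i => by ring
  rw [cube_eq_preimage, (PiLp.volume_preserving_ofLp (Fin n)).measure_preimage
    (MeasurableSet.univ_pi fun _ => measurableSet_Ioo).nullMeasurableSet, Real.volume_pi_Ioo]
  simp_rw [h1]
  rw [Finset.prod_const, Finset.card_univ, Fintype.card_fin,
    ENNReal.ofReal_inv_of_pos (by positivity), ENNReal.ofReal_pow (by norm_num),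
    ENNReal.ofReal_ofNat, ← ENNReal.inv_pow, ← pow_mul]

theorem norm_sub_le_of_mem_cube {j : ℕ} {m m' : Fin n → ℤ} {x z : Eu n} (hx : x ∈ cube j m)
    (hz : z ∈ cube j m') : ‖m - m'‖ ≤ 2 ^ j * ‖x - z‖ + 1 := by
  rw [pi_norm_le_iff_of_nonneg (by positivity)]
  intro i
  have h0 : (0 : ℝ) < 2 ^ j := by positivity
  obtain ⟨h1, h2⟩ := hx i
  obtain ⟨h3, h4⟩ := hz i
  rw [div_lt_iff₀ h0] at h1 h3
  rw [lt_div_iff₀ h0] at h2 h4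
  have h5 : |x i - z i| ≤ ‖x - z‖ := PiLp.norm_apply_le (x - z) i
  have h6 := mul_le_mul_of_nonneg_left h5 h0.le
  rw [Pi.sub_apply, Int.norm_eq_abs]
  push_cast
  have h7 := abs_le.1 h5
  rw [abs_le]
  constructor <;> nlinarith

theorem pairwise_disjoint_cube (j : ℕ) :
    Pairwise (Function.onFun Disjoint fun m : Fin n → ℤ => cube j m) := by
  intro m m' hmm
  refine Set.disjoint_left.2 fun x hx hx' => hmm (funext fun i => ?_)
  have h0 : (0 : ℝ) < 2 ^ j := by positivity
  obtain ⟨h1, h2⟩ := hx i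
  obtain ⟨h3, h4⟩ := hx' i
  have h5 : (m i : ℝ) < m' i + 1 := by
    have := h1.trans h4
    rwa [div_lt_div_iff_of_pos_right h0] at this
  have h6 : (m' i : ℝ) < m i + 1 := by
    have := h3.trans h2
    rwa [div_lt_div_iff_of_pos_right h0] at this
  norm_cast at h5 h6
  omega

/-- The open cubes miss only points on the countably many hyperplanes `x i = a / 2 ^ j`, a null set.
-/
theorem ae_mem_iUnion_cube (j : ℕ) : ∀ᵐ x : Eu n ∂volume, x ∈ ⋃ m : Fin n → ℤ, cube j m := by
  have h1 : ∀ (i : Fin n) (a : ℤ), ∀ᵐ x : Eu n ∂volume, x i ≠ (a : ℝ) / 2 ^ j := fun i a => by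
    have h2 : ∀ᵐ x : Fin n → ℝ ∂volume, x i ≠ (a : ℝ) / 2 ^ j := by
      rw [ae_iff]
      simp only [not_not]
      exact Measure.pi_hyperplane (fun _ : Fin n => (volume : Measure ℝ)) i ((a : ℝ) / 2 ^ j)
    exact (PiLp.volume_preserving_ofLp (Fin n)).quasiMeasurePreserving.ae h2
  have h3 : ∀ᵐ x : Eu n ∂volume, ∀ (i : Fin n) (a : ℤ), x i ≠ (a : ℝ) / 2 ^ j :=
    ae_all_iff.2 fun i => ae_all_iff.2 fun a => h1 i a
  filter_upwards [h3] with x hx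
  refine mem_iUnion.2 ⟨fun i => ⌊2 ^ j * x i⌋, fun i => ?_⟩
  have h0 : (0 : ℝ) < 2 ^ j := by positivity
  have h4 := Int.floor_le (2 ^ j * x i)
  have h5 := Int.lt_floor_add_one (2 ^ j * x i)
  refine ⟨lt_of_le_of_ne ?_ (hx i _).symm, ?_⟩
  · rw [div_le_iff₀ h0]
    linarith
  · rw [lt_div_iff₀ h0]
    linarith

theorem restrict_iUnion_cube (j : ℕ) :
    (volume : Measure (Eu n)).restrict (⋃ m : Fin n → ℤ, cube j m) = volume :=
  Measure.restrict_eq_self_of_ae_mem (ae_mem_iUnion_cube j)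

theorem lintegral_eq_tsum_cube (j : ℕ) (f : Eu n → ℝ≥0∞) :
    ∫⁻ x, f x = ∑' m : Fin n → ℤ, ∫⁻ x in cube j m, f x := by
  rw [← lintegral_iUnion (measurableSet_cube j) (pairwise_disjoint_cube j), restrict_iUnion_cube]

theorem ae_of_forall_cube {P : Eu n → Prop} (j : ℕ)
    (h : ∀ m : Fin n → ℤ, ∀ᵐ x ∂volume.restrict (cube j m), P x) : ∀ᵐ x : Eu n ∂volume, P x := by
  have h1 : ∀ᵐ x : Eu n ∂volume, ∀ m : Fin n → ℤ, x ∈ cube j m → P x :=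
    ae_all_iff.2 fun m => (ae_restrict_iff' (measurableSet_cube j m)).1 (h m)
  filter_upwards [h1, ae_mem_iUnion_cube j] with x hx hx'
  obtain ⟨m, hm⟩ := mem_iUnion.1 hx'
  exact hx m hm

theorem eLpNorm_eq_lN_cube {ε : Type*} [TopologicalSpace ε] [ContinuousENorm ε] {p : ℝ≥0∞}
    (hp0 : p ≠ 0) (j : ℕ) (g : Eu n → ε) :
    eLpNorm g p volume = lN p fun m : Fin n → ℤ => eLpNorm g p (volume.restrict (cube j m)) := by
  rcases eq_or_ne p ∞ with rfl | hp
  · rw [lN_top]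
    refine le_antisymm ?_ (iSup_le fun m => eLpNorm_restrict_le _ _ _ _)
    rw [eLpNorm_exponent_top]
    refine essSup_le_of_ae_le _ (ae_of_forall_cube j fun m => ?_)
    have : ∀ᵐ x ∂volume.restrict (cube j m), ‖g x‖ₑ ≤ eLpNorm g ∞ (volume.restrict (cube j m)) := by
      rw [eLpNorm_exponent_top]
      exact ae_le_eLpNormEssSup
    filter_upwards [this] with x hx
    exact hx.trans (le_iSup (fun m => eLpNorm g ∞ (volume.restrict (cube j m))) m)
  · have h0 := ENNReal.toReal_pos hp0 hp
    rw [lN_of_ne_top hp]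
    simp_rw [eLpNorm_eq_lintegral_rpow_enorm_toReal hp0 hp, ← ENNReal.rpow_mul,
      one_div_mul_cancel h0.ne', ENNReal.rpow_one]
    rw [← lintegral_eq_tsum_cube]

theorem isProbabilityMeasure_cube (j : ℕ) (m : Fin n → ℤ) :
    IsProbabilityMeasure ((2 : ℝ≥0∞) ^ (j * n) • (volume.restrict (cube j m))) :=
  ⟨by
    rw [Measure.smul_apply, Measure.restrict_apply_univ, volume_cube, smul_eq_mul,
      ENNReal.mul_inv_cancel (by positivity) (by finiteness)]⟩

end Cubes

/-! ### Weights on dyadic cubes -/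

section Averages

variable {n : ℕ} {E : Type*} [NormedAddCommGroup E] [NormedSpace ℝ E]

/-- The relation `1/σ₁ + 1/p = 1/r` for `σ₁ = r p'_r`, the reason for this choice of `σ₁`. If `p =
r`, then `σ₁ = ∞`. -/
theorem holderTriple_relExp {p r : ℝ≥0∞} (hr : 0 < r) (hrp : r ≤ p) :
    ENNReal.HolderTriple (r * (relExp p r).conjExponent) p r := by
  constructor
  rcases eq_or_ne p r with rfl | hpr
  · simp [relExp, ENNReal.conjExponent, hr.ne']
  · have hr' : r ≠ ∞ := fun h => hpr (le_antisymm (h ▸ le_top) hrp)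
    have h1 : 1 ≤ p / r := by
      rwa [ENNReal.le_div_iff_mul_le (Or.inl hr.ne') (Or.inl hr'), one_mul]
    rw [relExp, if_neg hpr]
    have h2 := (ENNReal.HolderConjugate.conjExponent h1).inv_add_inv_eq_inv
    rw [inv_one] at h2
    rw [ENNReal.mul_inv (Or.inl hr.ne') (Or.inl hr')]
    have h3 : p⁻¹ = r⁻¹ * (p / r)⁻¹ := by
      rw [ENNReal.inv_div (Or.inl hr') (Or.inl hr.ne'), div_eq_mul_inv, ← mul_assoc,
        ENNReal.inv_mul_cancel hr.ne' hr', one_mul]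
    rw [h3, ← mul_add, add_comm, h2, mul_one]

/-- Hölder's inequality against a weight. -/
theorem eLpNorm_le_inv_mul_smul {α : Type*} [MeasurableSpace α] {ν : Measure α}
    [IsProbabilityMeasure ν] {s σ p r : ℝ≥0∞} (hsr : s ≤ r) [ENNReal.HolderTriple σ p r]
    {t : α → ℝ} (ht : AEMeasurable t ν) (ht0 : ∀ᵐ x ∂ν, 0 < t x) {h : α → E}
    (hh : AEStronglyMeasurable h ν) :
    eLpNorm h s ν ≤ eLpNorm (fun x => (t x)⁻¹) σ ν * eLpNorm (fun x => t x • h x) p ν := by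
  refine (eLpNorm_le_eLpNorm_of_exponent_le hsr hh).trans ?_
  have h1 : h =ᵐ[ν] (fun x => (t x)⁻¹) • fun x => t x • h x := by
    filter_upwards [ht0] with x hx
    simp [smul_smul, inv_mul_cancel₀ hx.ne']
  rw [eLpNorm_congr_ae h1]
  exact eLpNorm_smul_le_mul_eLpNorm (ht.aestronglyMeasurable.smul hh)
    ht.inv.aestronglyMeasurable

variable {p : ℝ≥0∞} {t : ℕ → Eu n → ℝ} {α₁ α₂ : ℕ → ℝ} {α₃ : ℝ} {σ₁ σ₂ : ℝ≥0∞}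

theorem cubeMean_eq (p : ℝ≥0∞) (j : ℕ) (m : Fin n → ℤ) (g : Eu n → ℝ) :
    cubeMean p j m g = ((2 : ℝ≥0∞) ^ (j * n)) ^ (1 / p).toReal *
      eLpNorm g p (volume.restrict (cube j m)) :=
  eLpNorm_smul_measure_of_ne_zero (by positivity) g p _

theorem cubeFactor_ne_zero (p : ℝ≥0∞) (j : ℕ) : ((2 : ℝ≥0∞) ^ (j * n)) ^ (1 / p).toReal ≠ 0 :=
  (ENNReal.rpow_pos (by positivity) (by finiteness)).ne'

theorem cubeFactor_ne_top (p : ℝ≥0∞) (j : ℕ) : ((2 : ℝ≥0∞) ^ (j * n)) ^ (1 / p).toReal ≠ ∞ :=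
  ENNReal.rpow_ne_top_of_nonneg ENNReal.toReal_nonneg (by finiteness)

/-- On the normalised cube, a probability space, the `μ`-mean is at most the `r`-mean, and Hölder's
inequality against `t_l` produces the mean of `t_l⁻¹` that the lower weight condition controls. The
normalising factors of the two `L_p` norms cancel. -/
theorem MemX.cubeNorm_mul_average_le (ht : MemX α₁ α₂ α₃ σ₁ σ₂ p t) :
    ∃ C : ℝ, 0 < C ∧ ∀ (r : ℝ≥0∞) (μ : ℝ), 0 < μ → ENNReal.ofReal μ ≤ r →
      ENNReal.HolderTriple σ₁ p r → ∀ h : Eu n → E, AEStronglyMeasurable h volume →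
      ∀ j l : ℕ, j ≤ l → ∀ m : Fin n → ℤ,
      cubeNorm p t j m * (w (j * n) * ∫⁻ z in cube j m, ‖h z‖ₑ ^ μ) ^ (1 / μ) ≤
        ENNReal.ofReal (C * (α₁ j / α₁ l)) *
          eLpNorm (fun x => t l x • h x) p (volume.restrict (cube j m)) := by
  obtain ⟨C, hC0, hC⟩ := ht.lower
  refine ⟨C, hC0, fun r μ hμ hμr hσ h hh j l hjl m => ?_⟩
  set ν := (2 : ℝ≥0∞) ^ (j * n) • (volume.restrict (cube j m)) with hν
  have hac : ν ≪ volume := (Measure.restrict_le_self.absolutelyContinuous).smul_left _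
  have := isProbabilityMeasure_cube j m
  have h1 := eLpNorm_le_inv_mul_smul (ν := ν) hμr ((ht.admissible.aemeasurable l).mono_ac hac)
    (hac.ae_le (ht.admissible.pos l)) (hh.mono_ac hac) (σ := σ₁) (p := p)
  have h2 : eLpNorm h (ENNReal.ofReal μ) ν =
      (w (j * n) * ∫⁻ z in cube j m, ‖h z‖ₑ ^ μ) ^ (1 / μ) := by
    rw [eLpNorm_eq_lintegral_rpow_enorm_toReal (by simpa using hμ) (by finiteness),
      ENNReal.toReal_ofReal hμ.le, hν, lintegral_smul_measure, smul_eq_mul, ← Nat.cast_mul,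
      w_natCast]
  have h3 : eLpNorm (fun x => t l x • h x) p ν = _ :=
    eLpNorm_smul_measure_of_ne_zero (by positivity) _ p _
  rw [h2, h3, smul_eq_mul] at h1
  have h4 := mul_le_mul' (le_refl (cubeMean p j m (t j))) h1
  rw [← mul_assoc (cubeMean p j m (t j))] at h4
  have h5 := h4.trans (mul_le_mul' (hC j l hjl m) le_rfl)
  rw [cubeMean_eq, mul_assoc, mul_left_comm (ENNReal.ofReal _)] at h5
  exact (ENNReal.mul_le_mul_iff_right (cubeFactor_ne_zero p j) (cubeFactor_ne_top p j)).1 h5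

theorem MemX.eLpNorm_cube_le (ht : MemX α₁ α₂ α₃ σ₁ p p t) (hα₂ : ∀ k, 0 < α₂ k) :
    ∃ C : ℝ, 0 < C ∧ ∀ j k : ℕ, j ≤ k → ∀ m : Fin n → ℤ,
      eLpNorm (t k) p (volume.restrict (cube j m)) ≤
        ENNReal.ofReal (C * (α₂ k / α₂ j)) * cubeNorm p t j m := by
  obtain ⟨C, hC0, hC⟩ := ht.upper
  refine ⟨C, hC0, fun j k hjk m => ?_⟩
  have h0 : ENNReal.ofReal (C * (α₂ k / α₂ j)) ≠ 0 := by
    have := hα₂ k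
    have := hα₂ j
    rw [Ne, ENNReal.ofReal_eq_zero, not_le]
    positivity
  have h1 : cubeNorm p t j m ≠ 0 := (ht.neighbour j m m (by simp)).1.ne'
  rcases eq_or_ne (cubeNorm p t j m) ∞ with h2 | h2
  · rw [h2, ENNReal.mul_top h0]
    exact le_top
  have h3 := hC j k hjk m
  have h4 : cubeMean p j m (t j) ≠ 0 := by
    rw [cubeMean_eq]
    exact mul_ne_zero (cubeFactor_ne_zero p j) h1
  have h5 : cubeMean p j m (t j) ≠ ∞ := by
    rw [cubeMean_eq]
    exact ENNReal.mul_ne_top (cubeFactor_ne_top p j) h2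
  rw [ENNReal.inv_mul_le_iff h4 h5, cubeMean_eq, cubeMean_eq, mul_assoc,
    ENNReal.mul_le_mul_iff_right (cubeFactor_ne_zero p j) (cubeFactor_ne_top p j)] at h3
  rwa [mul_comm]

theorem MemX.cubeNorm_le_of_abs_le (ht : MemX α₁ α₂ α₃ σ₁ σ₂ p t) (j d : ℕ) :
    ∀ m m' : Fin n → ℤ, (∀ i, |m i - m' i| ≤ d) →
      cubeNorm p t j m ≤ w (α₃ * d) * cubeNorm p t j m' := by
  induction d with
  | zero =>
    intro m m' h
    have : m = m' := funext fun i => by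
      have := h i
      rw [Nat.cast_zero, abs_le] at this
      omega
    rw [this, Nat.cast_zero, mul_zero, w_zero, one_mul]
  | succ d ih =>
    intro m m' h
    -- Every coordinate moves at most one step towards `m'`, so `m''` is a neighbour of `m` and the
    -- distance to `m'` drops by one.
    set m'' : Fin n → ℤ := fun i => max (m i - 1) (min (m i + 1) (m' i)) with hm''
    have h1 : ∀ i, |m i - m'' i| ≤ 1 := fun i => by
      rw [abs_le]
      simp only [hm'']
      omega
    have h2 : ∀ i, |m'' i - m' i| ≤ d := fun i => by
      have := h i
      rw [abs_le] at this ⊢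
      simp only [hm'']
      push_cast at this
      omega
    calc cubeNorm p t j m ≤ w α₃ * cubeNorm p t j m'' := by
          rw [← ofReal_two_rpow]
          exact (ht.neighbour j m m'' h1).2
      _ ≤ w α₃ * (w (α₃ * d) * cubeNorm p t j m') := by gcongr; exact ih _ _ h2
      _ = _ := by
        rw [← mul_assoc, ← w_add]
        congr 2
        push_cast
        ring

theorem MemX.cubeNorm_le (ht : MemX α₁ α₂ α₃ σ₁ σ₂ p t) (j : ℕ) (m m' : Fin n → ℤ) :
    cubeNorm p t j m ≤ w (α₃ * ‖m - m'‖) * cubeNorm p t j m' := by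
  obtain ⟨d, hd⟩ : ∃ d : ℕ, ‖m - m'‖ = d := by
    rcases isEmpty_or_nonempty (Fin n) with he | he
    · exact ⟨0, by simp [Subsingleton.elim m m']⟩
    · obtain ⟨i, -, hi⟩ := Finset.exists_mem_eq_sup Finset.univ Finset.univ_nonempty
        fun i => ‖(m - m') i‖₊
      exact ⟨((m - m') i).natAbs, by
        rw [Pi.norm_def, hi, coe_nnnorm, Int.norm_eq_abs, Nat.cast_natAbs, Int.cast_abs]⟩
  rw [hd]
  refine ht.cubeNorm_le_of_abs_le j d m m' fun i => ?_
  have h2 := norm_le_pi_norm (m - m') i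
  rw [hd, Int.norm_eq_abs, Pi.sub_apply] at h2
  exact_mod_cast h2

end Averages

/-! ### Weighted estimates of the integral means -/

section WeightedPeetre

variable {n : ℕ}

/-- Half of a decay `c²` is spent on summation, the other half stays inside a supremum. -/
theorem tsum_mul_mul_le {ι : Type*} (c a : ι → ℝ≥0∞) :
    ∑' i, c i * (c i * a i) ≤ (∑' i, c i) * ⨆ i, c i * a i := by
  rw [← ENNReal.tsum_mul_right]
  exact ENNReal.tsum_le_tsum fun i => by gcongr; exact le_iSup (fun i => c i * a i) i

theorem exists_tsum_w_prod_le (n : ℕ) {a b : ℝ} (ha : 0 < a) (hb : 0 < b) :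
    ∃ D : ℝ≥0, ∀ m : Fin n → ℤ,
      ∑' q : ℕ × (Fin n → ℤ), w (-(a * q.1 + b * ‖m - q.2‖)) ≤ D := by
  obtain ⟨D, hD⟩ := exists_tsum_w_pi_le n hb
  refine ⟨(∑' d : ℕ, w (-(a * d))).toNNReal * D, fun m => ?_⟩
  rw [ENNReal.coe_mul, ENNReal.coe_toNNReal (tsum_w_nat_ne_top ha), ENNReal.tsum_prod',
    ← ENNReal.tsum_mul_right]
  refine ENNReal.tsum_le_tsum fun l => ?_
  simp_rw [neg_add, w_add, ENNReal.tsum_mul_left]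
  gcongr
  simpa only [norm_sub_rev m] using hD m

theorem peetreInt_le_tsum_cube {M Λ μ : ℝ} (hΛμ : 0 ≤ Λ * μ) (u : ℕ → Eu n → ℝ≥0∞)
    {j : ℕ} {m : Fin n → ℤ} {x : Eu n} (hx : x ∈ cube j m) :
    peetreInt M Λ μ u j x ≤ w (Λ * μ) * ∑' q : ℕ × (Fin n → ℤ),
      w (-(q.1 * (M * μ - n) + Λ * μ * ‖m - q.2‖)) *
        (w (j * n) * ∫⁻ z in cube j q.2, u (j + q.1) z ^ μ) := by
  rw [peetreInt, ENNReal.tsum_prod', ← ENNReal.tsum_mul_left]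
  refine ENNReal.tsum_le_tsum fun l => ?_
  rw [lintegral_eq_tsum_cube j, ← ENNReal.tsum_mul_left, ← ENNReal.tsum_mul_left]
  refine ENNReal.tsum_le_tsum fun m' => ?_
  have h1 : ∫⁻ z in cube j m', w (-(Λ * μ * 2 ^ j * ‖x - z‖)) * u (j + l) z ^ μ ≤
      w (Λ * μ - Λ * μ * ‖m - m'‖) * ∫⁻ z in cube j m', u (j + l) z ^ μ := by
    rw [← lintegral_const_mul' _ _ (w_ne_top _)]
    refine setLIntegral_mono' (measurableSet_cube j m') fun z hz => ?_
    gcongr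
    refine w_mono ?_
    have := mul_le_mul_of_nonneg_left (norm_sub_le_of_mem_cube hx hz) hΛμ
    linarith
  calc _ ≤ w (j * n - l * (M * μ - n)) *
        (w (Λ * μ - Λ * μ * ‖m - m'‖) * ∫⁻ z in cube j m', u (j + l) z ^ μ) := by gcongr
    _ = _ := by
      simp only [← mul_assoc, ← w_add]
      congr 2
      ring

/-- Half of the decay makes the sum over levels and cubes a supremum, which commutes with the power
`1/μ`; hence the factors `2` in the hypothesis on `M` and in `2 * b`. -/
theorem exists_peetreInt_rpow_le (n : ℕ) {M μ a b : ℝ} (hμ : 0 < μ) (ha : 0 < a) (hb : 0 < b)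
    (hM : 2 * a * μ ≤ M * μ - n) :
    ∃ C : ℝ≥0, ∀ (u : ℕ → Eu n → ℝ≥0∞) (j : ℕ) (m : Fin n → ℤ), ∀ x ∈ cube j m,
      peetreInt M (2 * b) μ u j x ^ (1 / μ) ≤ C * ⨆ q : ℕ × (Fin n → ℤ),
        w (-(a * q.1 + b * ‖m - q.2‖)) *
          (w (j * n) * ∫⁻ z in cube j q.2, u (j + q.1) z ^ μ) ^ (1 / μ) := by
  obtain ⟨D, hD⟩ := exists_tsum_w_prod_le n (mul_pos ha hμ) (mul_pos hb hμ)
  refine ⟨((w (2 * b * μ)).toNNReal * D) ^ (1 / μ), fun u j m x hx => ?_⟩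
  set B : ℕ × (Fin n → ℤ) → ℝ≥0∞ := fun q =>
    w (j * n) * ∫⁻ z in cube j q.2, u (j + q.1) z ^ μ with hB
  set S := ⨆ q : ℕ × (Fin n → ℤ), w (-(a * q.1 + b * ‖m - q.2‖)) * B q ^ (1 / μ) with hS
  have h1 : ∀ q : ℕ × (Fin n → ℤ),
      w (-(a * μ * q.1 + b * μ * ‖m - q.2‖)) * B q ≤ S ^ μ := fun q => by
    have : w (-(a * q.1 + b * ‖m - q.2‖)) * B q ^ (1 / μ) ≤ S :=
      le_iSup (fun q : ℕ × (Fin n → ℤ) => w (-(a * q.1 + b * ‖m - q.2‖)) * B q ^ (1 / μ)) q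
    have := ENNReal.rpow_le_rpow this hμ.le
    rw [ENNReal.mul_rpow_of_nonneg _ _ hμ.le, w_rpow, ← ENNReal.rpow_mul,
      one_div_mul_cancel hμ.ne', ENNReal.rpow_one] at this
    convert this using 3
    ring
  have h2 : peetreInt M (2 * b) μ u j x ≤ w (2 * b * μ) * (D * S ^ μ) := by
    refine (peetreInt_le_tsum_cube (by positivity) u hx).trans ?_
    gcongr
    calc _ ≤ ∑' q : ℕ × (Fin n → ℤ), w (-(a * μ * q.1 + b * μ * ‖m - q.2‖)) *
          (w (-(a * μ * q.1 + b * μ * ‖m - q.2‖)) * B q) := by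
          refine ENNReal.tsum_le_tsum fun q => ?_
          rw [← mul_assoc (w _) (w (-(a * μ * q.1 + b * μ * ‖m - q.2‖))) (B q), ← w_add]
          refine mul_le_mul' (w_mono ?_) le_rfl
          have := mul_le_mul_of_nonneg_left hM (Nat.cast_nonneg (α := ℝ) q.1)
          linarith
      _ ≤ _ := tsum_mul_mul_le _ _
      _ ≤ D * S ^ μ := mul_le_mul' (hD m) (iSup_le h1)
  calc _ ≤ (w (2 * b * μ) * (D * S ^ μ)) ^ (1 / μ) := by gcongr
    _ = _ := by
      rw [← mul_assoc, ENNReal.mul_rpow_of_nonneg _ _ (by positivity), ← ENNReal.rpow_mul,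
        mul_one_div_cancel hμ.ne', ENNReal.rpow_one,
        ENNReal.coe_rpow_of_nonneg _ (by positivity), ENNReal.coe_mul,
        ENNReal.coe_toNNReal (w_ne_top _)]

theorem eLpNorm_le_const_mul {α ε ε' : Type*} [MeasurableSpace α] {ν : Measure α}
    [TopologicalSpace ε] [ContinuousENorm ε] [TopologicalSpace ε'] [ContinuousENorm ε'] {p : ℝ≥0∞}
    (hp0 : p ≠ 0) {c : ℝ≥0∞} {f : α → ε} {g : α → ε'} (hg : AEMeasurable (fun x => ‖g x‖ₑ) ν)
    (h : ∀ᵐ x ∂ν, ‖f x‖ₑ ≤ c * ‖g x‖ₑ) : eLpNorm f p ν ≤ c * eLpNorm g p ν := by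
  rcases eq_or_ne p ∞ with rfl | hp
  · rw [eLpNorm_exponent_top, eLpNorm_exponent_top]
    refine essSup_le_of_ae_le _ ?_
    filter_upwards [h, ae_le_eLpNormEssSup (f := g) (μ := ν)] with x h1 h2
    exact h1.trans (by gcongr)
  · have h0 := ENNReal.toReal_pos hp0 hp
    rw [eLpNorm_eq_lintegral_rpow_enorm_toReal hp0 hp, eLpNorm_eq_lintegral_rpow_enorm_toReal hp0 hp,
      one_div, ENNReal.rpow_inv_le_iff h0, ENNReal.mul_rpow_of_nonneg _ _ h0.le, ← ENNReal.rpow_mul,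
      inv_mul_cancel₀ h0.ne', ENNReal.rpow_one,
      ← lintegral_const_mul'' _ (hg.pow_const _)]
    refine lintegral_mono_ae ?_
    filter_upwards [h] with x hx
    rw [← ENNReal.mul_rpow_of_nonneg _ _ h0.le]
    gcongr

variable {E : Type*} [NormedAddCommGroup E] [NormedSpace ℝ E]
  {p : ℝ≥0∞} {t : ℕ → Eu n → ℝ} {α₁ α₂ : ℕ → ℝ} {α₃ : ℝ} {σ₁ : ℝ≥0∞}

/-- Of the decay rates `A + 1` and `α₃ + 1`, the parts `A` and `α₃` pay for the growth of `α₁ j / α₁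
(j + l)` and for the passage from the cube `m` to `m'`; the rate `1` remains in each variable. -/
theorem MemX.exists_cubeNorm_mul_iSup_le (ht : MemX α₁ α₂ α₃ σ₁ p p t) {r : ℝ≥0∞} {μ : ℝ}
    (hμ : 0 < μ) (hμr : ENNReal.ofReal μ ≤ r) (hσ : ENNReal.HolderTriple σ₁ p r)
    (hα₁ : ∀ k, 0 < α₁ k) {A c : ℝ} (hα : ∀ j l : ℕ, α₁ j ≤ c * 2 ^ (A * l) * α₁ (j + l)) :
    ∃ C : ℝ≥0, ∀ h : ℕ → Eu n → E, (∀ i, AEStronglyMeasurable (h i) volume) →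
      ∀ (j : ℕ) (m : Fin n → ℤ), cubeNorm p t j m * (⨆ q : ℕ × (Fin n → ℤ),
        w (-((A + 1) * q.1 + (α₃ + 1) * ‖m - q.2‖)) *
          (w (j * n) * ∫⁻ z in cube j q.2, ‖h (j + q.1) z‖ₑ ^ μ) ^ (1 / μ)) ≤
      C * ⨆ (l : ℕ) (m' : Fin n → ℤ), w (-‖m - m'‖) * (w (-l) *
        eLpNorm (fun x => t (j + l) x • h (j + l) x) p (volume.restrict (cube j m'))) := by
  obtain ⟨C, hC0, hC⟩ := ht.cubeNorm_mul_average_le (E := E)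
  refine ⟨Real.toNNReal (C * c), fun h hh j m => ?_⟩
  rw [ENNReal.mul_iSup]
  refine iSup_le fun ⟨l, m'⟩ => ?_
  dsimp only
  set B := (w (j * n) * ∫⁻ z in cube j m', ‖h (j + l) z‖ₑ ^ μ) ^ (1 / μ)
  set N := eLpNorm (fun x => t (j + l) x • h (j + l) x) p (volume.restrict (cube j m')) with hN
  have h1 : cubeNorm p t j m' * B ≤ ENNReal.ofReal (C * c) * w (A * l) * N := by
    refine (hC r μ hμ hμr hσ (h (j + l)) (hh _) j (j + l) (by omega) m').trans ?_
    gcongr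
    have hc : 0 ≤ c := by
      have := (hα₁ 0).le.trans (hα 0 0)
      simp only [CharP.cast_eq_zero, mul_zero, Real.rpow_zero, mul_one, add_zero] at this
      exact nonneg_of_mul_nonneg_left this (hα₁ 0)
    rw [← ofReal_two_rpow, ← ENNReal.ofReal_mul (by positivity)]
    refine ENNReal.ofReal_le_ofReal ?_
    have : α₁ j / α₁ (j + l) ≤ c * 2 ^ (A * l) := (div_le_iff₀ (hα₁ _)).2 (hα j l)
    calc C * (α₁ j / α₁ (j + l)) ≤ C * (c * 2 ^ (A * l)) := by gcongr
      _ = _ := by ring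
  calc cubeNorm p t j m * (w (-((A + 1) * l + (α₃ + 1) * ‖m - m'‖)) * B)
      ≤ w (α₃ * ‖m - m'‖) * cubeNorm p t j m' *
        (w (-((A + 1) * l + (α₃ + 1) * ‖m - m'‖)) * B) := by
        gcongr
        exact ht.cubeNorm_le j m m'
    _ = w (α₃ * ‖m - m'‖) * w (-((A + 1) * l + (α₃ + 1) * ‖m - m'‖)) *
        (cubeNorm p t j m' * B) := by ring
    _ ≤ w (α₃ * ‖m - m'‖) * w (-((A + 1) * l + (α₃ + 1) * ‖m - m'‖)) *
        (ENNReal.ofReal (C * c) * w (A * l) * N) := by gcongr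
    _ = ENNReal.ofReal (C * c) * ((w (α₃ * ‖m - m'‖) *
        w (-((A + 1) * l + (α₃ + 1) * ‖m - m'‖)) * w (A * l)) * N) := by ring
    _ = ENNReal.ofReal (C * c) * (w (-‖m - m'‖) * (w (-l) * N)) := by
        rw [← w_add, ← w_add, ← mul_assoc (w (-‖m - m'‖)), ← w_add]
        congr 3
        ring
    _ ≤ _ := by
        gcongr
        · exact le_rfl
        · exact le_iSup₂_of_le l m' le_rfl

/-- On each cube of level `j` the means have a bound that does not depend on the point, so only the
`L_p` norm of `t_k` on the cube is left, and the upper weight condition reduces it to `t_{j,m}`. The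
remaining decay over cubes is absorbed by the Schur type estimate in `ℓ_p`. -/
theorem MemX.exists_eLpNorm_peetreInt_le (ht : MemX α₁ α₂ α₃ σ₁ p p t) (hp : 0 < p) {r : ℝ≥0∞}
    {μ : ℝ} (hμ : 0 < μ) (hμr : ENNReal.ofReal μ ≤ r) (hσ : ENNReal.HolderTriple σ₁ p r)
    (hα₁ : ∀ k, 0 < α₁ k) (hα₂ : ∀ k, 0 < α₂ k) (hα₃ : 0 ≤ α₃) {A c : ℝ} (hA : 0 < A)
    (hα : ∀ j l : ℕ, α₁ j ≤ c * 2 ^ (A * l) * α₁ (j + l)) {M : ℝ}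
    (hM : 2 * (A + 1) * μ ≤ M * μ - n) :
    ∃ C : ℝ≥0, ∀ h : ℕ → Eu n → E, (∀ i, AEStronglyMeasurable (h i) volume) →
      ∀ j k : ℕ, j ≤ k → eLpNorm (fun x => ‖t k x‖ₑ *
        peetreInt M (2 * (α₃ + 1)) μ (fun i y => ‖h i y‖ₑ) j x ^ (1 / μ)) p volume ≤
      C * ENNReal.ofReal (α₂ k / α₂ j) * ⨆ l : ℕ, w (-(1 / 2 * l)) *
        eLpNorm (fun x => t (j + l) x • h (j + l) x) p volume := by
  obtain ⟨C₁, hC₁⟩ := exists_peetreInt_rpow_le n hμ (by linarith : 0 < A + 1)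
    (by linarith : 0 < α₃ + 1) hM
  obtain ⟨C₂, hC₂0, hC₂⟩ := ht.eLpNorm_cube_le hα₂
  obtain ⟨C₃, hC₃⟩ := ht.exists_cubeNorm_mul_iSup_le (E := E) hμ hμr hσ hα₁ hα
  obtain ⟨D₁, hD₁⟩ := exists_lN_w_pi_le n hp.ne' one_pos
  obtain ⟨D₂, hD₂⟩ := exists_lN_w_nat_le hp.ne' (one_half_pos (α := ℝ))
  refine ⟨C₁ * C₂.toNNReal * C₃ * (D₁ * D₂), fun h hh j k hjk => ?_⟩
  set V : ℕ → ℝ≥0∞ := fun l => eLpNorm (fun x => t (j + l) x • h (j + l) x) p volume with hV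
  set N : ℕ → (Fin n → ℤ) → ℝ≥0∞ := fun l m =>
    eLpNorm (fun x => t (j + l) x • h (j + l) x) p (volume.restrict (cube j m)) with hN
  have hVN : ∀ l, V l = lN p (N l) := fun l => eLpNorm_eq_lN_cube hp.ne' j _
  rw [eLpNorm_eq_lN_cube hp.ne' j]
  set K : ℝ≥0∞ := C₁ * ENNReal.ofReal (C₂ * (α₂ k / α₂ j)) * C₃ with hK
  have h1 : ∀ m : Fin n → ℤ, eLpNorm (fun x => ‖t k x‖ₑ *
      peetreInt M (2 * (α₃ + 1)) μ (fun i y => ‖h i y‖ₑ) j x ^ (1 / μ)) p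
        (volume.restrict (cube j m)) ≤
      K * ⨆ (l : ℕ) (m' : Fin n → ℤ), w (-‖m - m'‖) * (w (-l) * N l m') := fun m => by
    set S := ⨆ q : ℕ × (Fin n → ℤ), w (-((A + 1) * q.1 + (α₃ + 1) * ‖m - q.2‖)) *
          (w (j * n) * ∫⁻ z in cube j q.2, ‖h (j + q.1) z‖ₑ ^ μ) ^ (1 / μ) with hS
    calc _ ≤ C₁ * S * eLpNorm (t k) p (volume.restrict (cube j m)) := by
          refine eLpNorm_le_const_mul hp.ne' (ht.admissible.aemeasurable
            k).restrict.enorm ?_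
          refine (ae_restrict_iff' (measurableSet_cube j m)).2 (Filter.Eventually.of_forall
            fun x hx => ?_)
          rw [enorm_eq_self, mul_comm]
          gcongr
          exact hC₁ _ j m x hx
      _ ≤ C₁ * S * (ENNReal.ofReal (C₂ * (α₂ k / α₂ j)) * cubeNorm p t j m) := by
          gcongr
          exact hC₂ j k hjk m
      _ = C₁ * ENNReal.ofReal (C₂ * (α₂ k / α₂ j)) * (cubeNorm p t j m * S) := by ring
      _ ≤ C₁ * ENNReal.ofReal (C₂ * (α₂ k / α₂ j)) * (C₃ *
          ⨆ (l : ℕ) (m' : Fin n → ℤ), w (-‖m - m'‖) * (w (-l) * N l m')) :=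
          mul_le_mul' le_rfl (hC₃ h hh j m)
      _ = _ := by rw [← mul_assoc]
  have h2 : ∀ l : ℕ, lN p (fun m => ⨆ m', w (-‖m - m'‖) * (w (-l) * N l m')) ≤
      D₁ * (w (-l) * V l) := fun l => by
    refine (lN_iSup_mul_le hp.ne' (D := D₁) (fun m' => ?_) _).trans ?_
    · simpa only [one_mul] using hD₁ m'
    · rw [lN_const_mul hp.ne', hVN]
  have h3 : lN p (fun l : ℕ => w (-l) * V l) ≤ D₂ * ⨆ l : ℕ, w (-(1 / 2 * l)) * V l := by
    -- Half of the decay in `l` makes the `ℓ_p` norm converge; the rate `1/2` survives in the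
    -- supremum.
    have h4 : ∀ l : ℕ, w (-l) * V l = w (-(1 / 2 * l)) * (w (-(1 / 2 * l)) * V l) := fun l => by
      rw [← mul_assoc, ← w_add]
      congr 2
      ring
    simp_rw [h4]
    refine (lN_mul_le hp.ne' _ _).trans ?_
    gcongr
    have := hD₂ 0
    simpa using this
  calc _ ≤ lN p fun m : Fin n → ℤ => K * ⨆ (l : ℕ) (m' : Fin n → ℤ),
        w (-‖m - m'‖) * (w (-l) * N l m') := lN_mono h1
    _ = K * lN p fun m : Fin n → ℤ => ⨆ (l : ℕ) (m' : Fin n → ℤ),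
        w (-‖m - m'‖) * (w (-l) * N l m') := lN_const_mul hp.ne' _ _
    _ ≤ K * lN p fun l : ℕ => D₁ * (w (-l) * V l) := by
        gcongr
        exact (lN_iSup_le hp.ne' _).trans (lN_mono h2)
    _ ≤ K * (D₁ * (D₂ * ⨆ l : ℕ, w (-(1 / 2 * l)) * V l)) := by
        rw [lN_const_mul hp.ne']
        gcongr
    _ = _ := by
        rw [hK, ENNReal.ofReal_mul hC₂0.le]
        push_cast
        rw [ENNReal.ofReal]
        ring

end WeightedPeetre

/-! ### Pointwise consequences of the Hardy conditions -/

section Hardy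

theorem le_lNorm {s : ℝ≥0∞} (hs : s ≠ 0) {S : Set ℕ} (a : ℕ → ℝ≥0∞) {j : ℕ} (hj : j ∈ S) :
    a j ≤ lNorm s S a := by
  rw [lNorm]
  split_ifs with h
  · exact le_iSup₂_of_le j hj le_rfl
  · rw [le_rpow_one_div_iff (ENNReal.toReal_pos hs h)]
    exact ENNReal.le_tsum (f := fun k : S => a k ^ s.toReal) ⟨j, hj⟩

theorem card_rpow_mul_le_lNorm {s : ℝ≥0∞} (hs : s ≠ 0) (hs' : s ≠ ∞) {S : Set ℕ} {a : ℕ → ℝ≥0∞}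
    {c : ℝ≥0∞} (F : Finset ℕ) (hF : ∀ i ∈ F, i ∈ S ∧ c ≤ a i) :
    (F.card : ℝ≥0∞) ^ (1 / s.toReal) * c ≤ lNorm s S a := by
  have h0 := ENNReal.toReal_pos hs hs'
  rw [lNorm, if_neg hs', le_rpow_one_div_iff h0, ENNReal.mul_rpow_of_nonneg _ _ h0.le,
    ← ENNReal.rpow_mul, one_div_mul_cancel h0.ne', ENNReal.rpow_one,
    tsum_subtype S fun k => a k ^ s.toReal]
  calc (F.card : ℝ≥0∞) * c ^ s.toReal = ∑ _i ∈ F, c ^ s.toReal := by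
        rw [Finset.sum_const, nsmul_eq_mul]
    _ ≤ ∑ i ∈ F, S.indicator (fun k => a k ^ s.toReal) i := by
        refine Finset.sum_le_sum fun i hi => ?_
        rw [Set.indicator_of_mem (hF i hi).1]
        exact ENNReal.rpow_le_rpow (hF i hi).2 h0.le
    _ ≤ _ := ENNReal.sum_le_tsum F

theorem one_le_relExp {p r : ℝ≥0∞} (hr : r ≠ 0) (hr' : r ≠ ∞) (hrp : r ≤ p) : 1 ≤ relExp p r := by
  rw [relExp]
  split_ifs
  · exact le_rfl
  · rwa [ENNReal.le_div_iff_mul_le (Or.inl hr) (Or.inl hr'), one_mul]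

theorem conjExponent_ne_zero (s : ℝ≥0∞) : s.conjExponent ≠ 0 := by
  simp [ENNReal.conjExponent]

/-- The first Hardy condition makes the sequence almost increasing. -/
theorem HardyTail.exists_le {s : ℝ≥0∞} (hs : 1 ≤ s) {β : ℕ → ℝ} (hβ : ∀ k, 0 < β k)
    (h : HardyTail s β) : ∃ K : ℝ, 1 ≤ K ∧ ∀ j i : ℕ, j ≤ i → β j ≤ K * β i := by
  have hs0 : s ≠ 0 := (one_pos.trans_le hs).ne'
  set R := ⨆ (n : ℕ) (_ : 1 ≤ n), lNorm s (Iic n) (fun k => ENNReal.ofReal (β k)) *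
        lNorm s.conjExponent (Ici n) (fun k => ENNReal.ofReal (β k)⁻¹) with hR
  have hRt : R ≠ ∞ := h.ne
  refine ⟨max 1 R.toReal, le_max_left _ _, fun j i hji => ?_⟩
  -- The supremum in the condition runs over `n ≥ 1`, so index `0` is treated by hand.
  rcases Nat.eq_zero_or_pos i with rfl | hi
  · rw [Nat.le_zero.1 hji]
    exact le_mul_of_one_le_left (hβ 0).le (le_max_left _ _)
  rw [← div_le_iff₀ (hβ i)]
  refine le_max_of_le_right ((ENNReal.ofReal_le_iff_le_toReal hRt).1 ?_)
  rw [div_eq_mul_inv, ENNReal.ofReal_mul (hβ j).le]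
  exact le_iSup₂_of_le i hi (mul_le_mul'
    (le_lNorm hs0 (fun k => ENNReal.ofReal (β k)) (mem_Iic.2 hji))
    (le_lNorm (conjExponent_ne_zero s) (fun k => ENNReal.ofReal (β k)⁻¹) (mem_Ici.2 le_rfl)))

theorem HardyHead.exists_le {s : ℝ≥0∞} (hs : 1 ≤ s) {β : ℕ → ℝ} (hβ : ∀ k, 0 < β k)
    (h : HardyHead s β) : ∃ K : ℝ, 1 ≤ K ∧ (∀ j k : ℕ, j ≤ k → β k ≤ K * β j) ∧
      ∀ n : ℕ, 1 ≤ n → lNorm s (Ici n) (fun k => ENNReal.ofReal (β k)) *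
        lNorm s.conjExponent (Iic n) (fun k => ENNReal.ofReal (β k)⁻¹) ≤ ENNReal.ofReal K := by
  have hs0 : s ≠ 0 := (one_pos.trans_le hs).ne'
  set R := ⨆ (n : ℕ) (_ : 1 ≤ n), lNorm s (Ici n) (fun k => ENNReal.ofReal (β k)) *
        lNorm s.conjExponent (Iic n) (fun k => ENNReal.ofReal (β k)⁻¹) with hR
  have hRt : R ≠ ∞ := h.ne
  refine ⟨max 1 R.toReal, le_max_left _ _, fun j k hjk => ?_, fun n hn => ?_⟩
  · rcases Nat.eq_zero_or_pos k with rfl | hk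
    · rw [Nat.le_zero.1 hjk]
      exact le_mul_of_one_le_left (hβ 0).le (le_max_left _ _)
    rw [← div_le_iff₀ (hβ j)]
    refine le_max_of_le_right ((ENNReal.ofReal_le_iff_le_toReal hRt).1 ?_)
    rw [div_eq_mul_inv, ENNReal.ofReal_mul (hβ k).le]
    exact le_iSup₂_of_le k hk (mul_le_mul'
      (le_lNorm hs0 (fun k => ENNReal.ofReal (β k)) (mem_Ici.2 le_rfl))
      (le_lNorm (conjExponent_ne_zero s) (fun k => ENNReal.ofReal (β k)⁻¹) (mem_Iic.2 hjk)))
  · refine le_trans ?_ (ENNReal.ofReal_le_ofReal (le_max_right _ _))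
    rw [ENNReal.ofReal_toReal hRt]
    exact le_iSup₂_of_le n hn le_rfl

/-- The condition first makes `β` almost decreasing. The `d + 1` terms between `n` and `n + d` are
then comparable from one side with an end value, and counting them in one of the two norms gives a
power of `d + 1`. -/
theorem HardyHead.exists_rpow_mul_le {s : ℝ≥0∞} (hs : 1 ≤ s) {β : ℕ → ℝ} (hβ : ∀ k, 0 < β k)
    (h : HardyHead s β) : ∃ (e K : ℝ), 0 < e ∧ 1 ≤ K ∧ (∀ j k : ℕ, j ≤ k → β k ≤ K * β j) ∧
      ∀ n d : ℕ, 1 ≤ n → ((d + 1 : ℕ) : ℝ) ^ e * β (n + d) ≤ K * β n := by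
  obtain ⟨K, hK1, hK, hN⟩ := h.exists_le hs hβ
  have hK0 : 0 < K := one_pos.trans_le hK1
  have hs0 : s ≠ 0 := (one_pos.trans_le hs).ne'
  have hcast : ∀ (d : ℕ) {e : ℝ}, 0 < e →
      ((d + 1 : ℕ) : ℝ≥0∞) ^ e = ENNReal.ofReal (((d + 1 : ℕ) : ℝ) ^ e) := fun d e he => by
    rw [← ENNReal.ofReal_rpow_of_pos (by positivity), ENNReal.ofReal_natCast]
  have hcard : ∀ n d : ℕ, (Finset.Icc n (n + d)).card = d + 1 := fun n d => by
    rw [Nat.card_Icc]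
    omega
  have hmono : ∀ j k : ℕ, j ≤ k → β k ≤ K ^ 2 * β j := fun j k hjk => (hK j k hjk).trans (by
    have := hβ j
    gcongr
    nlinarith)
  have key : ∀ (e : ℝ), 0 < e → ∀ n d : ℕ,
      ((d + 1 : ℕ) : ℝ≥0∞) ^ e * ENNReal.ofReal (β (n + d) / K) * ENNReal.ofReal (β n)⁻¹ ≤
        ENNReal.ofReal K → ((d + 1 : ℕ) : ℝ) ^ e * β (n + d) ≤ K ^ 2 * β n := fun e he n d h1 => by
    have h2 := hβ (n + d)
    have h3 := hβ n
    rw [hcast d he, ← ENNReal.ofReal_mul (by positivity), ← ENNReal.ofReal_mul (by positivity),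
      ENNReal.ofReal_le_ofReal_iff hK0.le, ← div_eq_mul_inv, div_le_iff₀ h3, ← mul_div_assoc,
      div_le_iff₀ hK0] at h1
    linarith
  rcases eq_or_ne s ∞ with rfl | hs'
  -- For `s = ∞` the first norm is a supremum and counts nothing; the terms are counted in the
  -- conjugate sum, whose exponent is `1`.
  · refine ⟨1, K ^ 2, one_pos, by nlinarith, hmono, fun n d hn => key 1 one_pos n d ?_⟩
    have hc : (∞ : ℝ≥0∞).conjExponent = 1 := by simp [ENNReal.conjExponent]
    have h1 := card_rpow_mul_le_lNorm (s := 1) one_ne_zero ENNReal.one_ne_top (S := Iic (n + d))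
      (a := fun k => ENNReal.ofReal (β k)⁻¹) (c := ENNReal.ofReal (K * β n)⁻¹)
      (Finset.Icc n (n + d)) fun i hi => by
        rw [Finset.mem_Icc] at hi
        have := hβ i
        refine ⟨hi.2, ENNReal.ofReal_le_ofReal ?_⟩
        gcongr
        exact hK n i hi.1
    have h2 := mul_le_mul' (le_lNorm (s := ∞) ENNReal.top_ne_zero (fun k => ENNReal.ofReal (β k))
      (mem_Ici.2 (le_refl (n + d)))) h1
    have h3 := hN (n + d) (by omega)
    rw [hc] at h3
    refine le_trans (le_of_eq ?_) (h2.trans h3)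
    have h4 := hβ (n + d)
    have h5 := hβ n
    rw [ENNReal.toReal_one, div_one, hcard, mul_assoc, mul_left_comm (ENNReal.ofReal (β (n + d))),
      ← ENNReal.ofReal_mul (by positivity), ← ENNReal.ofReal_mul (by positivity)]
    congr 2
    field_simp
  · have h0 := ENNReal.toReal_pos hs0 hs'
    refine ⟨1 / s.toReal, K ^ 2, by positivity, by nlinarith, hmono,
      fun n d hn => key _ (by positivity) n d ?_⟩
    have h1 := card_rpow_mul_le_lNorm hs0 hs' (S := Ici n)
      (a := fun k => ENNReal.ofReal (β k)) (c := ENNReal.ofReal (β (n + d) / K))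
      (Finset.Icc n (n + d)) fun i hi => by
        rw [Finset.mem_Icc] at hi
        refine ⟨hi.1, ENNReal.ofReal_le_ofReal ?_⟩
        rw [div_le_iff₀ hK0, mul_comm]
        exact hK i _ hi.2
    rw [hcard] at h1
    exact (mul_le_mul' h1 (le_lNorm (conjExponent_ne_zero s) (fun k => ENNReal.ofReal (β k)⁻¹)
      (mem_Iic.2 (le_refl n)))).trans (hN n hn)

/-- The second Hardy condition implies geometric decay. -/
theorem HardyHead.exists_geometric {s : ℝ≥0∞} (hs : 1 ≤ s) {β : ℕ → ℝ} (hβ : ∀ k, 0 < β k)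
    (h : HardyHead s β) : ∃ (δ C : ℝ), 0 < δ ∧ 0 < C ∧ ∀ j d : ℕ,
      β (j + d) ≤ C * 2 ^ (-(δ * d)) * β j := by
  obtain ⟨e, K, he, hK1, hK, hd⟩ := h.exists_rpow_mul_le hs hβ
  have hK0 : 0 < K := one_pos.trans_le hK1
  -- A shift for which the power of `d + 1` exceeds `2 * K` halves the sequence; iterating it turns
  -- polynomial into geometric decay.
  obtain ⟨D, hD0, hD⟩ : ∃ D : ℕ, 0 < D ∧ ∀ n, 1 ≤ n → β (n + D) ≤ β n / 2 := by
    obtain ⟨D, hD⟩ := exists_nat_ge ((2 * K) ^ (1 / e))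
    refine ⟨D + 1, by omega, fun n hn => ?_⟩
    have h1 : 2 * K ≤ ((D + 1 + 1 : ℕ) : ℝ) ^ e := by
      calc 2 * K = ((2 * K) ^ (1 / e)) ^ e := by
            rw [← Real.rpow_mul (by positivity), one_div_mul_cancel he.ne', Real.rpow_one]
        _ ≤ _ := by
            gcongr
            push_cast
            linarith
    have h2 := hd n (D + 1) hn
    have h3 : 2 * K * β (n + (D + 1)) ≤ K * β n := le_trans (by
      have := hβ (n + (D + 1))
      gcongr) h2
    nlinarith
  have hq : ∀ (q n : ℕ), 1 ≤ n → β (n + q * D) ≤ 2 ^ (-(q : ℝ)) * β n := fun q n hn => by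
    induction q with
    | zero => simp
    | succ q ih =>
      have h1 := hD (n + q * D) (by omega)
      rw [show n + (q + 1) * D = n + q * D + D by ring]
      rw [Nat.cast_succ, neg_add, Real.rpow_add two_pos, Real.rpow_neg_one]
      linarith
  have hDr : (0 : ℝ) < D := by exact_mod_cast hD0
  have hpos : ∀ n d : ℕ, 1 ≤ n → β (n + d) ≤ 2 * K * 2 ^ (-(1 / D * d : ℝ)) * β n :=
      fun n d hn => by
    have h1 : β (n + d) ≤ K * β (n + d / D * D) :=
      hK _ _ (by have := Nat.div_mul_le_self d D; omega)
    have h2 : (2 : ℝ) ^ (-((d / D : ℕ) : ℝ)) ≤ 2 * 2 ^ (-(1 / D * d : ℝ)) := by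
      calc (2 : ℝ) ^ (-((d / D : ℕ) : ℝ)) ≤ 2 ^ (1 + -(1 / D * d : ℝ)) := by
            refine Real.rpow_le_rpow_of_exponent_le one_le_two ?_
            have h3 : d < (d / D + 1) * D := Nat.lt_mul_of_div_lt (Nat.lt_succ_self _) hD0
            have h4 : (d : ℝ) < (((d / D : ℕ) : ℝ) + 1) * D := by exact_mod_cast h3
            have h5 : 1 / D * d < ((d / D : ℕ) : ℝ) + 1 := by
              rw [one_div_mul_eq_div, div_lt_iff₀ hDr]
              exact h4
            linarith
        _ = _ := by rw [Real.rpow_add two_pos, Real.rpow_one]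
    have h3 := hβ n
    calc β (n + d) ≤ K * (2 ^ (-((d / D : ℕ) : ℝ)) * β n) := h1.trans (by
          gcongr
          exact hq _ _ hn)
      _ ≤ K * (2 * 2 ^ (-(1 / D * d : ℝ)) * β n) := by gcongr
      _ = _ := by ring
  refine ⟨1 / D, 4 * K ^ 2, by positivity, by positivity, fun j d => ?_⟩
  have hj := hβ j
  -- The decay is known from index `1` on; the step from `0` to `1` uses almost monotonicity and one
  -- more factor `2 * K`.
  rcases Nat.eq_zero_or_pos j with rfl | hj1
  · rcases Nat.eq_zero_or_pos d with rfl | hd1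
    · simp only [add_zero, CharP.cast_eq_zero, mul_zero, neg_zero, Real.rpow_zero, mul_one]
      exact le_mul_of_one_le_left hj.le (by nlinarith)
    · obtain ⟨d, rfl⟩ := Nat.exists_eq_add_of_le hd1
      rw [zero_add]
      have h1 : (2 : ℝ) ^ (-(1 / D * d : ℝ)) ≤ 2 * 2 ^ (-(1 / D * ((1 + d : ℕ) : ℝ))) := by
        calc (2 : ℝ) ^ (-(1 / D * d : ℝ)) ≤ 2 ^ (1 + -(1 / D * ((1 + d : ℕ) : ℝ))) := by
              refine Real.rpow_le_rpow_of_exponent_le one_le_two ?_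
              have : (1 : ℝ) / D ≤ 1 := by
                rw [div_le_one hDr]
                exact_mod_cast hD0
              push_cast
              linarith
          _ = _ := by rw [Real.rpow_add two_pos, Real.rpow_one]
      calc β (1 + d) ≤ 2 * K * 2 ^ (-(1 / D * d : ℝ)) * β 1 := hpos 1 d le_rfl
        _ ≤ 2 * K * (2 * 2 ^ (-(1 / D * ((1 + d : ℕ) : ℝ)))) * (K * β 0) := by
            gcongr
            · exact (hβ 1).le
            · exact hK 0 1 (by omega)
        _ = _ := by ring
  · refine (hpos j d hj1).trans ?_
    have : 2 * K ≤ 4 * K ^ 2 := by nlinarith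
    gcongr

theorem HardyTail.exists_le_of_rpow {s : ℝ≥0∞} (hs : 1 ≤ s) {μ : ℝ} (hμ : 0 < μ) {b : ℕ → ℝ}
    (hb : ∀ k, 0 < b k) (h : HardyTail s fun k => b k ^ μ) :
    ∃ C : ℝ, ∀ j i : ℕ, j ≤ i → b j ≤ C * b i := by
  obtain ⟨K, hK1, hK⟩ := h.exists_le hs fun k => Real.rpow_pos_of_pos (hb k) μ
  refine ⟨K ^ (1 / μ), fun j i hji => ?_⟩
  have h1 := Real.rpow_le_rpow (Real.rpow_nonneg (hb j).le μ) (hK j i hji)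
    (one_div_nonneg.2 hμ.le)
  rwa [Real.mul_rpow (by linarith) (Real.rpow_nonneg (hb i).le μ), ← Real.rpow_mul (hb j).le,
    ← Real.rpow_mul (hb i).le, mul_one_div_cancel hμ.ne', Real.rpow_one, Real.rpow_one] at h1

theorem HardyHead.exists_geometric_of_rpow {s : ℝ≥0∞} (hs : 1 ≤ s) {μ : ℝ} (hμ : 0 < μ)
    {b : ℕ → ℝ} (hb : ∀ k, 0 < b k) (h : HardyHead s fun k => b k ^ μ) :
    ∃ (δ C : ℝ), 0 < δ ∧ 0 < C ∧ ∀ j d : ℕ, b (j + d) ≤ C * 2 ^ (-(δ * d)) * b j := by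
  obtain ⟨δ, C, hδ, hC, hd⟩ := h.exists_geometric hs fun k => Real.rpow_pos_of_pos (hb k) μ
  refine ⟨δ / μ, C ^ (1 / μ), by positivity, by positivity, fun j d => ?_⟩
  have h1 := Real.rpow_le_rpow (Real.rpow_nonneg (hb (j + d)).le μ) (hd j d)
    (one_div_nonneg.2 hμ.le)
  rw [Real.mul_rpow (by positivity) (Real.rpow_nonneg (hb j).le μ),
    Real.mul_rpow hC.le (by positivity), ← Real.rpow_mul (hb (j + d)).le,
    ← Real.rpow_mul (hb j).le, ← Real.rpow_mul two_pos.le, mul_one_div_cancel hμ.ne',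
    Real.rpow_one, Real.rpow_one] at h1
  convert h1 using 4
  ring

end Hardy

/-! ### The moment order -/

section Moments

variable {n : ℕ} {𝕜 : Type*} [RCLike 𝕜]

/-- The set of admissible orders contains `-1` vacuously. If it is bounded, its supremum belongs to
it; if not, all moments vanish and the default value `0` is admissible as well. -/
theorem momentOrder_spec (ψ : TestFun n 𝕜) : -1 ≤ momentOrder ψ ∧
    ∀ β : Fin n → ℕ, ((∑ i, β i : ℕ) : ℤ) ≤ momentOrder ψ →
      ∫ x : Eu n, (∏ i, x i ^ β i) • ψ x = 0 := by
  set S := {L : ℤ | ∀ β : Fin n → ℕ, ((∑ i, β i : ℕ) : ℤ) ≤ L →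
    ∫ x : Eu n, (∏ i, x i ^ β i) • ψ x = 0} with hS
  have h1 : (-1 : ℤ) ∈ S := fun β hβ => absurd hβ (by omega)
  by_cases hb : BddAbove S
  · exact ⟨le_csSup hb h1, Int.csSup_mem ⟨_, h1⟩ hb⟩
  · have h2 : momentOrder ψ = 0 := csSup_of_not_bddAbove hb |>.trans Int.csSup_empty
    refine ⟨by omega, fun β _ => ?_⟩
    rw [not_bddAbove_iff] at hb
    obtain ⟨L, hL, hL'⟩ := hb ((∑ i, β i : ℕ) : ℤ)
    exact hL β hL'.le

end Moments

/-! ### Summation over levels and the exponents of the weights -/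

section Assembly

variable {n : ℕ} {𝕜 : Type*} [RCLike 𝕜]

theorem measurable_peetreInt (M Λ μ : ℝ) {u : ℕ → Eu n → ℝ≥0∞} (hu : ∀ i, Measurable (u i))
    (j : ℕ) : Measurable (peetreInt M Λ μ u j) := by
  refine Measurable.tsum fun l => ?_
  refine Measurable.const_mul ?_ _
  refine Measurable.lintegral_prod_right' (f := fun q : Eu n × Eu n =>
    w (-(Λ * μ * 2 ^ j * ‖q.1 - q.2‖)) * u (j + l) q.2 ^ μ) ?_
  have h1 : Measurable fun q : Eu n × Eu n => -(Λ * μ * 2 ^ j * ‖q.1 - q.2‖) := by fun_prop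
  exact (measurable_const.pow h1).mul (((hu _).comp measurable_snd).pow_const _)

theorem lNorm_univ (q : ℝ≥0∞) (a : ℕ → ℝ≥0∞) : lNorm q univ a = lN q a := by
  rw [lNorm, lN, tsum_univ fun k => a k ^ q.toReal]
  simp only [mem_univ, iSup_pos]

/-- Summation over the levels below `k`, with suprema in place of sums. -/
theorem exists_eLpNorm_sum_range_le {α : Type*} [MeasurableSpace α] {ν : Measure α} {p : ℝ≥0∞}
    (hp : 0 < p) {δ : ℝ} (hδ : 0 < δ) :
    ∃ C : ℝ≥0, ∀ (k : ℕ) (c : ℕ → ℝ≥0∞) (g : ℕ → α → ℝ≥0∞) (B : ℝ≥0∞),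
      (∀ j, AEMeasurable (g j) ν) →
      (∀ j ≤ k, c j * eLpNorm (g j) p ν ≤ w (-(δ * |(j : ℝ) - k|)) * B) →
      eLpNorm (fun x => ∑ j ∈ Finset.range (k + 1), c j * g j x) p ν ≤ C * B := by
  obtain ⟨D₁, hD₁⟩ := exists_tsum_w_nat_le (half_pos hδ)
  obtain ⟨D₂, hD₂⟩ := exists_lN_w_nat_le hp.ne' (half_pos hδ)
  refine ⟨D₁ * D₂, fun k c g B hg h => ?_⟩
  set a : ℕ → ℝ≥0∞ := fun j => w (-(δ / 2 * |(j : ℝ) - k|)) with ha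
  -- Half of the decay is moved out to sum over `j`; `e j` carries its inverse, and the other half,
  -- left in the hypothesis, controls the supremum.
  set e : ℕ → ℝ≥0∞ := fun j => if j ≤ k then w (δ / 2 * |(j : ℝ) - k|) * c j else 0 with he
  have h1 : ∀ x, ∑ j ∈ Finset.range (k + 1), c j * g j x ≤ D₁ * ⨆ j, e j * g j x := fun x => by
    calc ∑ j ∈ Finset.range (k + 1), c j * g j x
        = ∑ j ∈ Finset.range (k + 1), a j * (e j * g j x) := by
          refine Finset.sum_congr rfl fun j hj => ?_
          have hj' : j ≤ k := Nat.lt_succ_iff.1 (Finset.mem_range.1 hj)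
          simp only [he, ha, if_pos hj', ← mul_assoc, ← w_add]
          rw [neg_add_cancel, w_zero, one_mul]
      _ ≤ ∑' j, a j * (e j * g j x) := ENNReal.sum_le_tsum _
      _ ≤ (∑' j, a j) * ⨆ j, e j * g j x := by
          rw [← ENNReal.tsum_mul_right]
          exact ENNReal.tsum_le_tsum fun j => by
            gcongr
            exact le_iSup (fun j => e j * g j x) j
      _ ≤ _ := mul_le_mul' (hD₁ k) le_rfl
  have hm : ∀ j, AEMeasurable (fun x => e j * g j x) ν := fun j => (hg j).const_mul _
  have h2 : ∀ j, eLpNorm (fun x => e j * g j x) p ν ≤ a j * B := fun j => by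
    refine (eLpNorm_le_const_mul (c := e j) (g := g j) hp.ne' (hg j)
      (Filter.Eventually.of_forall fun x => le_rfl)).trans ?_
    by_cases hj : j ≤ k
    · simp only [he, if_pos hj]
      rw [mul_assoc]
      refine (mul_le_mul' le_rfl (h j hj)).trans (le_of_eq ?_)
      rw [← mul_assoc, ← w_add]
      congr 2
      ring
    · simp only [he, if_neg hj, zero_mul]
      exact zero_le
  calc eLpNorm (fun x => ∑ j ∈ Finset.range (k + 1), c j * g j x) p ν
      ≤ D₁ * eLpNorm (fun x => ⨆ j, e j * g j x) p ν :=
        eLpNorm_le_const_mul hp.ne' (AEMeasurable.iSup hm)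
          (Filter.Eventually.of_forall fun x => h1 x)
    _ ≤ D₁ * lN p fun j => eLpNorm (fun x => e j * g j x) p ν := by
        gcongr
        exact eLpNorm_iSup_le hp.ne' hm
    _ ≤ D₁ * lN p fun j => B * a j := by
        gcongr
        refine lN_mono fun j => ?_
        rw [mul_comm]
        exact h2 j
    _ ≤ D₁ * (B * D₂) := by
        rw [lN_const_mul hp.ne']
        gcongr
        exact hD₂ k
    _ = _ := by
        push_cast
        ring

theorem vanishingMoments_diffKernel (ζ₀ : TestFun n 𝕜) :
    VanishingMoments (1 + momentOrder (diffKernel ζ₀)).toNat (diffKernel ζ₀) := fun β hβ =>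
  (momentOrder_spec (diffKernel ζ₀)).2 β (by omega)

/-- All that is needed of this condition: since `2^(kA) α_k` is almost increasing, `α` falls at most
at the rate `A`. -/
theorem exists_le_of_hardyTail {s : ℝ≥0∞} (hs : 1 ≤ s) {μ A : ℝ} (hμ : 0 < μ) {α : ℕ → ℝ}
    (hα : ∀ k, 0 < α k) (h : HardyTail s fun k => ((2 : ℝ) ^ ((k : ℝ) * A) * α k) ^ μ) :
    ∃ c : ℝ, ∀ j l : ℕ, α j ≤ c * 2 ^ (A * l) * α (j + l) := by
  obtain ⟨c, hc⟩ := h.exists_le_of_rpow hs hμ fun k => mul_pos (by positivity) (hα k)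
  refine ⟨c, fun j l => ?_⟩
  have h1 := hc j (j + l) (by omega)
  have h2 : (2 : ℝ) ^ (((j + l : ℕ) : ℝ) * A) = 2 ^ ((j : ℝ) * A) * 2 ^ (A * l) := by
    rw [← Real.rpow_add two_pos]
    push_cast
    congr 1
    ring
  rw [h2] at h1
  refine le_of_mul_le_mul_left (h1.trans (le_of_eq ?_))
    (Real.rpow_pos_of_pos two_pos ((j : ℝ) * A))
  ring

/-- Geometric decay of `2^(-kL) α_k` keeps the growth rate of `α` below `L` by a margin `δ`; this
margin makes the sum over the lower levels converge. -/
theorem exists_le_of_hardyHead {s : ℝ≥0∞} (hs : 1 ≤ s) {μ L : ℝ} (hμ : 0 < μ) {α : ℕ → ℝ}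
    (hα : ∀ k, 0 < α k) (h : HardyHead s fun k => ((2 : ℝ) ^ (-((k : ℝ) * L)) * α k) ^ μ) :
    ∃ (δ c : ℝ), 0 < δ ∧ 0 < c ∧ ∀ j d : ℕ,
      α (j + d) / α j ≤ c * 2 ^ ((L - δ) * d) := by
  obtain ⟨δ, c, hδ, hc, hd⟩ := h.exists_geometric_of_rpow hs hμ fun k =>
    mul_pos (by positivity) (hα k)
  refine ⟨δ, c, hδ, hc, fun j d => ?_⟩
  rw [div_le_iff₀ (hα j)]
  have h1 := hd j d
  have h2 : (2 : ℝ) ^ (-(((j + d : ℕ) : ℝ) * L)) = 2 ^ (-((j : ℝ) * L)) * 2 ^ (-(L * d)) := by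
    rw [← Real.rpow_add two_pos]
    push_cast
    congr 1
    ring
  have h3 : (2 : ℝ) ^ ((L - δ) * d) = 2 ^ (-(δ * d)) * 2 ^ (L * d) := by
    rw [← Real.rpow_add two_pos]
    congr 1
    ring
  have h4 : (2 : ℝ) ^ (-(L * d)) * 2 ^ (L * d) = 1 := by
    rw [← Real.rpow_add two_pos, neg_add_cancel, Real.rpow_zero]
  rw [h2] at h1
  have h5 : (2 : ℝ) ^ (-(L * d)) * α (j + d) ≤ c * 2 ^ (-(δ * d)) * α j := by
    refine le_of_mul_le_mul_left ?_ (Real.rpow_pos_of_pos two_pos (-((j : ℝ) * L)))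
    linarith
  have h6 := mul_le_mul_of_nonneg_left h5 (Real.rpow_nonneg two_pos.le (L * d))
  calc α (j + d) = 2 ^ (-(L * d)) * 2 ^ (L * d) * α (j + d) := by rw [h4, one_mul]
    _ = 2 ^ (L * d) * (2 ^ (-(L * d)) * α (j + d)) := by ring
    _ ≤ _ := h6
    _ = _ := by
      rw [h3]
      ring

end Assembly

end VarBesov

end

/-! ### The main theorem -/

open VarBesov in
theorem theorem3p2 {𝕜 : Type*} [RCLike 𝕜] (n : ℕ) (hn : 0 < n)
    (p q r : ENNReal) (hp : 0 < p) (hq : 0 < q) (hr : 0 < r) (hrp : r ≤ p)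
    (α₁ α₂ : ℕ → ℝ) (hα₁ : ∀ k, 0 < α₁ k) (hα₂ : ∀ k, 0 < α₂ k) (α₃ : ℝ) (hα₃ : 0 ≤ α₃)
    (t : ℕ → VarBesov.Eu n → ℝ)
    (ht : VarBesov.MemX α₁ α₂ α₃ (r * (VarBesov.relExp p r).conjExponent) p p t)
    (φ₀ : VarBesov.TestFun n 𝕜) (hφ₀ : ∫ x, φ₀ x = 1)
    (ζ₀ : VarBesov.TestFun n 𝕜)
    (A μ : ℝ) (hA : 0 < A) (hμ : 0 < μ) (hμ' : ENNReal.ofReal μ ≤ min 1 (min q r))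
    (hTail : VarBesov.HardyTail (VarBesov.relExp q (ENNReal.ofReal μ))
      (fun k => ((2 : ℝ) ^ ((k : ℝ) * A) * α₁ k) ^ μ))
    (hHead : VarBesov.HardyHead (VarBesov.relExp q (ENNReal.ofReal μ))
      (fun k => ((2 : ℝ) ^ (-((k : ℝ) * (1 + (VarBesov.momentOrder
        (VarBesov.diffKernel ζ₀) : ℝ)))) * α₂ k) ^ μ)) :
    ∃ C : NNReal, 0 < C ∧ ∀ f ∈ VarBesov.ExpDistr n 𝕜,
      VarBesov.besovNorm p q t ζ₀ f ≤ C * VarBesov.besovNorm p q t φ₀ f := by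
  have hμ1 : μ ≤ 1 := by
    have := hμ'.trans (min_le_left _ _)
    rwa [← ENNReal.ofReal_one, ENNReal.ofReal_le_ofReal_iff zero_le_one] at this
  have hμq : ENNReal.ofReal μ ≤ q := hμ'.trans ((min_le_right _ _).trans (min_le_left _ _))
  have hμr : ENNReal.ofReal μ ≤ r := hμ'.trans ((min_le_right _ _).trans (min_le_right _ _))
  have hs : 1 ≤ relExp q (ENNReal.ofReal μ) :=
    one_le_relExp (by simpa using hμ) ENNReal.ofReal_ne_top hμq
  obtain ⟨c₁, hc₁⟩ := exists_le_of_hardyTail hs hμ hα₁ hTail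
  obtain ⟨δ, c₂, hδ, hc₂0, hc₂⟩ := exists_le_of_hardyHead hs hμ hα₂ hHead
  -- Nothing is lost by `toNat`, as the moment order is at least `-1`.
  set l : ℕ := (1 + momentOrder (diffKernel ζ₀)).toNat with hl
  have hlr : (1 + (momentOrder (diffKernel ζ₀) : ℝ)) = l := by
    have h1 := (momentOrder_spec (diffKernel ζ₀)).1
    have h2 : ((l : ℕ) : ℤ) = 1 + momentOrder (diffKernel ζ₀) := by omega
    exact_mod_cast h2.symm
  rw [hlr] at hc₂
  obtain ⟨M, hM⟩ := exists_nat_ge ((2 * (A + 1) * μ + n) / μ)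
  have hM' : 2 * (A + 1) * μ ≤ M * μ - n := by
    rw [div_le_iff₀ hμ] at hM
    linarith
  obtain ⟨C₁, hC₁⟩ := exists_enorm_conv_le_peetreInt hφ₀ (vanishingMoments_diffKernel ζ₀) hμ hμ1 M
    (by linarith : 0 ≤ 2 * (α₃ + 1))
  obtain ⟨C₂, hC₂⟩ := ht.exists_eLpNorm_peetreInt_le (E := 𝕜) hp hμ hμr
    (holderTriple_relExp hr hrp) hα₁ hα₂ hα₃ hA hc₁ hM'
  obtain ⟨C₃, hC₃⟩ := exists_eLpNorm_sum_range_le (ν := (volume : Measure (Eu n))) hp (half_pos hδ)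
  -- A rate dominated both by half of the margin `δ` and by the rate `1/2` of the supremum over
  -- higher levels.
  set ε := min (δ / 2) (1 / 2) with hε
  have hε0 : 0 < ε := by positivity
  obtain ⟨C₄, hC₄⟩ := exists_lN_w_nat_le hq.ne' hε0
  -- The summand `1` only makes the constant positive.
  refine ⟨C₁ * (C₃ * (C₂ * c₂.toNNReal)) * C₄ + 1, by positivity, fun f hf => ?_⟩
  set h : ℕ → Eu n → 𝕜 := fun i x => conv (kernelSeq φ₀ i) f x with hh
  have hcont : ∀ i, Continuous (h i) := fun i => continuous_conv hf _
  set V : ℕ → ℝ≥0∞ := fun i => eLpNorm (fun x => t i x • h i x) p volume with hV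
  set g : ℕ → ℕ → Eu n → ℝ≥0∞ := fun k j x => ‖t k x‖ₑ *
    peetreInt M (2 * (α₃ + 1)) μ (fun i y => ‖h i y‖ₑ) j x ^ (1 / μ) with hg
  have hgm : ∀ k j, AEMeasurable (g k j) volume := fun k j =>
    (ht.admissible.aemeasurable k).enorm.mul
      ((measurable_peetreInt _ _ _ (fun i => (hcont i).measurable.enorm) j).pow_const
        _).aemeasurable
  set B : ℕ → ℝ≥0∞ := fun k => ⨆ i : ℕ, w (-(ε * |(k : ℝ) - i|)) * V i with hB
  have hgB : ∀ k j : ℕ, j ≤ k → w (-(l * (k - j))) * eLpNorm (g k j) p volume ≤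
      w (-(δ / 2 * |(j : ℝ) - k|)) * (C₂ * c₂.toNNReal * B k) := by
    intro k j hjk
    obtain ⟨d, rfl⟩ := Nat.exists_eq_add_of_le hjk
    have h1 := hC₂ h (fun i => (hcont i).aestronglyMeasurable) j (j + d) hjk
    have h2 : ENNReal.ofReal (α₂ (j + d) / α₂ j) ≤ c₂.toNNReal * w ((l - δ) * d) := by
      refine (ENNReal.ofReal_le_ofReal (hc₂ j d)).trans (le_of_eq ?_)
      rw [ENNReal.ofReal_mul hc₂0.le, ofReal_two_rpow]
      rfl
    -- Recentring at the level `k = j + d`: the distance from `k` to `j + i` is at most `d + i`.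
    have h3 : w (-(δ / 2 * d)) * (⨆ i : ℕ, w (-(1 / 2 * i)) * V (j + i)) ≤ B (j + d) := by
      rw [ENNReal.mul_iSup]
      refine iSup_le fun i => ?_
      rw [← mul_assoc, ← w_add]
      refine le_trans ?_ (le_iSup (fun i : ℕ => w (-(ε * |((j + d : ℕ) : ℝ) - i|)) * V i) (j + i))
      refine mul_le_mul' (w_mono ?_) le_rfl
      have h4 : |((j + d : ℕ) : ℝ) - ((j + i : ℕ) : ℝ)| ≤ d + i := by
        push_cast
        rw [abs_le]
        constructor <;> linarith [Nat.cast_nonneg (α := ℝ) d, Nat.cast_nonneg (α := ℝ) i]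
      have h5 : ε * d ≤ δ / 2 * d := by gcongr; exact min_le_left _ _
      have h6 : ε * i ≤ 1 / 2 * i := by gcongr; exact min_le_right _ _
      have h7 := mul_le_mul_of_nonneg_left h4 hε0.le
      linarith
    have h8 : |(j : ℝ) - ((j + d : ℕ) : ℝ)| = d := by
      push_cast
      rw [sub_add_cancel_left, abs_neg, Nat.abs_cast]
    have h9 : (((j + d : ℕ) : ℝ) - j) = d := by push_cast; ring
    rw [h8, h9]
    calc w (-(l * d)) * eLpNorm (g (j + d) j) p volume
        ≤ w (-(l * d)) * (C₂ * (c₂.toNNReal * w ((l - δ) * d)) *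
          ⨆ i : ℕ, w (-(1 / 2 * i)) * V (j + i)) := by
          refine mul_le_mul' le_rfl (h1.trans ?_)
          gcongr
      _ = w (-(δ / 2 * d)) * (C₂ * c₂.toNNReal * (w (-(δ / 2 * d)) *
          ⨆ i : ℕ, w (-(1 / 2 * i)) * V (j + i))) := by
          -- The moments beat the growth of `α₂` by `2^(-δd)`. One half serves the sum over `j`, the
          -- other the recentring.
          have h10 : w (-(l * d)) * w ((l - δ) * d) = w (-(δ / 2 * d)) * w (-(δ / 2 * d)) := by
            rw [← w_add, ← w_add]
            congr 1
            ring
          calc _ = w (-(l * d)) * w ((l - δ) * d) * (C₂ * c₂.toNNReal *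
                ⨆ i : ℕ, w (-(1 / 2 * i)) * V (j + i)) := by ring
            _ = _ := by
                rw [h10]
                ring
      _ ≤ _ := by gcongr
  have hk : ∀ k, eLpNorm (fun x => t k x • conv (kernelSeq ζ₀ k) f x) p volume ≤
      C₁ * (C₃ * (C₂ * c₂.toNNReal)) * B k := fun k => by
    calc _ ≤ C₁ * eLpNorm (fun x => ∑ j ∈ Finset.range (k + 1), w (-(l * (k - j))) * g k j x)
          p volume := by
          refine eLpNorm_le_const_mul hp.ne' ?_ (Filter.Eventually.of_forall fun x => ?_)
          · exact Finset.aemeasurable_fun_sum _ fun j _ => (hgm k j).const_mul _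
          · rw [enorm_smul, enorm_eq_self]
            calc ‖t k x‖ₑ * ‖conv (kernelSeq ζ₀ k) f x‖ₑ ≤ ‖t k x‖ₑ * (C₁ * _) :=
                  mul_le_mul' le_rfl (hC₁ f hf k x)
              _ = _ := by
                  rw [mul_left_comm, Finset.mul_sum]
                  simp only [hg, mul_left_comm]
                  rfl
      _ ≤ C₁ * (C₃ * (C₂ * c₂.toNNReal * B k)) := by
          gcongr
          exact hC₃ k _ (g k) _ (hgm k) (hgB k)
      _ = _ := by ring
  rw [besovNorm, besovNorm, lNorm_univ, lNorm_univ]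
  calc _ ≤ lN q fun k => C₁ * (C₃ * (C₂ * c₂.toNNReal)) * B k := lN_mono hk
    _ ≤ C₁ * (C₃ * (C₂ * c₂.toNNReal)) * (C₄ * lN q V) := by
        rw [lN_const_mul hq.ne']
        gcongr
        exact lN_iSup_mul_le hq.ne' hC₄ V
    _ = ((C₁ * (C₃ * (C₂ * c₂.toNNReal)) * C₄ : ℝ≥0) : ℝ≥0∞) * lN q V := by
        push_cast
        ring
    _ ≤ _ := by
        gcongr
        exact le_self_add
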